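/- Let $d\ge 3$ and let $W$ be a complex vector space with basis $v_1,\dots,v_d$. Let $R$ be the polynomial ring over $\mathbb C$ in the variables $p_{0,ij}=p_{0,ji}$ and $p_{r,st}=p_{r,ts}$ $(1\le i,j,r,s,t\le d)$. Put $P(1)=1$, $P(x_m)=x_m$ and $P(x_ix_j)=p_{0,ij}+\sum_{m=1}^d p_{m,ij}x_m$, extended $R$-linearly to polynomials in $x_1,\dots,x_d$ of degree at most $2$, and for $1\le a,i,j,k\le d$ let $C(a;j,(i,k))\in R$ be the coefficient of $x_a$ in $P(x_kP(x_ix_j))-P(x_iP(x_kx_j))$. (These elements generate the ideal of the chart $V_d$ of $\mathrm{Hilb}^{d+1}(\mathbb C^d)$ of ideals $I$ such that $1,x_1,\dots,x_d$ is a basis of $\mathbb C[x_1,\dots,x_d]/I$.) Let $Y\subset R$ be their $\mathbb C$-linear span, in which $C(a;j,(i,k))=-C(a;j,(k,i))$. The group $GL(W)$ acts on $R$ by algebra automorphisms through $g\cdot p_{0,st}=\sum_{s',t'}g_{s's}g_{t't}\,p_{0,s't'}$ and $g\cdot p_{r,st}=\sum_{r',s',t'}(g^{-1})_{rr'}g_{s's}g_{t't}\,p_{r',s't'}$,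 where $gv_s=\sum_{s'}g_{s's}v_{s'}$; the subspace $Y$ is stable, and we regard it as a representation of $GL(W)$ through this action multiplied by $\det g$. For a partition $\lambda$ let $\mathbb S_\lambda W$ be the Schur functor, and call the sum of all subrepresentations isomorphic to $\mathbb S_\lambda W$ the isotypic component of type $\lambda$. All partitions below are partitions of $d+2$ into $d$ parts, zeros allowed. Let $$T=\textstyle\bigwedge^{d-1}W\otimes W\otimes\bigwedge^2W ,$$ and let $T'\subset T$ be the sum of its isotypic components of types $(2,2,1,\dots,1,1)$ and, if $d\ge4$, $(2,2,2,1,\dots,1,0)$. Then: 1. There is exactly one $GL(W)$-equivariant linear map $\varphi:Y\to T$ such that, for all $a,i,j,k$, $$\varphi\big(C(a;j,(i,k))\big)\equiv(-1)^a(v_1\wedge\cdots\wedge\widehat{v_a}\wedge\cdots\wedge v_d)\otimes v_j\otimes(v_i\wedge v_k)\pmod{T'} .$$ 2. The map $\varphi$ is injective, and $T=\varphi(Y)\oplus T'$; so $\varphi(Y)$ avoids the remaining isotypic components. 3. There is an isomorphism of $GL(W)$-representations $$e:\ Y\ \xrightarrow{\ \sim\ }\ \mathbb S_{(3,2,1,\dots,1,0)}W\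 \oplus\ \mathbb S_{(3,1,1,\dots,1,1)}W$$ such that $\varphi$ maps the first (second) summand, transported to $Y$ by $e$, onto the isotypic component of $T$ of type $(3,2,1,\dots,1,0)$ (of type $(3,1,1,\dots,1,1)$). -/

import Mathlib

open scoped TensorProduct

namespace HilbertSymmetric

noncomputable section

/-! ### Representations of `GL(W)` and Schur functors -/

section Schur

variable (W : Type*) [AddCommGroup W] [Module ℂ W]

/-- The group `GL(W)`. -/
abbrev GLW := LinearMap.GeneralLinearGroup ℂ W

/-- The tautological representation of `GL(W)` on `W`. -/
def stdRep : Representation ℂ (GLW W) W := Units.coeHom (W →ₗ[ℂ] W)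

/-- The representation of `GL(W)` on the exterior power `⋀^n W`. -/
def extRep (n : ℕ) : Representation ℂ (GLW W) (⋀[ℂ]^n W) where
  toFun g := exteriorPower.map n (stdRep W g)
  map_one' := by
    rw [map_one]
    exact exteriorPower.map_id
  map_mul' g h := by
    rw [map_mul]
    exact exteriorPower.map_comp (stdRep W h) (stdRep W g)

/-- The tensor power of `W` with one factor for each cell of the Young diagram `μ`. -/
abbrev CellTensor (μ : YoungDiagram) := ⨂[ℂ] _ : μ.cells, W

/-- The diagonal representation of `GL(W)` on the tensor power indexed by the cells of `μ`. -/
def cellRep (μ : YoungDiagram) : Representation ℂ (GLW W) (CellTensor W μ) where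
  toFun g := PiTensorProduct.map fun _ => stdRep W g
  map_one' := by
    rw [map_one]
    exact PiTensorProduct.map_one
  map_mul' g h := by
    rw [map_mul]
    exact PiTensorProduct.map_mul _ _

/-- The permutation of the tensor factors given by a permutation of the cells. -/
def permCells (μ : YoungDiagram) (σ : Equiv.Perm μ.cells) : CellTensor W μ →ₗ[ℂ] CellTensor W μ :=
  (PiTensorProduct.reindex ℂ (fun _ : μ.cells => W) σ).toLinearMap

/-- The action of `a_μ = ∑ σ`, summed over the permutations of the cells preserving each row. -/
def rowSymmetrizer (μ : YoungDiagram) : CellTensor W μ →ₗ[ℂ] CellTensor W μ :=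
  ∑ σ : Equiv.Perm μ.cells with ∀ c, (σ c).1.1 = c.1.1, permCells W μ σ

/-- The action of `b_μ = ∑ sgn(τ) τ`, summed over the permutations of the cells preserving each
column. -/
def colAntisymmetrizer (μ : YoungDiagram) : CellTensor W μ →ₗ[ℂ] CellTensor W μ :=
  ∑ τ : Equiv.Perm μ.cells with ∀ c, (τ c).1.2 = c.1.2,
    ((Equiv.Perm.sign τ : ℤ) : ℂ) • permCells W μ τ

/-- The action of the Young symmetrizer `c_μ = a_μ b_μ`. -/
def youngSymmetrizer (μ : YoungDiagram) : CellTensor W μ →ₗ[ℂ] CellTensor W μ :=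
  rowSymmetrizer W μ ∘ₗ colAntisymmetrizer W μ

theorem permCells_cellRep (μ : YoungDiagram) (σ : Equiv.Perm μ.cells) (g : GLW W)
    (x : CellTensor W μ) :
    permCells W μ σ (cellRep W μ g x) = cellRep W μ g (permCells W μ σ x) :=
  (PiTensorProduct.map_reindex (fun _ : μ.cells => stdRep W g) σ x).symm

theorem youngSymmetrizer_cellRep (μ : YoungDiagram) (g : GLW W) (x : CellTensor W μ) :
    youngSymmetrizer W μ (cellRep W μ g x) = cellRep W μ g (youngSymmetrizer W μ x) := by
  simp only [youngSymmetrizer, rowSymmetrizer, colAntisymmetrizer, LinearMap.comp_apply,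
    LinearMap.sum_apply, LinearMap.smul_apply, permCells_cellRep, map_sum, map_smul]

/-- The Schur functor `𝕊_μ W`: the image of the Young symmetrizer `c_μ` on the tensor power. -/
def schur (μ : YoungDiagram) : Subrepresentation (cellRep W μ) where
  toSubmodule := LinearMap.range (youngSymmetrizer W μ)
  apply_mem_toSubmodule g := by
    rintro _ ⟨x, rfl⟩
    exact ⟨cellRep W μ g x, youngSymmetrizer_cellRep W μ g x⟩

/-- `𝕊_μ W` as a representation of `GL(W)`. -/
abbrev schurRep (μ : YoungDiagram) : Representation ℂ (GLW W) (schur W μ).toSubmodule :=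
  (schur W μ).toRepresentation

/-- The representation `⋀^{d-1} W ⊗ W ⊗ ⋀² W` of `GL(W)`. -/
abbrev ambientRep (d : ℕ) :
    Representation ℂ (GLW W) (⋀[ℂ]^(d - 1) W ⊗[ℂ] (W ⊗[ℂ] ⋀[ℂ]^2 W)) :=
  (extRep W (d - 1)).tprod ((stdRep W).tprod (extRep W 2))

end Schur

/-- The `σ`-isotypic component of a representation `ρ`: the sum of all subrepresentations of `ρ`
that are isomorphic to `σ`. -/
def isotypic {G V U : Type*} [Group G] [AddCommMonoid V] [Module ℂ V] [AddCommMonoid U]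
    [Module ℂ U] (ρ : Representation ℂ G V) (σ : Representation ℂ G U) : Submodule ℂ V :=
  ⨆ (N : Subrepresentation ρ) (_ : Nonempty (N.toRepresentation.Equiv σ)), N.toSubmodule

/-! ### The four partitions of `d + 2` -/

section Partitions

/-- `(3, 2, 1, …, 1, 0)`, a partition of `d + 2` into `d` parts, for `3 ≤ d`. -/
def shape321 (d : ℕ) : YoungDiagram :=
  YoungDiagram.ofRowLens ([3, 2] ++ List.replicate (d - 3) 1 ++ [0])
    (by
      simp only [List.sortedGE_iff_pairwise, List.pairwise_append, List.pairwise_replicate]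
      grind)

/-- `(3, 1, 1, …, 1, 1)`, a partition of `d + 2` into `d` parts, for `1 ≤ d`. -/
def shape311 (d : ℕ) : YoungDiagram :=
  YoungDiagram.ofRowLens ([3] ++ List.replicate (d - 1) 1)
    (by simp [List.sortedGE_iff_pairwise, List.pairwise_replicate])

/-- `(2, 2, 1, …, 1, 1)`, a partition of `d + 2` into `d` parts, for `2 ≤ d`. -/
def shape221 (d : ℕ) : YoungDiagram :=
  YoungDiagram.ofRowLens ([2, 2] ++ List.replicate (d - 2) 1)
    (by simp [List.sortedGE_iff_pairwise, List.pairwise_replicate])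

/-- `(2, 2, 2, 1, …, 1, 0)`, a partition of `d + 2` into `d` parts, for `4 ≤ d`. -/
def shape222 (d : ℕ) : YoungDiagram :=
  YoungDiagram.ofRowLens ([2, 2, 2] ++ List.replicate (d - 4) 1 ++ [0])
    (by
      simp only [List.sortedGE_iff_pairwise, List.pairwise_append, List.pairwise_replicate]
      grind)

variable (W : Type*) [AddCommGroup W] [Module ℂ W]

/-- The sum of the isotypic components of types `(2, 2, 1, …, 1, 1)` and, if `4 ≤ d`,
`(2, 2, 2, 1, …, 1, 0)` of `⋀^{d-1} W ⊗ W ⊗ ⋀² W`. -/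
def remainingIsotypic (d : ℕ) : Submodule ℂ (⋀[ℂ]^(d - 1) W ⊗[ℂ] (W ⊗[ℂ] ⋀[ℂ]^2 W)) :=
  isotypic (ambientRep W d) (schurRep W (shape221 d)) ⊔
    ⨆ _ : 4 ≤ d, isotypic (ambientRep W d) (schurRep W (shape222 d))

end Partitions

/-! ### The generators `C(a; j, (i, k))` -/

section Generators

variable (d : ℕ)

/-- The polynomial ring `R` in the coordinates `p_{0,ij} = p_{0,ji}` (first index `none`) and
`p_{r,st} = p_{r,ts}` (first index `some r`). -/
abbrev R := MvPolynomial (Option (Fin d) × Sym2 (Fin d)) ℂ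

variable {d}

/-- The coordinate `p_{r,st}`. -/
def p (r : Option (Fin d)) (s t : Fin d) : R d := MvPolynomial.X (r, s(s, t))

/-- The coefficients of `P(x_i x_j) = p_{0,ij} + ∑ m, p_{m,ij} x_m`. A form
`ℓ_0 + ∑ m, ℓ_m x_m` over `R` is recorded by its coefficients `ℓ : Option (Fin d) → R d`. -/
def projQuad (i j : Fin d) : Option (Fin d) → R d := fun r => p r i j

/-- The coefficients of `P(x_k ℓ) = ℓ_0 x_k + ∑ m, ℓ_m P(x_k x_m)`, for a form
`ℓ = ℓ_0 + ∑ m, ℓ_m x_m`; here `P` is linear and fixes `1, x_1, …, x_d`. -/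
def projMul (k : Fin d) (l : Option (Fin d) → R d) : Option (Fin d) → R d := fun r =>
  l none * (if r = some k then 1 else 0) + ∑ m : Fin d, l (some m) * projQuad k m r

/-- `C(a; j, (i, k))`: the coefficient of `x_a` in `P(x_k P(x_i x_j)) - P(x_i P(x_k x_j))`. -/
def C (a j i k : Fin d) : R d :=
  projMul k (projQuad i j) (some a) - projMul i (projQuad k j) (some a)

theorem C_antisymm (a j i k : Fin d) : C a j i k + C a j k i = 0 := by
  simp [C]

/-- The linear span in `R` of the generators; by `C_antisymm` the relations
`C(a; j, (i, k)) + C(a; j, (k, i)) = 0` hold in it. -/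
def Yspan (d : ℕ) : Submodule ℂ (R d) :=
  Submodule.span ℂ {f | ∃ a j i k : Fin d, f = C a j i k}

variable {W : Type*} [AddCommGroup W] [Module ℂ W] (v : Module.Basis (Fin d) ℂ W)

/-- The matrix of `g` in the basis `v`, so that `g v_s = ∑ s', (mat v g s' s) v_{s'}`. -/
def mat (g : GLW W) : Matrix (Fin d) (Fin d) ℂ := LinearMap.toMatrix v v (stdRep W g)

/-- The matrix of `1 ⊕ g` on `ℂ ⊕ W` in the basis consisting of `1` and of `v`. -/
def extMat (g : GLW W) : Matrix (Option (Fin d)) (Option (Fin d)) ℂ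
  | none, none => 1
  | some r, some s => mat v g r s
  | _, _ => 0

/-- `g · p_{r,st} = ∑ (g⁻¹)_{rr'} g_{s's} g_{t't} p_{r',s't'}` for `r ≠ 0`, and
`g · p_{0,st} = ∑ g_{s's} g_{t't} p_{0,s't'}`. -/
def actVar (g : GLW W) (s t : Fin d) (r : Option (Fin d)) : R d :=
  ∑ r', extMat v g⁻¹ r r' • ∑ s', ∑ t', (mat v g s' s * mat v g t' t) • p r' s' t'

theorem p_comm (r : Option (Fin d)) (s t : Fin d) : p r s t = p r t s := by
  simp [p, Sym2.eq_swap]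

theorem actVar_comm (g : GLW W) (s t : Fin d) (r : Option (Fin d)) :
    actVar v g s t r = actVar v g t s r := by
  refine Finset.sum_congr rfl fun r' _ => ?_
  congr 1
  rw [Finset.sum_comm]
  exact Finset.sum_congr rfl fun x _ => Finset.sum_congr rfl fun y _ => by
    rw [p_comm r' y x, mul_comm]

/-- The action of `g ∈ GL(W)` on `R` by algebra homomorphisms that is induced, with `x_i = v_i`, by
the linear changes of coordinates `P ↦ g P g⁻¹` of the projectors `P`: for a function `f` of `P`,
`(g · f)(P) = f (g⁻¹ P g)`. -/
def actAlg (g : GLW W) : R d →ₐ[ℂ] R d :=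
  MvPolynomial.aeval fun q => Sym2.lift
    ⟨fun s t => actVar v g s t q.1, fun s t => actVar_comm v g s t q.1⟩ q.2

theorem actAlg_p (g : GLW W) (r : Option (Fin d)) (s t : Fin d) :
    actAlg v g (p r s t) = actVar v g s t r := by
  simp [actAlg, p]

theorem mat_one : mat v (1 : GLW W) = 1 := by
  simp [mat, Module.End.one_eq_id]

theorem mat_mul (g h : GLW W) : mat v (g * h) = mat v g * mat v h := by
  simp [mat, LinearMap.toMatrix_mul]

theorem extMat_one : extMat v (1 : GLW W) = 1 := by
  ext (_ | r) (_ | s) <;> simp [extMat, mat_one, Matrix.one_apply]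

theorem extMat_mul (g h : GLW W) : extMat v (g * h) = extMat v g * extMat v h := by
  ext (_ | r) (_ | s) <;> simp [extMat, mat_mul, Matrix.mul_apply, Fintype.sum_option]

theorem actAlg_one : actAlg v (1 : GLW W) = AlgHom.id ℂ (R d) := by
  refine MvPolynomial.algHom_ext fun ⟨r, q⟩ => ?_
  induction q with
  | _ s t =>
    change actAlg v 1 (p r s t) = p r s t
    rw [actAlg_p]
    simp only [actVar, inv_one, extMat_one, mat_one, Matrix.one_apply, ite_mul, one_mul, zero_mul,
      ite_smul, one_smul, zero_smul, Finset.sum_ite_eq, Finset.sum_ite_eq', Finset.mem_univ,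
      if_true, Finset.sum_ite_irrel, Finset.sum_const_zero]

/-- The matrix of the operator `ℓ ↦ P(x_k ℓ)` on the span of `1, x_1, …, x_d`. -/
def mulMat (k : Fin d) : Matrix (Option (Fin d)) (Option (Fin d)) (R d)
  | r, none => if r = some k then 1 else 0
  | r, some m => p r k m

theorem C_eq_mulMat (a j i k : Fin d) :
    C a j i k = (mulMat k * mulMat i - mulMat i * mulMat k) (some a) (some j) := by
  simp [C, projMul, projQuad, mulMat, Matrix.mul_apply, Fintype.sum_option, mul_comm]

/-- A complex matrix, as a matrix over `R`. -/
def scalarMat (A : Matrix (Option (Fin d)) (Option (Fin d)) ℂ) :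
    Matrix (Option (Fin d)) (Option (Fin d)) (R d) := A.map (algebraMap ℂ (R d))

theorem scalarMat_apply (A : Matrix (Option (Fin d)) (Option (Fin d)) ℂ) (r s : Option (Fin d)) :
    scalarMat A r s = algebraMap ℂ (R d) (A r s) :=
  rfl

theorem scalarMat_mul (A B : Matrix (Option (Fin d)) (Option (Fin d)) ℂ) :
    scalarMat (A * B) = scalarMat A * scalarMat B :=
  Matrix.map_mul

theorem scalarMat_one : scalarMat (1 : Matrix (Option (Fin d)) (Option (Fin d)) ℂ) = 1 :=
  Matrix.map_one _ (map_zero _) (map_one _)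

theorem actAlg_scalarMat (g : GLW W) (A : Matrix (Option (Fin d)) (Option (Fin d)) ℂ) :
    (actAlg v g).mapMatrix (scalarMat A) = scalarMat A := by
  ext r s : 2
  simp [scalarMat]

theorem scalarMat_inv_mul (g : GLW W) :
    scalarMat (extMat v g⁻¹) * scalarMat (extMat v g) = 1 := by
  rw [← scalarMat_mul, ← extMat_mul, inv_mul_cancel, extMat_one, scalarMat_one]

theorem scalarMat_mul_inv (g : GLW W) :
    scalarMat (extMat v g) * scalarMat (extMat v g⁻¹) = 1 := by
  rw [← scalarMat_mul, ← extMat_mul, mul_inv_cancel, extMat_one, scalarMat_one]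

theorem mulMat_scalarMat_none (g : GLW W) (k : Fin d) (r : Option (Fin d)) :
    (mulMat k * scalarMat (extMat v g)) r none = if r = some k then 1 else 0 := by
  rw [Matrix.mul_apply, Fintype.sum_option]
  simp [mulMat, scalarMat, extMat]

theorem mulMat_scalarMat_some (g : GLW W) (k m : Fin d) (r : Option (Fin d)) :
    (mulMat k * scalarMat (extMat v g)) r (some m) = ∑ m', mat v g m' m • p r k m' := by
  rw [Matrix.mul_apply, Fintype.sum_option]
  simp [mulMat, scalarMat, extMat, Algebra.smul_def, mul_comm]

theorem actAlg_mulMat (g : GLW W) (k : Fin d) :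
    (actAlg v g).mapMatrix (mulMat k) =
      ∑ k', mat v g k' k •
        (scalarMat (extMat v g⁻¹) * mulMat k' * scalarMat (extMat v g)) := by
  refine Matrix.ext fun r s => ?_
  simp only [AlgHom.mapMatrix_apply, Matrix.map_apply, Matrix.sum_apply, Matrix.smul_apply,
    Matrix.mul_assoc]
  cases s with
  | none =>
    have h1 := congrFun (congrFun (scalarMat_inv_mul v g) r) (some k)
    rw [Matrix.mul_apply, Fintype.sum_option] at h1
    simp only [scalarMat_apply, show extMat v g none (some k) = 0 from rfl, map_zero,
      mul_zero, zero_add, Matrix.one_apply] at h1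
    have h2 : actAlg v g (mulMat k r none) = if r = some k then 1 else 0 := by
      simp [mulMat, apply_ite (actAlg v g)]
    rw [h2, ← h1]
    refine Finset.sum_congr rfl fun x _ => ?_
    rw [Matrix.mul_apply]
    simp only [mulMat_scalarMat_none, mul_ite, mul_one, mul_zero, Finset.sum_ite_eq',
      Finset.mem_univ, if_true, scalarMat_apply, Algebra.smul_def]
    rw [mul_comm]
    rfl
  | some m =>
    change actAlg v g (p r k m) = _
    rw [actAlg_p, actVar]
    have h3 : ∀ k', (scalarMat (extMat v g⁻¹) * (mulMat k' * scalarMat (extMat v g))) r (some m) =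
        ∑ r', scalarMat (extMat v g⁻¹) r r' * ∑ m', mat v g m' m • p r' k' m' := fun k' => by
      rw [Matrix.mul_apply]
      simp only [mulMat_scalarMat_some]
    simp only [h3, scalarMat_apply, Finset.mul_sum, Algebra.smul_def, map_mul]
    rw [Finset.sum_comm]
    refine Finset.sum_congr rfl fun x _ => Finset.sum_congr rfl fun y _ =>
      Finset.sum_congr rfl fun z _ => ?_
    ring

theorem actAlg_mul (g h : GLW W) : actAlg v (g * h) = (actAlg v g).comp (actAlg v h) := by
  refine MvPolynomial.algHom_ext fun ⟨r, q⟩ => ?_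
  induction q with
  | _ s t =>
    have key : (actAlg v (g * h)).mapMatrix (mulMat s) =
        (actAlg v g).mapMatrix ((actAlg v h).mapMatrix (mulMat s)) := by
      simp only [actAlg_mulMat, map_sum, map_smul, map_mul, actAlg_scalarMat, mul_inv_rev,
        extMat_mul, scalarMat_mul, mat_mul, Matrix.mul_apply, Finset.sum_smul, Finset.mul_sum,
        Finset.sum_mul, Finset.smul_sum, mul_smul, Matrix.mul_smul, Matrix.smul_mul]
      rw [Finset.sum_comm]
      refine Finset.sum_congr rfl fun x _ => Finset.sum_congr rfl fun y _ => ?_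
      rw [smul_comm]
      simp only [Matrix.mul_assoc]
    exact congrFun (congrFun key r) (some t)

/-- The natural representation of `GL(W)` on `R`, by algebra automorphisms. -/
def coordRep : Representation ℂ (GLW W) (R d) where
  toFun g := (actAlg v g).toLinearMap
  map_one' := by rw [actAlg_one]; rfl
  map_mul' g h := by rw [actAlg_mul]; rfl

/-- The representation `det ⊗ R` of `GL(W)`: the natural action on `R`, twisted by the
determinant. -/
def twistedRep : Representation ℂ (GLW W) (R d) where
  toFun g := LinearMap.det (stdRep W g) • coordRep v g
  map_one' := by simp
  map_mul' g h := by
    simp only [map_mul]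
    rw [smul_mul_smul_comm]

theorem actAlg_comm (g : GLW W) (i k : Fin d) :
    (actAlg v g).mapMatrix (mulMat k * mulMat i - mulMat i * mulMat k) =
      ∑ k', ∑ i', (mat v g k' k * mat v g i' i) • (scalarMat (extMat v g⁻¹) *
        ((mulMat k' * mulMat i' - mulMat i' * mulMat k') * scalarMat (extMat v g))) := by
  have h : ∀ x y : Fin d,
      scalarMat (extMat v g⁻¹) * mulMat x * scalarMat (extMat v g) *
        (scalarMat (extMat v g⁻¹) * mulMat y * scalarMat (extMat v g)) =
      scalarMat (extMat v g⁻¹) * (mulMat x * mulMat y * scalarMat (extMat v g)) := fun x y => by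
    simp only [Matrix.mul_assoc]
    rw [← Matrix.mul_assoc (scalarMat (extMat v g)), scalarMat_mul_inv, Matrix.one_mul]
  have h' : ∀ x y : Fin d, (actAlg v g).mapMatrix (mulMat x * mulMat y) =
      ∑ x', ∑ y', (mat v g x' x * mat v g y' y) • (scalarMat (extMat v g⁻¹) *
        (mulMat x' * mulMat y' * scalarMat (extMat v g))) := fun x y => by
    rw [map_mul, actAlg_mulMat, actAlg_mulMat, Finset.sum_mul_sum]
    refine Finset.sum_congr rfl fun x' _ => Finset.sum_congr rfl fun y' _ => ?_
    rw [smul_mul_smul_comm, h]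
  rw [map_sub, h', h', Finset.sum_comm (f := fun x' y' => (mat v g x' i * mat v g y' k) • _),
    ← Finset.sum_sub_distrib]
  refine Finset.sum_congr rfl fun x' _ => ?_
  rw [← Finset.sum_sub_distrib]
  refine Finset.sum_congr rfl fun y' _ => ?_
  rw [mul_comm (mat v g y' i), ← smul_sub, Matrix.sub_mul, Matrix.mul_sub]

theorem conj_apply (g : GLW W) (A : Matrix (Option (Fin d)) (Option (Fin d)) (R d))
    (a j : Fin d) :
    (scalarMat (extMat v g⁻¹) * (A * scalarMat (extMat v g))) (some a) (some j) =
      ∑ a', ∑ j', (mat v g⁻¹ a a' * mat v g j' j) • A (some a') (some j') := by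
  rw [Matrix.mul_apply, Fintype.sum_option, scalarMat_apply,
    show extMat v g⁻¹ (some a) none = 0 from rfl, map_zero, zero_mul, zero_add]
  refine Finset.sum_congr rfl fun a' _ => ?_
  rw [Matrix.mul_apply, Fintype.sum_option, scalarMat_apply _ none,
    show extMat v g none (some j) = 0 from rfl, map_zero, mul_zero, zero_add, Finset.mul_sum]
  refine Finset.sum_congr rfl fun j' _ => ?_
  rw [scalarMat_apply, scalarMat_apply, Algebra.smul_def, map_mul,
    show extMat v g⁻¹ (some a) (some a') = mat v g⁻¹ a a' from rfl,
    show extMat v g (some j') (some j) = mat v g j' j from rfl]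
  ring

theorem actAlg_C (g : GLW W) (a j i k : Fin d) :
    actAlg v g (C a j i k) = ∑ k', ∑ i', (mat v g k' k * mat v g i' i) • ∑ a', ∑ j',
      (mat v g⁻¹ a a' * mat v g j' j) • C a' j' i' k' := by
  have hh := congrFun (congrFun (actAlg_comm v g i k) (some a)) (some j)
  rw [AlgHom.mapMatrix_apply, Matrix.map_apply, ← C_eq_mulMat] at hh
  rw [hh]
  simp only [Matrix.sum_apply, Matrix.smul_apply, conj_apply, C_eq_mulMat]

/-- The representation `Y` of `GL(W)` spanned by the `C(a; j, (i, k))`, as a subrepresentation of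
`det ⊗ R`. -/
def Y : Subrepresentation (twistedRep v) where
  toSubmodule := Yspan d
  apply_mem_toSubmodule g := by
    intro f hf
    refine Submodule.smul_mem _ _ ?_
    induction hf using Submodule.span_induction with
    | mem x hx =>
      obtain ⟨a, j, i, k, rfl⟩ := hx
      change actAlg v g (C a j i k) ∈ _
      rw [actAlg_C]
      exact Submodule.sum_mem _ fun k' _ => Submodule.sum_mem _ fun i' _ =>
        Submodule.smul_mem _ _ <| Submodule.sum_mem _ fun a' _ => Submodule.sum_mem _ fun j' _ =>
        Submodule.smul_mem _ _ (Submodule.subset_span ⟨a', j', i', k', rfl⟩)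
    | zero => simp
    | add x y _ _ hx hy => rw [map_add]; exact Submodule.add_mem _ hx hy
    | smul c x _ hx => rw [map_smul]; exact Submodule.smul_mem _ _ hx

/-- `Y` as a representation of `GL(W)`. -/
abbrev Yrep : Representation ℂ (GLW W) (Y v).toSubmodule := (Y v).toRepresentation

/-- `C(a; j, (i, k))` as an element of `Y`. -/
def genY (a j i k : Fin d) : (Y v).toSubmodule :=
  ⟨C a j i k, Submodule.subset_span ⟨a, j, i, k, rfl⟩⟩

/-- `v_1 ∧ ⋯ ∧ v_d` with the factor `v_a` omitted. -/
def wedgeOmit (a : Fin d) : ⋀[ℂ]^(d - 1) W :=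
  exteriorPower.ιMulti ℂ (d - 1) fun b : Fin (d - 1) =>
    v ⟨if (b : ℕ) < a then b else b + 1, by split <;> omega⟩

/-- `(-1)^a (v_1 ∧ ⋯ ∧ v̂_a ∧ ⋯ ∧ v_d) ⊗ v_j ⊗ (v_i ∧ v_k)`, where the indices, which run through
`0, …, d - 1` here, are counted from `1` in the sign. -/
def genT (a j i k : Fin d) : ⋀[ℂ]^(d - 1) W ⊗[ℂ] (W ⊗[ℂ] ⋀[ℂ]^2 W) :=
  (-1 : ℂ) ^ ((a : ℕ) + 1) •
    (wedgeOmit v a ⊗ₜ[ℂ] (v j ⊗ₜ[ℂ] exteriorPower.ιMulti ℂ 2 ![v i, v k]))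

end Generators

end

end HilbertSymmetric

/-!
Twisting by `det`, the space `T` is `W* ⊗ W ⊗ ⋀² W`, spanned by elements `t(α; w, x, y)` that are
alternating in `x` and `y`, where `genT v a j i k` is `t(v_a^*; v_j, v_i, v_k)`. It decomposes into
the constituents of types `(3, 2, 1, …, 1, 0)` and `(3, 1, …, 1)`, two constituents of type
`(2, 2, 1, …, 1)` and, if `4 ≤ d`, one of type `(2, 2, 2, 1, …, 1, 0)`. Each is the span of the
`GL(W)`-orbit of one vector `u` and is isomorphic to the Schur module of its type. An equivariant
map from such a span to `T` is determined by the image of `u`, which is an eigenvector of every `g`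
that has `u` as an eigenvector, for the same eigenvalue; such vectors lie in the constituents of the
same type, which identifies the isotypic components.

The map `Q : T → Y` that sends the elements `genT` to the elements `C` is well defined, equivariant
and surjective. The traces and the cyclic sums of the `C` vanish, so that `Q` kills the constituents
of the last two types, and evaluation at symmetric matrices shows that it is injective on the other
two. Hence `ker Q = T'`, and `φ` is the only equivariant section of `Q`.
-/

namespace HilbertSymmetric

noncomputable section

open Module

section Wedge

variable {K M N : Type*} [CommRing K] [AddCommGroup M] [Module K M] [AddCommGroup N] [Module K N]

/-- The exterior product `x ∧ y` as a bilinear map. -/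
def wedgePair : M →ₗ[K] M →ₗ[K] ⋀[K]^2 M :=
  LinearMap.mk₂ K (fun x y => exteriorPower.ιMulti K 2 ![x, y])
    (fun x x' y => (exteriorPower.ιMulti K 2).map_vecCons_add ![y] x x')
    (fun c x y => (exteriorPower.ιMulti K 2).map_vecCons_smul ![y] c x)
    (fun x y y' => ((exteriorPower.ιMulti K 2).curryLeft x).map_vecCons_add ![] y y')
    (fun c x y => ((exteriorPower.ιMulti K 2).curryLeft x).map_vecCons_smul ![] c y)

theorem wedgePair_apply (x y : M) : wedgePair x y = exteriorPower.ιMulti K 2 ![x, y] := rfl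

theorem wedgePair_self (x : M) : wedgePair (K := K) x x = 0 :=
  (exteriorPower.ιMulti K 2).map_eq_zero_of_eq ![x, x] (i := 0) (j := 1) rfl (by simp)

theorem map_wedgePair (f : M →ₗ[K] N) (x y : M) :
    exteriorPower.map 2 f (wedgePair x y) = wedgePair (f x) (f y) := by
  rw [wedgePair_apply, wedgePair_apply, exteriorPower.map_apply_ιMulti]
  congr 1
  ext i
  fin_cases i <;> rfl

theorem span_wedgePair :
    Submodule.span K {ω : ⋀[K]^2 M | ∃ x y, ω = wedgePair x y} = ⊤ := by
  rw [eq_top_iff, ← exteriorPower.ιMulti_span]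
  refine Submodule.span_mono ?_
  rintro _ ⟨u, rfl⟩
  exact ⟨u 0, u 1, congrArg _ (by ext i; fin_cases i <;> rfl)⟩

/-- The linear form on an exterior power given by a family of covectors. -/
def wedgeForm {m : ℕ} (F : Fin m → Dual K M) : ⋀[K]^m M →ₗ[K] K :=
  exteriorPower.pairingDual K M m (exteriorPower.ιMulti K m F)

theorem wedgeForm_ιMulti {m : ℕ} (F : Fin m → Dual K M) (y : Fin m → M) :
    wedgeForm F (exteriorPower.ιMulti K m y) = (Matrix.of fun i j => F i (y j)).det := by
  rw [wedgeForm, exteriorPower.pairingDual_ιMulti_ιMulti, ← Matrix.det_transpose]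
  rfl

theorem wedgeForm_wedgePair (β γ : Dual K M) (x y : M) :
    wedgeForm ![β, γ] (wedgePair x y) = β x * γ y - β y * γ x := by
  rw [wedgePair_apply, wedgeForm_ιMulti, Matrix.det_fin_two]
  simp

theorem wedgeForm_map {m : ℕ} (F : Fin m → Dual K N) (f : M →ₗ[K] N) (ω : ⋀[K]^m M) :
    wedgeForm F (exteriorPower.map m f ω) = wedgeForm (fun i => F i ∘ₗ f) ω := by
  suffices wedgeForm F ∘ₗ exteriorPower.map m f = wedgeForm fun i => F i ∘ₗ f from
    LinearMap.congr_fun this ω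
  refine exteriorPower.linearMap_ext (AlternatingMap.ext fun y => ?_)
  simp only [LinearMap.compAlternatingMap_apply, LinearMap.comp_apply,
    exteriorPower.map_apply_ιMulti, wedgeForm_ιMulti, Function.comp_apply]

theorem det_covectors_comp {ι : Type*} [Fintype ι] [DecidableEq ι] (v : Basis ι K M)
    (F : ι → Dual K M) (f : M →ₗ[K] M) :
    (Matrix.of fun i j => F i (f (v j))).det =
      LinearMap.det f * (Matrix.of fun i j => F i (v j)).det := by
  rw [← LinearMap.det_toMatrix v f, mul_comm, ← Matrix.det_mul]
  congr 1
  ext i j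
  rw [Matrix.mul_apply, Matrix.of_apply, ← v.sum_repr (f (v j)), map_sum]
  exact Finset.sum_congr rfl fun k _ => by
    rw [map_smul, smul_eq_mul, mul_comm, LinearMap.toMatrix_apply]; rfl

end Wedge

section OmitIndex

variable {d : ℕ}

/-- The increasing enumeration of the indices different from `a`, as it occurs in `wedgeOmit`. -/
def omitIdx (a : Fin d) (b : Fin (d - 1)) : Fin d :=
  ⟨if (b : ℕ) < a then b else b + 1, by split <;> omega⟩

theorem omitIdx_injective (a : Fin d) : Function.Injective (omitIdx a) := by
  intro b c h
  simp only [omitIdx, Fin.mk.injEq] at h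
  ext
  split_ifs at h <;> omega

theorem omitIdx_ne (a : Fin d) (b : Fin (d - 1)) : omitIdx a b ≠ a := by
  intro h
  have := congrArg Fin.val h
  simp only [omitIdx] at this
  split_ifs at this <;> omega

theorem exists_omitIdx_eq {a c : Fin d} (h : c ≠ a) : ∃ b, omitIdx a b = c := by
  have h' : (c : ℕ) ≠ a := fun e => h (Fin.ext e)
  by_cases hc : (c : ℕ) < a
  · exact ⟨⟨c, by omega⟩, by ext; simp [omitIdx, hc]⟩
  · refine ⟨⟨c - 1, by omega⟩, ?_⟩
    ext
    simp only [omitIdx]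
    split_ifs <;> omega

theorem omitIdx_eq_succAbove {n : ℕ} (a : Fin (n + 1)) (b : Fin n) :
    omitIdx a b = a.succAbove b := by
  ext
  simp only [omitIdx, Fin.succAbove, Fin.lt_def, Fin.val_castSucc]
  split_ifs <;> simp

end OmitIndex

section DualWedge

variable {d : ℕ} {W : Type*} [AddCommGroup W] [Module ℂ W]

theorem wedgeForm_wedgeOmit (v : Basis (Fin d) ℂ W) (a b : Fin d) :
    wedgeForm (fun i => v.coord (omitIdx a i)) (wedgeOmit v b) = if a = b then 1 else 0 := by
  refine (wedgeForm_ιMulti _ fun j => v (omitIdx b j)).trans ?_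
  split_ifs with h
  · subst h
    rw [← Matrix.det_one (n := Fin (d - 1))]
    congr 1
    ext i j
    simp [Matrix.one_apply, Finsupp.single_apply, (omitIdx_injective a).eq_iff, eq_comm]
  · obtain ⟨j, hj⟩ := exists_omitIdx_eq h
    refine Matrix.det_eq_zero_of_column_eq_zero j fun i => ?_
    simp [hj, Finsupp.single_apply, (omitIdx_ne a i).symm]

theorem linearIndependent_wedgeOmit (v : Basis (Fin d) ℂ W) :
    LinearIndependent ℂ (wedgeOmit v) :=
  LinearIndependent.of_pairwise_dual_eq_zero_one _
    (fun a => wedgeForm fun i => v.coord (omitIdx a i))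
    (fun a b h => (wedgeForm_wedgeOmit v a b).trans (if_neg h))
    (fun a => (wedgeForm_wedgeOmit v a a).trans (if_pos rfl))

/-- The vectors `wedgeOmit v a` as a basis of `⋀^{d-1} W`. -/
def wedgeOmitBasis [NeZero d] (v : Basis (Fin d) ℂ W) : Basis (Fin d) ℂ (⋀[ℂ]^(d - 1) W) :=
  have : Module.Finite ℂ W := .of_basis v
  basisOfLinearIndependentOfCardEqFinrank (linearIndependent_wedgeOmit v) <| by
    rw [exteriorPower.finrank_eq, Module.finrank_eq_card_basis v, Fintype.card_fin,
      Nat.choose_symm (n := d) (k := 1) NeZero.one_le, Nat.choose_one_right]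

theorem wedgeOmitBasis_apply [NeZero d] (v : Basis (Fin d) ℂ W) (a : Fin d) :
    wedgeOmitBasis v a = wedgeOmit v a := by
  simp [wedgeOmitBasis]

/-- The isomorphism `W* ≃ ⋀^{d-1} W` given by the volume form of the basis `v`; it sends the `a`-th
coordinate form to `(-1)^a v_1 ∧ ⋯ ∧ v̂_a ∧ ⋯ ∧ v_d`, with `a` counted from `1` in the sign. -/
def dualWedge [NeZero d] (v : Basis (Fin d) ℂ W) : Dual ℂ W ≃ₗ[ℂ] ⋀[ℂ]^(d - 1) W :=
  v.dualBasis.equiv ((wedgeOmitBasis v).unitsSMul fun a => (-1) ^ ((a : ℕ) + 1)) (.refl _)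

theorem dualWedge_coord [NeZero d] (v : Basis (Fin d) ℂ W) (a : Fin d) :
    dualWedge v (v.coord a) = (-1 : ℂ) ^ ((a : ℕ) + 1) • wedgeOmit v a := by
  rw [← v.coe_dualBasis, dualWedge, Basis.equiv_apply, Basis.unitsSMul_apply, Equiv.refl_apply,
    wedgeOmitBasis_apply]
  simp [Units.smul_def]

theorem dualWedge_apply [NeZero d] (v : Basis (Fin d) ℂ W) (α : Dual ℂ W) :
    dualWedge v α = ∑ a : Fin d, ((-1 : ℂ) ^ ((a : ℕ) + 1) * α (v a)) • wedgeOmit v a := by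
  conv_lhs => rw [← v.sum_dual_apply_smul_coord α, map_sum]
  refine Finset.sum_congr rfl fun a _ => ?_
  rw [map_smul, dualWedge_coord, smul_smul, mul_comm]

theorem wedgeForm_dualWedge_coord [NeZero d] (v : Basis (Fin d) ℂ W) (a : Fin d) (α : Dual ℂ W) :
    wedgeForm (fun i => v.coord (omitIdx a i)) (dualWedge v α) =
      (-1 : ℂ) ^ ((a : ℕ) + 1) * α (v a) := by
  simp [dualWedge_apply, wedgeForm_wedgeOmit]

theorem dualWedge_ext [NeZero d] (v : Basis (Fin d) ℂ W) {ω η : ⋀[ℂ]^(d - 1) W}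
    (h : ∀ F : Fin (d - 1) → Dual ℂ W, wedgeForm F ω = wedgeForm F η) : ω = η := by
  obtain ⟨α, rfl⟩ := (dualWedge v).surjective ω
  obtain ⟨β, rfl⟩ := (dualWedge v).surjective η
  refine congrArg _ (v.ext fun a => ?_)
  simpa [wedgeForm_dualWedge_coord] using h fun i => v.coord (omitIdx a i)

/-- Laplace expansion along the first row. -/
theorem wedgeForm_dualWedge {n : ℕ} (v : Basis (Fin (n + 1)) ℂ W) (α : Dual ℂ W)
    (F : Fin n → Dual ℂ W) :
    wedgeForm (m := n + 1 - 1) F (dualWedge v α) =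
      -(Matrix.of fun i j => (Fin.cons α F : Fin (n + 1) → Dual ℂ W) i (v j)).det := by
  rw [Matrix.det_succ_row_zero, dualWedge_apply, map_sum, ← Finset.sum_neg_distrib]
  refine Finset.sum_congr rfl fun a _ => ?_
  have h_minor : wedgeForm (m := n + 1 - 1) F (wedgeOmit v a) =
      ((Matrix.of fun i j => (Fin.cons α F : Fin (n + 1) → Dual ℂ W) i (v j)).submatrix Fin.succ
        a.succAbove).det := by
    refine (wedgeForm_ιMulti F fun j : Fin n => v (omitIdx a j)).trans (congrArg _ ?_)
    ext i j
    simp [omitIdx_eq_succAbove]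
  rw [map_smul, h_minor, smul_eq_mul, pow_succ, Matrix.of_apply, Fin.cons_zero]
  ring

theorem wedgeForm_update_dualWedge [NeZero d] (v : Basis (Fin d) ℂ W) (α : Dual ℂ W)
    (F : Fin (d - 1) → Dual ℂ W) (i : Fin (d - 1)) :
    wedgeForm (Function.update F i α) (dualWedge v (F i)) = -wedgeForm F (dualWedge v α) := by
  obtain ⟨n, rfl⟩ := Nat.exists_eq_succ_of_ne_zero (NeZero.ne d)
  change Fin n → Dual ℂ W at F
  change Fin n at i
  let A := Matrix.of fun k j => (Fin.cons α F : Fin (n + 1) → Dual ℂ W) k (v j)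
  have h_swap : (Matrix.of fun k j =>
      (Fin.cons (F i) (Function.update F i α) : Fin (n + 1) → Dual ℂ W) k (v j)) =
        A.submatrix (Equiv.swap 0 i.succ) id := by
    ext k j
    simp only [A, Matrix.of_apply, Matrix.submatrix_apply, id]
    congr 1
    refine Fin.cases (by simp) (fun l => ?_) k
    by_cases hl : l = i
    · simp [hl]
    · rw [Equiv.swap_apply_of_ne_of_ne (Fin.succ_ne_zero l) (by simpa using hl)]
      simp [hl]
  refine (wedgeForm_dualWedge v (F i) (Function.update F i α)).trans ?_
  rw [h_swap, Matrix.det_permute, Equiv.Perm.sign_swap (Fin.succ_ne_zero i).symm]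
  refine Eq.trans ?_ (congrArg Neg.neg (wedgeForm_dualWedge v α F).symm)
  simp [A]

theorem stdRep_inv_apply (g : GLW W) (w : W) : stdRep W g⁻¹ (stdRep W g w) = w := by
  rw [← Module.End.mul_apply, ← map_mul, inv_mul_cancel, map_one, Module.End.one_apply]

theorem stdRep_apply_inv (g : GLW W) (w : W) : stdRep W g (stdRep W g⁻¹ w) = w := by
  rw [← Module.End.mul_apply, ← map_mul, mul_inv_cancel, map_one, Module.End.one_apply]

theorem extRep_dualWedge [NeZero d] (v : Basis (Fin d) ℂ W) (g : GLW W) (α : Dual ℂ W) :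
    extRep W (d - 1) g (dualWedge v α) =
      LinearMap.det (stdRep W g) • dualWedge v (α ∘ₗ stdRep W g⁻¹) := by
  refine dualWedge_ext v fun F => ?_
  obtain ⟨n, rfl⟩ := Nat.exists_eq_succ_of_ne_zero (NeZero.ne d)
  refine (wedgeForm_map F _ _).trans <| (wedgeForm_dualWedge v α _).trans ?_
  rw [map_smul, smul_eq_mul]
  refine Eq.trans ?_ (congrArg _ (wedgeForm_dualWedge v _ F).symm)
  rw [mul_neg, ← det_covectors_comp]
  congr 2
  ext i j
  refine Fin.cases ?_ (fun l => ?_) i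
  · simp
  · simp

end DualWedge

section Tens

variable {d : ℕ} {W : Type*} [AddCommGroup W] [Module ℂ W]

/-- A vector space `T` with an action of `GL(W)` that is spanned by the values of a multilinear
map `t` on `W* × W × W × W`, alternating in the last two arguments and equivariant up to the
determinant, with enough linear forms to separate its points: a copy of
`det ⊗ W* ⊗ W ⊗ ⋀² W`. -/
structure TensModel (W T : Type*) [AddCommGroup W] [Module ℂ W] [AddCommGroup T] [Module ℂ T] where
  /-- The action of `GL(W)`. -/
  rep : Representation ℂ (GLW W) T
  /-- The universal multilinear map. -/
  t : Dual ℂ W →ₗ[ℂ] W →ₗ[ℂ] W →ₗ[ℂ] W →ₗ[ℂ] T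
  t_self (α : Dual ℂ W) (w x : W) : t α w x x = 0
  rep_t (g : GLW W) (α : Dual ℂ W) (w x y : W) : rep g (t α w x y) = LinearMap.det (stdRep W g) •
    t (α ∘ₗ stdRep W g⁻¹) (stdRep W g w) (stdRep W g x) (stdRep W g y)
  span_t : Submodule.span ℂ {z | ∃ α w x y, z = t α w x y} = ⊤
  /-- The linear forms on `T` given by a vector and three covectors. -/
  form (ω : W) (β γ δ : Dual ℂ W) : T →ₗ[ℂ] ℂ
  form_t (ω : W) (β γ δ α : Dual ℂ W) (w x y : W) :
    form ω β γ δ (t α w x y) = α ω * (β w * (γ x * δ y - γ y * δ x))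

/-- The trilinear map `(w, x, y) ↦ w ⊗ (x ∧ y)`. -/
def tensWedge : W →ₗ[ℂ] W →ₗ[ℂ] W →ₗ[ℂ] W ⊗[ℂ] ⋀[ℂ]^2 W where
  toFun w := wedgePair.compr₂ (TensorProduct.mk ℂ W (⋀[ℂ]^2 W) w)
  map_add' w w' := by ext x y; simp
  map_smul' c w := by ext x y; simp [TensorProduct.smul_tmul']

theorem tensWedge_apply (w x y : W) : tensWedge w x y = w ⊗ₜ[ℂ] wedgePair x y := rfl

theorem span_tensWedge :
    Submodule.span ℂ {s : W ⊗[ℂ] ⋀[ℂ]^2 W | ∃ w x y, s = tensWedge w x y} = ⊤ := by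
  rw [eq_top_iff, ← TensorProduct.span_tmul_eq_top, Submodule.span_le]
  rintro _ ⟨w, η, rfl⟩
  suffices ⊤ ≤ (Submodule.span ℂ {s | ∃ w x y, s = tensWedge w x y}).comap
    (TensorProduct.mk ℂ W (⋀[ℂ]^2 W) w) from this Submodule.mem_top
  rw [← span_wedgePair, Submodule.span_le]
  rintro _ ⟨x, y, rfl⟩
  exact Submodule.subset_span ⟨w, x, y, rfl⟩

variable [NeZero d] (v : Basis (Fin d) ℂ W)

/-- The multilinear map sending a covector `α` and vectors `w, x, y` to
`dualWedge α ⊗ w ⊗ (x ∧ y)`. -/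
def tens : Dual ℂ W →ₗ[ℂ] W →ₗ[ℂ] W →ₗ[ℂ] W →ₗ[ℂ] ⋀[ℂ]^(d - 1) W ⊗[ℂ] (W ⊗[ℂ] ⋀[ℂ]^2 W) where
  toFun α :=
    { toFun := fun w => (tensWedge w).compr₂ (TensorProduct.mk ℂ _ _ (dualWedge v α))
      map_add' := fun w w' => by ext x y; simp [TensorProduct.tmul_add]
      map_smul' := fun c w => by ext x y; simp }
  map_add' α β := by ext w x y; simp
  map_smul' c α := by ext w x y; simp [TensorProduct.smul_tmul']

theorem tens_apply (α : Dual ℂ W) (w x y : W) :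
    tens v α w x y = dualWedge v α ⊗ₜ[ℂ] tensWedge w x y := rfl

theorem tens_self (α : Dual ℂ W) (w x : W) : tens v α w x x = 0 := by
  rw [tens_apply, tensWedge_apply, wedgePair_self, TensorProduct.tmul_zero, TensorProduct.tmul_zero]

theorem genT_eq_tens (a j i k : Fin d) :
    genT v a j i k = tens v (v.coord a) (v j) (v i) (v k) := by
  rw [genT, tens_apply, dualWedge_coord, TensorProduct.smul_tmul', tensWedge_apply, wedgePair_apply]

theorem ambientRep_tens (g : GLW W) (α : Dual ℂ W) (w x y : W) :
    ambientRep W d g (tens v α w x y) = LinearMap.det (stdRep W g) •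
      tens v (α ∘ₗ stdRep W g⁻¹) (stdRep W g w) (stdRep W g x) (stdRep W g y) := by
  have h_pair : extRep W 2 g (wedgePair x y) = wedgePair (stdRep W g x) (stdRep W g y) :=
    map_wedgePair _ _ _
  simp only [tens_apply, tensWedge_apply, Representation.tprod_apply, TensorProduct.map_tmul,
    extRep_dualWedge, h_pair, TensorProduct.smul_tmul']

theorem span_tens : Submodule.span ℂ {z | ∃ α w x y, z = tens v α w x y} = ⊤ := by
  rw [eq_top_iff, ← TensorProduct.span_tmul_eq_top, Submodule.span_le]
  rintro _ ⟨ω, s, rfl⟩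
  obtain ⟨α, rfl⟩ := (dualWedge v).surjective ω
  suffices ⊤ ≤ (Submodule.span ℂ {z | ∃ α w x y, z = tens v α w x y}).comap
    (TensorProduct.mk ℂ _ _ (dualWedge v α)) from this Submodule.mem_top
  rw [← span_tensWedge, Submodule.span_le]
  rintro _ ⟨w, x, y, rfl⟩
  exact Submodule.subset_span ⟨α, w, x, y, rfl⟩

/-- The linear form `dualWedge α ⊗ w ⊗ (x ∧ y) ↦ α(ω) β(w) (γ(x) δ(y) - γ(y) δ(x))`. -/
def tensForm (ω : W) (β γ δ : Dual ℂ W) : ⋀[ℂ]^(d - 1) W ⊗[ℂ] (W ⊗[ℂ] ⋀[ℂ]^2 W) →ₗ[ℂ] ℂ :=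
  LinearMap.mul' ℂ ℂ ∘ₗ TensorProduct.map (Dual.eval ℂ W ω ∘ₗ (dualWedge v).symm.toLinearMap)
    (LinearMap.mul' ℂ ℂ ∘ₗ TensorProduct.map β (wedgeForm ![γ, δ]))

theorem tensForm_tens (ω : W) (β γ δ α : Dual ℂ W) (w x y : W) :
    tensForm v ω β γ δ (tens v α w x y) = α ω * (β w * (γ x * δ y - γ y * δ x)) := by
  simp [tensForm, tens_apply, tensWedge_apply, wedgeForm_wedgePair]

/-- The space `⋀^{d-1} W ⊗ W ⊗ ⋀² W` as a copy of `det ⊗ W* ⊗ W ⊗ ⋀² W`. -/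
def ambientModel : TensModel W (⋀[ℂ]^(d - 1) W ⊗[ℂ] (W ⊗[ℂ] ⋀[ℂ]^2 W)) where
  rep := ambientRep W d
  t := tens v
  t_self := tens_self v
  rep_t := ambientRep_tens v
  span_t := span_tens v
  form := tensForm v
  form_t := tensForm_tens v

end Tens

section Contraction

variable {K M N : Type*} [CommRing K] [AddCommGroup M] [Module K M] [AddCommGroup N] [Module K N]

theorem coord_basis {ι : Type*} [DecidableEq ι] (v : Basis ι K M) (a b : ι) :
    v.coord a (v b) = if a = b then 1 else 0 := by
  simp [Finsupp.single_apply, eq_comm]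

/-- The contraction `∑ a, f (v_a^*) v_a` of a bilinear map on `M* × M`. -/
def contract {ι : Type*} [Fintype ι] (v : Basis ι K M) (f : Dual K M →ₗ[K] M →ₗ[K] N) : N :=
  ∑ a, f (v.coord a) (v a)

theorem sum_coord_mul {ι : Type*} [Fintype ι] (v : Basis ι K M) (x : M) (β : Dual K M) :
    ∑ a, v.coord a x * β (v a) = β x := by
  simp only [← smul_eq_mul, ← map_smul, ← map_sum, v.coord_apply, v.sum_repr]

/-- The trilinear map `(w, x, y) ↦ f x y w`. -/
def rotate (f : M →ₗ[K] M →ₗ[K] M →ₗ[K] N) : M →ₗ[K] M →ₗ[K] M →ₗ[K] N :=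
  ((LinearMap.lflip (R₀ := K)).toLinearMap ∘ₗ f).flip

theorem rotate_apply (f : M →ₗ[K] M →ₗ[K] M →ₗ[K] N) (w x y : M) :
    rotate f w x y = f x y w := rfl

end Contraction

theorem contract_comp_stdRep {ι W M : Type*} [Fintype ι] [AddCommGroup W] [Module ℂ W]
    [AddCommGroup M] [Module ℂ M] (v : Basis ι ℂ W) (f : Dual ℂ W →ₗ[ℂ] W →ₗ[ℂ] M)
    (g : GLW W) :
    ∑ a, f (v.coord a ∘ₗ stdRep W g⁻¹) (stdRep W g (v a)) = contract v f := by
  classical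
  have h_left : ∀ a, f (v.coord a ∘ₗ stdRep W g⁻¹) (stdRep W g (v a)) =
      ∑ b, v.coord a (stdRep W g⁻¹ (v b)) • f (v.coord b) (stdRep W g (v a)) := fun a => by
    conv_lhs => rw [← v.sum_dual_apply_smul_coord (v.coord a ∘ₗ stdRep W g⁻¹)]
    simp only [map_sum, map_smul, LinearMap.sum_apply, LinearMap.smul_apply, LinearMap.comp_apply]
  have h_right : ∀ b, f (v.coord b) (v b) =
      ∑ a, v.coord a (stdRep W g⁻¹ (v b)) • f (v.coord b) (stdRep W g (v a)) := fun b => by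
    conv_lhs => rw [← stdRep_apply_inv g (v b), ← v.sum_repr (stdRep W g⁻¹ (v b))]
    simp only [map_sum, map_smul, Basis.coord_apply]
  simp only [contract, h_left, h_right]
  exact Finset.sum_comm

namespace TensModel

variable {d : ℕ} {W T : Type*} [AddCommGroup W] [Module ℂ W] [AddCommGroup T] [Module ℂ T]
  (m : TensModel W T) (v : Basis (Fin d) ℂ W)

theorem t_swap (α : Dual ℂ W) (w x y : W) : m.t α w y x = -m.t α w x y := by
  have h := m.t_self α w (x + y)
  simp only [map_add, LinearMap.add_apply, m.t_self, zero_add, add_zero] at h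
  exact eq_neg_of_add_eq_zero_left h

theorem ext {M : Type*} [AddCommGroup M] [Module ℂ M] {f h : T →ₗ[ℂ] M}
    (H : ∀ α w x y, f (m.t α w x y) = h (m.t α w x y)) : f = h :=
  LinearMap.ext_on m.span_t fun _ ⟨α, w, x, y, e⟩ => by rw [e, H]

theorem ext_basis {M : Type*} [AddCommGroup M] [Module ℂ M] {f h : T →ₗ[ℂ] M}
    (H : ∀ a j i k, f (m.t (v.coord a) (v j) (v i) (v k)) =
      h (m.t (v.coord a) (v j) (v i) (v k))) : f = h := by
  refine m.ext fun α w x y => ?_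
  rw [← v.sum_dual_apply_smul_coord α, ← v.sum_repr w, ← v.sum_repr x, ← v.sum_repr y]
  simp only [map_sum, map_smul, LinearMap.sum_apply, LinearMap.smul_apply, H]

theorem form_rep (g : GLW W) (ω : W) (β γ δ : Dual ℂ W) (z : T) :
    m.form ω β γ δ (m.rep g z) = LinearMap.det (stdRep W g) *
      m.form (stdRep W g⁻¹ ω) (β ∘ₗ stdRep W g) (γ ∘ₗ stdRep W g) (δ ∘ₗ stdRep W g) z := by
  suffices m.form ω β γ δ ∘ₗ m.rep g = LinearMap.det (stdRep W g) •
      m.form (stdRep W g⁻¹ ω) (β ∘ₗ stdRep W g) (γ ∘ₗ stdRep W g) (δ ∘ₗ stdRep W g) from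
    LinearMap.congr_fun this z
  refine m.ext fun α w x y => ?_
  rw [LinearMap.comp_apply, m.rep_t, map_smul, m.form_t, LinearMap.smul_apply, m.form_t]
  rfl

/-- The coordinates of an element of `T` with respect to a basis of `W`. -/
def coord (a j i k : Fin d) : T →ₗ[ℂ] ℂ :=
  m.form (v a) (v.coord j) (v.coord i) (v.coord k)

theorem coord_t (a j i k : Fin d) (α : Dual ℂ W) (w x y : W) :
    m.coord v a j i k (m.t α w x y) =
      α (v a) * (v.coord j w * (v.coord i x * v.coord k y - v.coord i y * v.coord k x)) :=
  m.form_t ..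

theorem coord_swap (a j i k : Fin d) (z : T) :
    m.coord v a j k i z = -m.coord v a j i k z := by
  suffices m.coord v a j k i = -m.coord v a j i k by rw [this, LinearMap.neg_apply]
  refine m.ext fun α w x y => ?_
  rw [LinearMap.neg_apply, coord_t, coord_t]
  ring

theorem coord_self (a j i : Fin d) (z : T) : m.coord v a j i i z = 0 :=
  self_eq_neg.1 (m.coord_swap v a j i i z)

theorem sum_coord_smul {M : Type*} [AddCommGroup M] [Module ℂ M]
    (c : Fin d → Fin d → Fin d → Fin d → M) (a j i k : Fin d) :
    ∑ a', ∑ j', ∑ i', ∑ k', m.coord v a' j' i' k' (m.t (v.coord a) (v j) (v i) (v k)) •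
      c a' j' i' k' = c a j i k - c a j k i := by
  simp only [coord_t, coord_basis]
  simp [mul_sub, sub_smul, Finset.sum_sub_distrib]

theorem two_smul_eq_sum_coord (z : T) :
    (2 : ℂ) • z = ∑ a, ∑ j, ∑ i, ∑ k,
      m.coord v a j i k z • m.t (v.coord a) (v j) (v i) (v k) := by
  suffices (2 : ℂ) • (LinearMap.id : T →ₗ[ℂ] T) = ∑ a, ∑ j, ∑ i, ∑ k,
      (m.coord v a j i k).smulRight (m.t (v.coord a) (v j) (v i) (v k)) by
    simpa using LinearMap.congr_fun this z
  refine m.ext_basis v fun a j i k => ?_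
  simp only [LinearMap.sum_apply, LinearMap.smulRight_apply]
  rw [m.sum_coord_smul v (fun a j i k => m.t (v.coord a) (v j) (v i) (v k)), m.t_swap _ _ (v i)]
  simp [two_smul]

theorem eq_zero_of_coord {z : T} (h : ∀ a j i k, m.coord v a j i k z = 0) : z = 0 := by
  have := m.two_smul_eq_sum_coord v z
  simpa [h] using this

/-- The cyclic sum of `t α w x y` over the three vectors. -/
def cyc : Dual ℂ W →ₗ[ℂ] W →ₗ[ℂ] W →ₗ[ℂ] W →ₗ[ℂ] T where
  toFun α := m.t α + rotate (m.t α) + rotate (rotate (m.t α))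
  map_add' α β := by
    ext w x y
    simp only [map_add, LinearMap.add_apply, rotate_apply]
    abel
  map_smul' c α := by ext w x y; simp [rotate_apply]

theorem cyc_apply (α : Dual ℂ W) (w x y : W) :
    m.cyc α w x y = m.t α w x y + m.t α x y w + m.t α y w x := rfl

theorem cyc_rotate (α : Dual ℂ W) (w x y : W) : m.cyc α x y w = m.cyc α w x y := by
  rw [cyc_apply, cyc_apply]; abel

theorem cyc_swap (α : Dual ℂ W) (w x y : W) : m.cyc α w y x = -m.cyc α w x y := by
  rw [cyc_apply, cyc_apply, m.t_swap α w x y, m.t_swap α y w x, m.t_swap α x y w]; abel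

theorem cyc_self (α : Dual ℂ W) (w x : W) : m.cyc α w x x = 0 := by
  rw [cyc_apply, m.t_self, m.t_swap α x w x]; abel

theorem rep_cyc (g : GLW W) (α : Dual ℂ W) (w x y : W) :
    m.rep g (m.cyc α w x y) = LinearMap.det (stdRep W g) •
      m.cyc (α ∘ₗ stdRep W g⁻¹) (stdRep W g w) (stdRep W g x) (stdRep W g y) := by
  simp only [cyc_apply, map_add, m.rep_t, smul_add]

/-- The contraction `∑ a, t(v_a^*; v_a, x, y)`. -/
def trace : W →ₗ[ℂ] W →ₗ[ℂ] T := contract v m.t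

theorem trace_apply (x y : W) : m.trace v x y = ∑ a, m.t (v.coord a) (v a) x y := by
  simp [trace, contract]

/-- The contraction `∑ a, (cyclic sum of t(v_a^*; v_a, x, y))`. -/
def cycTrace : W →ₗ[ℂ] W →ₗ[ℂ] T := contract v m.cyc

theorem cycTrace_apply (x y : W) : m.cycTrace v x y = ∑ a, m.cyc (v.coord a) (v a) x y := by
  simp [cycTrace, contract]

/-- The contraction `∑ a, t(v_a^*; w, x, v_a)`. -/
def polar : W →ₗ[ℂ] W →ₗ[ℂ] T := ∑ a, rotate (m.t (v.coord a)) (v a)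

theorem polar_apply (w x : W) : m.polar v w x = ∑ a, m.t (v.coord a) w x (v a) := by
  simp [polar, rotate_apply]

theorem rep_trace (g : GLW W) (x y : W) : m.rep g (m.trace v x y) =
    LinearMap.det (stdRep W g) • m.trace v (stdRep W g x) (stdRep W g y) := by
  have h_inv := LinearMap.congr_fun₂ (contract_comp_stdRep v m.t g) (stdRep W g x) (stdRep W g y)
  simp only [LinearMap.sum_apply] at h_inv
  rw [trace_apply, map_sum]
  simp only [m.rep_t, ← Finset.smul_sum, h_inv]
  rfl

theorem rep_cycTrace (g : GLW W) (x y : W) : m.rep g (m.cycTrace v x y) =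
    LinearMap.det (stdRep W g) • m.cycTrace v (stdRep W g x) (stdRep W g y) := by
  have h_inv := LinearMap.congr_fun₂ (contract_comp_stdRep v m.cyc g) (stdRep W g x) (stdRep W g y)
  simp only [LinearMap.sum_apply] at h_inv
  rw [cycTrace_apply, map_sum]
  simp only [m.rep_cyc, ← Finset.smul_sum, h_inv]
  rfl

theorem rep_polar (g : GLW W) (w x : W) : m.rep g (m.polar v w x) =
    LinearMap.det (stdRep W g) • m.polar v (stdRep W g w) (stdRep W g x) := by
  have h_inv := contract_comp_stdRep v ((m.t.flip (stdRep W g w)).flip (stdRep W g x)) g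
  simp only [contract, LinearMap.flip_apply] at h_inv
  simp only [polar_apply, map_sum, m.rep_t, ← Finset.smul_sum, h_inv]

theorem trace_swap (x y : W) : m.trace v y x = -m.trace v x y := by
  rw [trace_apply, trace_apply, ← Finset.sum_neg_distrib]
  exact Finset.sum_congr rfl fun a _ => m.t_swap _ _ _ _

theorem cycTrace_swap (x y : W) : m.cycTrace v y x = -m.cycTrace v x y := by
  rw [cycTrace_apply, cycTrace_apply, ← Finset.sum_neg_distrib]
  exact Finset.sum_congr rfl fun a _ => m.cyc_swap _ _ _ _

theorem form_trace (ω : W) (β γ δ : Dual ℂ W) (x y : W) :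
    m.form ω β γ δ (m.trace v x y) = β ω * (γ x * δ y - γ y * δ x) := by
  simp only [trace_apply, map_sum, m.form_t, ← mul_assoc, ← Finset.sum_mul, sum_coord_mul]

theorem form_polar (ω : W) (β γ δ : Dual ℂ W) (w x : W) :
    m.form ω β γ δ (m.polar v w x) = β w * (γ x * δ ω - γ ω * δ x) := by
  rw [← sum_coord_mul v ω δ, ← sum_coord_mul v ω γ, Finset.mul_sum, Finset.sum_mul,
    ← Finset.sum_sub_distrib, Finset.mul_sum, polar_apply, map_sum]
  refine Finset.sum_congr rfl fun a _ => ?_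
  rw [m.form_t]
  ring

theorem form_cycTrace (ω : W) (β γ δ : Dual ℂ W) (x y : W) :
    m.form ω β γ δ (m.cycTrace v x y) = β ω * (γ x * δ y - γ y * δ x) +
      γ ω * (δ x * β y - δ y * β x) + δ ω * (β x * γ y - β y * γ x) := by
  rw [← sum_coord_mul v ω β, ← sum_coord_mul v ω γ, ← sum_coord_mul v ω δ, Finset.sum_mul,
    Finset.sum_mul, Finset.sum_mul, ← Finset.sum_add_distrib, ← Finset.sum_add_distrib,
    cycTrace_apply, map_sum]
  refine Finset.sum_congr rfl fun a _ => ?_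
  rw [cyc_apply, map_add, map_add, m.form_t, m.form_t, m.form_t]
  ring

/-- The span of the elements `t(α; w, w, x)` with `α(w) = α(x) = 0`; it is the constituent of type
`(3, 2, 1, …, 1, 0)`. -/
def primitive : Submodule ℂ T :=
  Submodule.span ℂ {z | ∃ (α : Dual ℂ W) (w x : W), α w = 0 ∧ α x = 0 ∧ z = m.t α w w x}

/-- The span of the elements `cyc(α; w, x, y)` with `α(w) = α(x) = α(y) = 0`; it is the constituent
of type `(2, 2, 2, 1, …, 1, 0)`. -/
def cycPrimitive : Submodule ℂ T :=
  Submodule.span ℂ {z | ∃ (α : Dual ℂ W) (w x y : W),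
    α w = 0 ∧ α x = 0 ∧ α y = 0 ∧ z = m.cyc α w x y}

/-- The span of the elements `polar w w`; it is the constituent of type `(3, 1, …, 1)`. -/
def polarSub : Submodule ℂ T := Submodule.span ℂ {z | ∃ w, z = m.polar v w w}

/-- The span of the elements `trace x y`; it is a constituent of type `(2, 2, 1, …, 1)`. -/
def traceSub : Submodule ℂ T := Submodule.span ℂ {z | ∃ x y, z = m.trace v x y}

/-- The span of the elements `cycTrace x y`; it is a second constituent of type
`(2, 2, 1, …, 1)`. -/
def cycTraceSub : Submodule ℂ T := Submodule.span ℂ {z | ∃ x y, z = m.cycTrace v x y}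

/-- The span of all cyclic sums. -/
def cycSub : Submodule ℂ T := Submodule.span ℂ {z | ∃ α w x y, z = m.cyc α w x y}

end TensModel

section Vanishing

variable {K M N : Type*} [Field K] [AddCommGroup M] [Module K M] [AddCommGroup N] [Module K N]
  {d : ℕ}

theorem eq_zero_of_eq_neg_self [CharZero K] {x : N} (h : x = -x) : x = 0 := by
  have h_two : (2 : K) • x = 0 := by rw [two_smul, ← eq_neg_iff_add_eq_zero]; exact h
  exact (smul_eq_zero_iff_right two_ne_zero).1 h_two

theorem sum_eq_of_forall_ne {G : Fin d → N} {c : N} (j : Fin d) (h : ∀ a, a ≠ j → G a = c) :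
    ∑ a, G a = G j + ((d : K) - 1) • c := by
  rw [← Finset.add_sum_erase _ _ (Finset.mem_univ j),
    Finset.sum_congr rfl fun a ha => h a (Finset.ne_of_mem_erase ha), Finset.sum_const,
    Finset.card_erase_of_mem (Finset.mem_univ j), Finset.card_univ, Fintype.card_fin,
    ← Nat.cast_smul_eq_nsmul K, Nat.cast_pred j.pos]

theorem sum_eq_of_forall_ne_ne {G : Fin d → N} {c : N} {l j : Fin d} (hlj : l ≠ j)
    (h : ∀ a, a ≠ l → a ≠ j → G a = c) :
    ∑ a, G a = G l + G j + ((d : K) - 2) • c := by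
  have h_off : ∀ a, a ≠ l → G a - (if a = j then G j - c else 0) = c := fun a ha => by
    split_ifs with e
    · rw [e]; abel
    · rw [h a ha e, sub_zero]
  have h_sum := sum_eq_of_forall_ne (K := K) l h_off
  rw [Finset.sum_sub_distrib, Finset.sum_ite_eq', if_pos (Finset.mem_univ j), if_neg hlj,
    sub_eq_iff_eq_add] at h_sum
  rw [h_sum]
  module

theorem multilinear_ext_basis {ι : Type*} [Finite ι] (v : Basis ι K M)
    {f h : Dual K M →ₗ[K] M →ₗ[K] M →ₗ[K] M →ₗ[K] N}
    (H : ∀ a j i k, f (v.coord a) (v j) (v i) (v k) = h (v.coord a) (v j) (v i) (v k)) : f = h := by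
  classical
  refine v.dualBasis.ext fun a => v.ext fun j => v.ext fun i => v.ext fun k => ?_
  simpa only [v.coe_dualBasis] using H a j i k

/-- The multilinear map `f` is alternating in its last two arguments and kills the generators of
`primitive`, `cycSub`, `traceSub` and `polarSub`. -/
structure KillsConstituents (v : Basis (Fin d) K M)
    (f : Dual K M →ₗ[K] M →ₗ[K] M →ₗ[K] M →ₗ[K] N) : Prop where
  swap (α : Dual K M) (w x y : M) : f α w y x = -f α w x y
  primitive (α : Dual K M) (w x : M) (hw : α w = 0) (hx : α x = 0) : f α w w x = 0
  cyc (α : Dual K M) (w x y : M) : f α w x y + f α x y w + f α y w x = 0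
  trace (x y : M) : ∑ a, f (v.coord a) (v a) x y = 0
  polar (w : M) : ∑ a, f (v.coord a) w w (v a) = 0

namespace KillsConstituents

variable [CharZero K] {v : Basis (Fin d) K M} {f : Dual K M →ₗ[K] M →ₗ[K] M →ₗ[K] M →ₗ[K] N}

theorem apply_self (hf : KillsConstituents v f) (α : Dual K M) (w x : M) : f α w x x = 0 :=
  eq_zero_of_eq_neg_self (K := K) (hf.swap α w x x)

/-- On the kernel of `α`, the map `f α` is alternating, so that its cyclic sums are its triples. -/
theorem eq_zero_of_annihilates (hf : KillsConstituents v f) {α : Dual K M} {w x y : M}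
    (hw : α w = 0) (hx : α x = 0) (hy : α y = 0) : f α w x y = 0 := by
  have h_swap_left : ∀ p r s, α p = 0 → α r = 0 → α s = 0 → f α p r s + f α r p s = 0 := by
    intro p r s hp hr hs
    have h := hf.primitive α (p + r) s (by simp [hp, hr]) hs
    simp only [map_add, LinearMap.add_apply, hf.primitive α p s hp hs,
      hf.primitive α r s hr hs] at h
    simpa [add_comm] using h
  have h_wx := h_swap_left w x y hw hx hy
  have h_wy := h_swap_left w y x hw hy hx
  have h_cyc := hf.cyc α w x y
  rw [hf.swap α w x y] at h_wy
  rw [hf.swap α x w y] at h_cyc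
  refine (smul_eq_zero_iff_right (three_ne_zero (α := K))).1 ?_
  linear_combination (norm := module) h_cyc + h_wx - h_wy

/-- The value does not depend on `b ≠ l`, so that `hf.polar (v l)` is a multiple of it. -/
theorem coord_self_self_basis (hf : KillsConstituents v f) (hd : 2 ≤ d) {b l : Fin d}
    (hbl : b ≠ l) : f (v.coord b) (v l) (v l) (v b) = 0 := by
  have h_const : ∀ p, p ≠ l →
      f (v.coord p) (v l) (v l) (v p) = f (v.coord b) (v l) (v l) (v b) := by
    intro p hpl
    rcases eq_or_ne p b with rfl | hpb
    · rfl
    have h := hf.primitive (v.coord b - v.coord p) (v l) (v b + v p)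
      (by simp [coord_basis, hbl, hpl, -Basis.coord_apply])
      (by simp [coord_basis, hpb, hpb.symm, -Basis.coord_apply])
    simp only [map_add, map_sub, LinearMap.sub_apply,
      hf.primitive (v.coord b) (v l) (v p) (by simp [coord_basis, hbl, -Basis.coord_apply])
        (by simp [coord_basis, hpb.symm, -Basis.coord_apply]),
      hf.primitive (v.coord p) (v l) (v b) (by simp [coord_basis, hpl, -Basis.coord_apply])
        (by simp [coord_basis, hpb, -Basis.coord_apply])] at h
    linear_combination (norm := module) -h
  have h_polar := hf.polar (v l)
  rw [sum_eq_of_forall_ne (K := K) l h_const, hf.apply_self, zero_add] at h_polar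
  refine (smul_eq_zero_iff_right ?_).1 h_polar
  rw [sub_ne_zero]
  exact_mod_cast (by omega : d ≠ 1)

section DistinctIndices

variable {b l p : Fin d}

theorem coord_add_swap (hf : KillsConstituents v f) (hbl : b ≠ l) (hbp : b ≠ p) (hlp : l ≠ p) :
    f (v.coord b) (v b) (v l) (v p) + f (v.coord b) (v l) (v b) (v p) =
      f (v.coord l) (v l) (v l) (v p) := by
  have h_sub := hf.primitive (v.coord b - v.coord l) (v b + v l) (v p)
    (by simp [coord_basis, hbl, hbl.symm, -Basis.coord_apply])
    (by simp [coord_basis, hbp, hlp, -Basis.coord_apply])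
  have h_add := hf.primitive (v.coord b + v.coord l) (v l - v b) (v p)
    (by simp [coord_basis, hbl, hbl.symm, -Basis.coord_apply])
    (by simp [coord_basis, hbp, hlp, -Basis.coord_apply])
  have h_coord := hf.primitive (v.coord l) (v b) (v p)
    (by simp [coord_basis, hbl.symm, -Basis.coord_apply])
    (by simp [coord_basis, hlp, -Basis.coord_apply])
  simp only [map_add, map_sub, LinearMap.sub_apply, LinearMap.add_apply] at h_sub h_add
  rw [← sub_eq_zero]
  refine (smul_eq_zero_iff_right (two_ne_zero (α := K))).1 ?_
  linear_combination (norm := module) h_sub - h_add + (2 : K) • h_coord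

theorem three_smul_coord (hf : KillsConstituents v f) (hbl : b ≠ l) (hbp : b ≠ p) (hlp : l ≠ p) :
    (3 : K) • f (v.coord b) (v b) (v l) (v p) =
      f (v.coord l) (v l) (v l) (v p) - f (v.coord p) (v p) (v p) (v l) := by
  have h_l := hf.coord_add_swap hbl hbp hlp
  have h_p := hf.coord_add_swap hbp hbl hlp.symm
  have h_cyc := hf.cyc (v.coord b) (v b) (v l) (v p)
  rw [hf.swap _ _ (v l) (v p)] at h_p
  rw [hf.swap _ _ (v b) (v p)] at h_cyc
  linear_combination (norm := module) h_l - h_p + h_cyc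

theorem coord_self_self_comm (hf : KillsConstituents v f) (hlp : l ≠ p) :
    f (v.coord l) (v l) (v l) (v p) = f (v.coord p) (v p) (v p) (v l) := by
  have h_trace := congrArg ((3 : K) • ·) (hf.trace (v l) (v p))
  simp only [Finset.smul_sum, smul_zero] at h_trace
  rw [sum_eq_of_forall_ne_ne (K := K) hlp fun b hbl hbp => hf.three_smul_coord hbl hbp hlp,
    hf.swap (v.coord p) (v p) (v p) (v l)] at h_trace
  rw [← sub_eq_zero]
  refine (smul_eq_zero_iff_right (Nat.cast_add_one_ne_zero (R := K) d)).1 ?_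
  linear_combination (norm := module) h_trace

/-- After `hf.coord_self_self_comm`, the polarization of `hf.polar` at `v l + v p` is a multiple of
this value. -/
theorem coord_self_self_eq_zero (hf : KillsConstituents v f) (hd : 2 ≤ d) (hlp : l ≠ p) :
    f (v.coord l) (v l) (v l) (v p) = 0 := by
  have h_other : ∀ b, b ≠ l → b ≠ p →
      f (v.coord b) (v p) (v l) (v b) + f (v.coord b) (v l) (v p) (v b) =
        (-2 : K) • f (v.coord l) (v l) (v l) (v p) := by
    intro b hbl hbp
    have h_l := hf.coord_add_swap hbl hbp hlp
    have h_p := hf.coord_add_swap hbp hbl hlp.symm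
    rw [hf.swap _ _ (v l) (v p), ← hf.coord_self_self_comm hlp] at h_p
    rw [hf.swap _ _ (v b) (v p), hf.swap _ _ (v b) (v l)]
    linear_combination (norm := module) -h_l - h_p
  have h_polar := hf.polar (v l + v p)
  simp only [map_add, LinearMap.add_apply, Finset.sum_add_distrib, hf.polar (v l),
    hf.polar (v p)] at h_polar
  rw [zero_add, add_zero, ← Finset.sum_add_distrib, sum_eq_of_forall_ne_ne (K := K) hlp h_other,
    hf.apply_self, hf.apply_self, hf.swap (v.coord l) (v l) (v l) (v p),
    hf.swap (v.coord p) (v p) (v p) (v l), ← hf.coord_self_self_comm hlp] at h_polar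
  have h_ne : -2 * ((d : K) - 1) ≠ 0 :=
    mul_ne_zero (by norm_num) (sub_ne_zero.2 (by exact_mod_cast (by omega : d ≠ 1)))
  refine (smul_eq_zero_iff_right h_ne).1 ?_
  linear_combination (norm := module) h_polar

theorem coord_self_basis (hf : KillsConstituents v f) (hbl : b ≠ l) (hbp : b ≠ p) (hlp : l ≠ p) :
    f (v.coord b) (v b) (v l) (v p) = 0 := by
  refine (smul_eq_zero_iff_right (three_ne_zero (α := K))).1 ?_
  rw [hf.three_smul_coord hbl hbp hlp, hf.coord_self_self_comm hlp, sub_self]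

theorem coord_basis_self (hf : KillsConstituents v f) (hd : 2 ≤ d) (l : Fin d) (hbp : b ≠ p) :
    f (v.coord b) (v l) (v b) (v p) = 0 := by
  rcases eq_or_ne b l with rfl | hbl
  · exact hf.coord_self_self_eq_zero hd hbp
  rcases eq_or_ne l p with rfl | hlp
  · rw [hf.swap, hf.coord_self_self_basis hd hbl, neg_zero]
  · have h := hf.coord_add_swap hbl hbp hlp
    rwa [hf.coord_self_self_eq_zero hd hlp, hf.coord_self_basis hbl hbp hlp, zero_add] at h

end DistinctIndices

theorem eq_zero (hf : KillsConstituents v f) (hd : 2 ≤ d) : f = 0 := by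
  refine multilinear_ext_basis v fun a j i k => ?_
  rw [LinearMap.zero_apply, LinearMap.zero_apply, LinearMap.zero_apply, LinearMap.zero_apply]
  rcases eq_or_ne i k with rfl | hik
  · exact hf.apply_self ..
  rcases eq_or_ne a i with rfl | hai
  · exact hf.coord_basis_self hd j hik
  rcases eq_or_ne a k with rfl | hak
  · rw [hf.swap, hf.coord_basis_self hd j hai, neg_zero]
  rcases eq_or_ne a j with rfl | haj
  · exact hf.coord_self_basis hai hak hik
  · exact hf.eq_zero_of_annihilates (by rw [coord_basis, if_neg haj])
      (by rw [coord_basis, if_neg hai]) (by rw [coord_basis, if_neg hak])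

end KillsConstituents

/-- The multilinear map `f` is alternating in its last three arguments and kills the generators of
`cycPrimitive` and `cycTraceSub`. -/
structure KillsCyclicConstituents (v : Basis (Fin d) K M)
    (f : Dual K M →ₗ[K] M →ₗ[K] M →ₗ[K] M →ₗ[K] N) : Prop where
  swap (α : Dual K M) (w x y : M) : f α w y x = -f α w x y
  rotate (α : Dual K M) (w x y : M) : f α x y w = f α w x y
  primitive (α : Dual K M) (w x y : M) (hw : α w = 0) (hx : α x = 0) (hy : α y = 0) :
    f α w x y = 0
  trace (x y : M) : ∑ a, f (v.coord a) (v a) x y = 0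

namespace KillsCyclicConstituents

variable [CharZero K] {v : Basis (Fin d) K M} {f : Dual K M →ₗ[K] M →ₗ[K] M →ₗ[K] M →ₗ[K] N}

theorem apply_self_right (hf : KillsCyclicConstituents v f) (α : Dual K M) (w x : M) :
    f α w x x = 0 :=
  eq_zero_of_eq_neg_self (K := K) (hf.swap α w x x)

theorem apply_self_left (hf : KillsCyclicConstituents v f) (α : Dual K M) (w x : M) :
    f α x x w = 0 := by
  rw [hf.rotate, hf.apply_self_right]

/-- The value does not depend on `b ∉ {l, p}`, so that `hf.trace (v l) (v p)` is a multiple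
of it. -/
theorem coord_self_basis (hf : KillsCyclicConstituents v f) (hd : 3 ≤ d) (b l p : Fin d) :
    f (v.coord b) (v b) (v l) (v p) = 0 := by
  rcases eq_or_ne l p with rfl | hlp
  · exact hf.apply_self_right ..
  rcases eq_or_ne b l with rfl | hbl
  · exact hf.apply_self_left ..
  rcases eq_or_ne b p with rfl | hbp
  · rw [hf.swap, hf.apply_self_left, neg_zero]
  have h_const : ∀ c, c ≠ l → c ≠ p →
      f (v.coord c) (v c) (v l) (v p) = f (v.coord b) (v b) (v l) (v p) := by
    intro c hcl hcp
    rcases eq_or_ne c b with rfl | hcb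
    · rfl
    have h_vanish : ∀ {q r : Fin d}, q ≠ r → v.coord q (v r) = 0 := fun h => by
      rw [coord_basis, if_neg h]
    have h := hf.primitive (v.coord b - v.coord c) (v b + v c) (v l) (v p)
      (by simp [coord_basis, hcb, hcb.symm, -Basis.coord_apply])
      (by rw [LinearMap.sub_apply, h_vanish hbl, h_vanish hcl, sub_zero])
      (by rw [LinearMap.sub_apply, h_vanish hbp, h_vanish hcp, sub_zero])
    simp only [map_add, map_sub, LinearMap.sub_apply, LinearMap.add_apply,
      hf.primitive _ _ _ _ (h_vanish hcb.symm) (h_vanish hbl) (h_vanish hbp),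
      hf.primitive _ _ _ _ (h_vanish hcb) (h_vanish hcl) (h_vanish hcp)] at h
    linear_combination (norm := module) -h
  have h_trace := hf.trace (v l) (v p)
  rw [sum_eq_of_forall_ne_ne (K := K) hlp h_const, hf.apply_self_left, hf.swap,
    hf.apply_self_left, neg_zero, zero_add, zero_add] at h_trace
  refine (smul_eq_zero_iff_right (sub_ne_zero.2 ?_)).1 h_trace
  exact_mod_cast (by omega : d ≠ 2)

theorem eq_zero (hf : KillsCyclicConstituents v f) (hd : 3 ≤ d) : f = 0 := by
  refine multilinear_ext_basis v fun a j i k => ?_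
  rw [LinearMap.zero_apply, LinearMap.zero_apply, LinearMap.zero_apply, LinearMap.zero_apply]
  rcases eq_or_ne a j with rfl | haj
  · exact hf.coord_self_basis hd ..
  rcases eq_or_ne a i with rfl | hai
  · rw [← hf.rotate, hf.coord_self_basis hd]
  rcases eq_or_ne a k with rfl | hak
  · rw [hf.rotate, hf.coord_self_basis hd]
  · exact hf.primitive _ _ _ _ (by rw [coord_basis, if_neg haj])
      (by rw [coord_basis, if_neg hai]) (by rw [coord_basis, if_neg hak])

end KillsCyclicConstituents

/-- The multilinear map `f` followed by the linear map `q`. -/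
def postcomp {M' N' : Type*} [AddCommGroup M'] [Module K M'] [AddCommGroup N'] [Module K N']
    (q : N →ₗ[K] N') (f : M' →ₗ[K] M →ₗ[K] M →ₗ[K] M →ₗ[K] N) :
    M' →ₗ[K] M →ₗ[K] M →ₗ[K] M →ₗ[K] N' :=
  f.compr₂ ((q.compRight K).compRight K)

end Vanishing

namespace TensModel

variable {d : ℕ} {W T : Type*} [AddCommGroup W] [Module ℂ W] [AddCommGroup T] [Module ℂ T]
  (m : TensModel W T) (v : Basis (Fin d) ℂ W)

theorem sup_eq_top (hd : 2 ≤ d) :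
    m.primitive ⊔ (m.polarSub v ⊔ (m.traceSub v ⊔ m.cycSub)) = ⊤ := by
  set N := m.primitive ⊔ (m.polarSub v ⊔ (m.traceSub v ⊔ m.cycSub))
  have h_mk : ∀ {z}, z ∈ N → N.mkQ z = 0 := fun h => by rwa [← LinearMap.mem_ker, N.ker_mkQ]
  have h_primitive : m.primitive ≤ N := le_sup_left
  have h_polar : m.polarSub v ≤ N := le_sup_left.trans le_sup_right
  have h_trace : m.traceSub v ≤ N := le_sup_left.trans (le_sup_right.trans le_sup_right)
  have h_cyc : m.cycSub ≤ N := le_sup_right.trans (le_sup_right.trans le_sup_right)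
  have h_kills : KillsConstituents v (postcomp N.mkQ m.t) :=
    { swap α w x y := (congrArg N.mkQ (m.t_swap α w x y)).trans (map_neg _ _)
      primitive α w x hw hx :=
        h_mk (h_primitive (Submodule.subset_span ⟨α, w, x, hw, hx, rfl⟩))
      cyc α w x y := h_mk (h_cyc (Submodule.subset_span ⟨α, w, x, y, rfl⟩))
      trace x y := (map_sum N.mkQ _ _).symm.trans
        (h_mk (h_trace (Submodule.subset_span ⟨x, y, (m.trace_apply v x y).symm⟩)))
      polar w := (map_sum N.mkQ _ _).symm.trans
        (h_mk (h_polar (Submodule.subset_span ⟨w, (m.polar_apply v w w).symm⟩))) }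
  have h_zero : N.mkQ = 0 := m.ext fun α w x y =>
    LinearMap.congr_fun₂ (LinearMap.congr_fun₂ (h_kills.eq_zero hd) α w) x y
  rw [← N.ker_mkQ, h_zero, LinearMap.ker_zero]

theorem cycSub_le (hd : 3 ≤ d) : m.cycSub ≤ m.cycPrimitive ⊔ m.cycTraceSub v := by
  set N := m.cycPrimitive ⊔ m.cycTraceSub v
  have h_mk : ∀ {z}, z ∈ N → N.mkQ z = 0 := fun h => by rwa [← LinearMap.mem_ker, N.ker_mkQ]
  have h_primitive : m.cycPrimitive ≤ N := le_sup_left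
  have h_trace : m.cycTraceSub v ≤ N := le_sup_right
  have h_kills : KillsCyclicConstituents v (postcomp N.mkQ m.cyc) :=
    { swap α w x y := (congrArg N.mkQ (m.cyc_swap α w x y)).trans (map_neg _ _)
      rotate α w x y := congrArg N.mkQ (m.cyc_rotate α w x y)
      primitive α w x y hw hx hy :=
        h_mk (h_primitive (Submodule.subset_span ⟨α, w, x, y, hw, hx, hy, rfl⟩))
      trace x y := (map_sum N.mkQ _ _).symm.trans
        (h_mk (h_trace (Submodule.subset_span ⟨x, y, (m.cycTrace_apply v x y).symm⟩))) }
  refine Submodule.span_le.2 ?_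
  rintro _ ⟨α, w, x, y, rfl⟩
  rw [SetLike.mem_coe, ← N.ker_mkQ, LinearMap.mem_ker]
  exact LinearMap.congr_fun₂ (LinearMap.congr_fun₂ (h_kills.eq_zero hd) α w) x y

end TensModel

section Transitivity

variable {K M : Type*} [Field K] [AddCommGroup M] [Module K M] {ι : Type*}

theorem exists_linearIndependent_option_of_dual {α : Dual K M} (hα : α ≠ 0) {x : ι → M}
    (hx : LinearIndependent K x) (hαx : ∀ i, α (x i) = 0) :
    ∃ p, α p = 1 ∧ LinearIndependent K fun o : Option ι => o.casesOn' p x := by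
  obtain ⟨p, hp⟩ := LinearMap.surjective hα 1
  refine ⟨p, hp, linearIndependent_option'.2 ⟨hx, fun h => one_ne_zero (α := K) ?_⟩⟩
  have h_le : Submodule.span K (Set.range x) ≤ LinearMap.ker α := by
    rw [Submodule.span_le]
    rintro _ ⟨i, rfl⟩
    exact hαx i
  rw [← hp, LinearMap.mem_ker.1 (h_le h)]

variable [Finite ι]

theorem exists_linearEquiv_of_linearIndependent {x y : ι → M} (hx : LinearIndependent K x)
    (hy : LinearIndependent K y) : ∃ e : M ≃ₗ[K] M, ∀ i, e (x i) = y i := by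
  have : FiniteDimensional K (Submodule.span K (Set.range x)) :=
    FiniteDimensional.span_of_finite K (Set.finite_range _)
  obtain ⟨e, he⟩ := Submodule.exists_linearEquiv_restrict_eq
    (hx.linearCombinationEquiv.symm ≪≫ₗ hy.linearCombinationEquiv)
  refine ⟨e, fun i => ?_⟩
  simpa using (he (hx.linearCombinationEquiv (Finsupp.single i 1))).symm

/-- Move `x` to `y` and a vector `p` with `α p = 1` to one with `β = 1`, then correct the covector
by a transvection along `p`. -/
theorem exists_linearEquiv_of_linearIndependent_of_dual {x y : ι → M} (hx : LinearIndependent K x)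
    (hy : LinearIndependent K y) {α β : Dual K M} (hα : α ≠ 0) (hβ : β ≠ 0)
    (hαx : ∀ i, α (x i) = 0) (hβy : ∀ i, β (y i) = 0) :
    ∃ e : M ≃ₗ[K] M, (∀ i, e (x i) = y i) ∧ β ∘ₗ e = α := by
  obtain ⟨p, hp, hpx⟩ := exists_linearIndependent_option_of_dual hα hx hαx
  obtain ⟨r, hr, hry⟩ := exists_linearIndependent_option_of_dual hβ hy hβy
  obtain ⟨e, he⟩ := exists_linearEquiv_of_linearIndependent hpx hry
  have hep : e p = r := he none
  have hex : ∀ i, e (x i) = y i := fun i => he (some i)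
  have h_zero : (α - β ∘ₗ e.toLinearMap) p = 0 := by simp [hp, hep, hr]
  refine ⟨LinearEquiv.transvection h_zero ≪≫ₗ e, fun i => ?_, LinearMap.ext fun z => ?_⟩
  · simp [LinearMap.transvection.apply, hαx, hex, hβy]
  · simp [LinearMap.transvection.apply, hep, hr]

theorem injective_pair {κ : Type*} {j k : κ} (hjk : j ≠ k) : Function.Injective ![j, k] := by
  intro p r h
  fin_cases p <;> fin_cases r <;> simp_all

theorem injective_triple {κ : Type*} {j i k : κ} (hji : j ≠ i) (hjk : j ≠ k) (hik : i ≠ k) :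
    Function.Injective ![j, i, k] := by
  intro p r h
  fin_cases p <;> fin_cases r <;> simp_all

theorem linearIndependent_pair_of_ne_zero {N : Type*} [AddCommGroup N] [Module K N]
    {f : M →ₗ[K] M →ₗ[K] N} (hf : ∀ w, f w w = 0) {w x : M} (h : f w x ≠ 0) :
    LinearIndependent K ![w, x] := by
  have hw : w ≠ 0 := by
    rintro rfl
    simp at h
  rw [LinearIndependent.pair_iff' hw]
  rintro c rfl
  exact h (by rw [map_smul, hf, smul_zero])

end Transitivity

section GLAction

variable {W : Type*} [AddCommGroup W] [Module ℂ W]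

/-- The element of `GL(W)` given by a linear automorphism. -/
abbrev toGL (e : W ≃ₗ[ℂ] W) : GLW W := LinearMap.GeneralLinearGroup.ofLinearEquiv e

theorem stdRep_toGL (e : W ≃ₗ[ℂ] W) (w : W) : stdRep W (toGL e) w = e w := rfl

theorem stdRep_toGL_inv (e : W ≃ₗ[ℂ] W) (w : W) : stdRep W (toGL e)⁻¹ w = e.symm w := rfl

theorem det_stdRep_ne_zero (g : GLW W) : LinearMap.det (stdRep W g) ≠ 0 := by
  have h : LinearMap.det (stdRep W g) * LinearMap.det (stdRep W g⁻¹) = 1 := by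
    rw [← map_mul, ← map_mul, mul_inv_cancel, map_one, map_one]
  exact left_ne_zero_of_mul_eq_one h

theorem exists_stdRep_of_linearIndependent {ι : Type*} [Finite ι] {x y : ι → W}
    (hx : LinearIndependent ℂ x) (hy : LinearIndependent ℂ y) :
    ∃ g : GLW W, ∀ i, stdRep W g (x i) = y i := by
  obtain ⟨e, he⟩ := exists_linearEquiv_of_linearIndependent hx hy
  exact ⟨toGL e, he⟩

theorem exists_stdRep_of_linearIndependent_of_dual {ι : Type*} [Finite ι] {x y : ι → W}
    (hx : LinearIndependent ℂ x) (hy : LinearIndependent ℂ y) {α β : Dual ℂ W} (hα : α ≠ 0)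
    (hβ : β ≠ 0) (hαx : ∀ i, α (x i) = 0) (hβy : ∀ i, β (y i) = 0) :
    ∃ g : GLW W, (∀ i, stdRep W g (x i) = y i) ∧ α ∘ₗ stdRep W g⁻¹ = β := by
  obtain ⟨e, he, heα⟩ := exists_linearEquiv_of_linearIndependent_of_dual hx hy hα hβ hαx hβy
  refine ⟨toGL e, he, LinearMap.ext fun z => ?_⟩
  rw [← heα]
  exact congrArg β (e.apply_symm_apply z)

end GLAction

section Orbit

variable {K G V : Type*} [Field K] [Group G] [AddCommGroup V] [Module K V]
  (ρ : Representation K G V)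

/-- The subrepresentation generated by a vector. -/
def orbit (u : V) : Subrepresentation ρ where
  toSubmodule := Submodule.span K (Set.range fun g => ρ g u)
  apply_mem_toSubmodule g := by
    suffices Submodule.span K (Set.range fun h => ρ h u) ≤
        (Submodule.span K (Set.range fun h => ρ h u)).comap (ρ g) from fun _ hz => this hz
    rw [Submodule.span_le]
    rintro _ ⟨h, rfl⟩
    exact Submodule.subset_span ⟨g * h, by simp only [map_mul, Module.End.mul_apply]⟩

theorem rep_mem_orbit (u : V) (g : G) : ρ g u ∈ (orbit ρ u).toSubmodule :=
  Submodule.subset_span ⟨g, rfl⟩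

theorem mem_orbit_self (u : V) : u ∈ (orbit ρ u).toSubmodule := by
  simpa using rep_mem_orbit ρ u 1

theorem orbit_le {N : Submodule K V} {u : V} (h : ∀ g, ρ g u ∈ N) :
    (orbit ρ u).toSubmodule ≤ N :=
  Submodule.span_le.2 (Set.range_subset_iff.2 h)

theorem mem_orbit_of_smul {u z : V} {g : G} {c : K} (hc : c ≠ 0) (h : ρ g u = c • z) :
    z ∈ (orbit ρ u).toSubmodule := by
  rw [← Submodule.smul_mem_iff _ hc, ← h]
  exact rep_mem_orbit ρ u g

theorem span_eq_orbit {S : Set V} {u : V} (h_mem : ∀ g, ρ g u ∈ Submodule.span K S)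
    (h_trans : ∀ z ∈ S, z ≠ 0 → ∃ (g : G) (c : K), c ≠ 0 ∧ ρ g u = c • z) :
    Submodule.span K S = (orbit ρ u).toSubmodule := by
  refine le_antisymm (Submodule.span_le.2 fun z hz => ?_) (orbit_le ρ h_mem)
  rcases eq_or_ne z 0 with rfl | h_ne
  · exact Submodule.zero_mem _
  · obtain ⟨g, c, hc, h⟩ := h_trans z hz h_ne
    exact mem_orbit_of_smul ρ hc h

/-- `z` is an eigenvector of every `g` that has `u` as an eigenvector, for the same eigenvalue;
the image of `u` under an equivariant map has this property. -/
def InheritsEigenvalues (u z : V) : Prop := ∀ (g : G) (c : K), ρ g u = c • u → ρ g z = c • z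

theorem InheritsEigenvalues.refl (u : V) : InheritsEigenvalues ρ u u := fun _ _ h => h

variable {ρ}

theorem InheritsEigenvalues.sub_smul {u z z' : V} (h : InheritsEigenvalues ρ u z)
    (h' : InheritsEigenvalues ρ u z') (c : K) : InheritsEigenvalues ρ u (z - c • z') :=
  fun g r hg => by rw [map_sub, map_smul, h g r hg, h' g r hg, smul_sub, smul_comm]

/-- Subtracting a multiple of `u` reduces the claim to vectors on which `φ` vanishes. -/
theorem InheritsEigenvalues.eq_smul {u z : V} (φ : Dual K V) (hφ : φ u = 1)
    (h_zero : ∀ z, InheritsEigenvalues ρ u z → φ z = 0 → z = 0)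
    (hz : InheritsEigenvalues ρ u z) : z = φ z • u := by
  rw [← sub_eq_zero]
  exact h_zero _ (hz.sub_smul (.refl ρ u) _) (by simp [hφ])

end Orbit

section Uncurry

variable {K M N : Type*} [CommRing K] [AddCommGroup M] [Module K M] [AddCommGroup N] [Module K N]

/-- Trilinear maps as multilinear maps in three variables. -/
def uncurryTrilinear :
    (M →ₗ[K] M →ₗ[K] M →ₗ[K] N) →ₗ[K] MultilinearMap K (fun _ : Fin 3 => M) N where
  toFun f :=
    { toFun := fun z => f (z 0) (z 1) (z 2)
      map_update_add' := fun {inst} z i x y => by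
        obtain rfl : inst = instDecidableEqFin _ := Subsingleton.elim _ _
        fin_cases i <;> simp
      map_update_smul' := fun {inst} z i c x => by
        obtain rfl : inst = instDecidableEqFin _ := Subsingleton.elim _ _
        fin_cases i <;> simp }
  map_add' _ _ := rfl
  map_smul' _ _ := rfl

/-- Bilinear maps as multilinear maps in two variables. -/
def uncurryBilinear : (M →ₗ[K] M →ₗ[K] N) →ₗ[K] MultilinearMap K (fun _ : Fin 2 => M) N where
  toFun f :=
    { toFun := fun z => f (z 0) (z 1)
      map_update_add' := fun {inst} z i x y => by
        obtain rfl : inst = instDecidableEqFin _ := Subsingleton.elim _ _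
        fin_cases i <;> simp
      map_update_smul' := fun {inst} z i c x => by
        obtain rfl : inst = instDecidableEqFin _ := Subsingleton.elim _ _
        fin_cases i <;> simp }
  map_add' _ _ := rfl
  map_smul' _ _ := rfl

end Uncurry

namespace TensModel

variable {d : ℕ} {W T : Type*} [AddCommGroup W] [Module ℂ W] [AddCommGroup T] [Module ℂ T]
  (m : TensModel W T) (v : Basis (Fin d) ℂ W)

theorem linearIndependent_of_cyc_ne_zero {α : Dual ℂ W} {w x y : W} (h : m.cyc α w x y ≠ 0) :
    LinearIndependent ℂ ![w, x, y] := by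
  let f : W [⋀^Fin 3]→ₗ[ℂ] T :=
    { uncurryTrilinear (m.cyc α) with
      map_eq_zero_of_eq' := fun z i j hz hij => by
        change m.cyc α (z 0) (z 1) (z 2) = 0
        have h_left : ∀ p r, m.cyc α p p r = 0 := fun p r => by rw [m.cyc_rotate, m.cyc_self]
        have h_outer : ∀ p r, m.cyc α p r p = 0 := fun p r => by rw [m.cyc_swap, h_left, neg_zero]
        fin_cases i <;> fin_cases j <;> simp at hij hz <;>
          simp only [hz, h_left, h_outer, m.cyc_self] }
  by_contra h_dep
  exact h (f.map_linearDependent ![w, x, y] h_dep)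

theorem primitive_eq_orbit {a j k : Fin d} (haj : a ≠ j) (hak : a ≠ k) (hjk : j ≠ k) :
    m.primitive = (orbit m.rep (m.t (v.coord a) (v j) (v j) (v k))).toSubmodule := by
  refine span_eq_orbit _ (fun g => ?_) ?_
  · rw [m.rep_t]
    refine Submodule.smul_mem _ _ (Submodule.subset_span ⟨_, _, _, ?_, ?_, rfl⟩)
    · simp [haj.symm]
    · simp [hak.symm]
  · rintro _ ⟨α, w, x, hw, hx, rfl⟩ h_ne
    have h_ind : LinearIndependent ℂ ![w, x] :=
      linearIndependent_pair_of_ne_zero (f := m.t α w) (fun x => m.t_self α w x) h_ne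
    have hα : α ≠ 0 := by
      rintro rfl
      simp at h_ne
    obtain ⟨g, hg, hgα⟩ := exists_stdRep_of_linearIndependent_of_dual
      (v.linearIndependent.comp _ (injective_pair hjk)) h_ind (α := v.coord a)
      (fun h => by simpa using LinearMap.congr_fun h (v a)) hα
      (fun i => by fin_cases i <;> simp [haj.symm, hak.symm])
      (fun i => by fin_cases i <;> simp [hw, hx])
    have hgj : stdRep W g (v j) = w := hg 0
    have hgk : stdRep W g (v k) = x := hg 1
    exact ⟨g, _, det_stdRep_ne_zero g, by rw [m.rep_t, hgj, hgk, hgα]⟩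

theorem cycPrimitive_eq_orbit {a j i k : Fin d} (haj : a ≠ j) (hai : a ≠ i) (hak : a ≠ k)
    (hji : j ≠ i) (hjk : j ≠ k) (hik : i ≠ k) :
    m.cycPrimitive = (orbit m.rep (m.cyc (v.coord a) (v j) (v i) (v k))).toSubmodule := by
  refine span_eq_orbit _ (fun g => ?_) ?_
  · rw [m.rep_cyc]
    refine Submodule.smul_mem _ _ (Submodule.subset_span ⟨_, _, _, _, ?_, ?_, ?_, rfl⟩)
    · simp [haj.symm]
    · simp [hai.symm]
    · simp [hak.symm]
  · rintro _ ⟨α, w, x, y, hw, hx, hy, rfl⟩ h_ne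
    have hα : α ≠ 0 := by
      rintro rfl
      simp at h_ne
    obtain ⟨g, hg, hgα⟩ := exists_stdRep_of_linearIndependent_of_dual
      (v.linearIndependent.comp _ (injective_triple hji hjk hik))
      (m.linearIndependent_of_cyc_ne_zero h_ne) (α := v.coord a)
      (fun h => by simpa using LinearMap.congr_fun h (v a)) hα
      (fun i => by fin_cases i <;> simp [haj.symm, hai.symm, hak.symm])
      (fun i => by fin_cases i <;> simp [hw, hx, hy])
    have hgj : stdRep W g (v j) = w := hg 0
    have hgi : stdRep W g (v i) = x := hg 1
    have hgk : stdRep W g (v k) = y := hg 2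
    exact ⟨g, _, det_stdRep_ne_zero g, by rw [m.rep_cyc, hgj, hgi, hgk, hgα]⟩

theorem cycPrimitive_eq_bot (v : Basis (Fin 3) ℂ W) : m.cycPrimitive = ⊥ := by
  refine Submodule.span_eq_bot.2 ?_
  rintro _ ⟨α, w, x, y, hw, hx, hy, rfl⟩
  by_contra h_ne
  have h_span := (m.linearIndependent_of_cyc_ne_zero h_ne).span_eq_top_of_card_eq_finrank
    (by rw [Module.finrank_eq_card_basis v])
  have hα : α = 0 := by
    refine LinearMap.ext_on h_span ?_
    rintro _ ⟨i, rfl⟩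
    fin_cases i <;> simp [hw, hx, hy]
  exact h_ne (by rw [hα]; simp)

theorem polarSub_eq_orbit (j : Fin d) :
    m.polarSub v = (orbit m.rep (m.polar v (v j) (v j))).toSubmodule := by
  refine span_eq_orbit _ (fun g => ?_) ?_
  · rw [m.rep_polar]
    exact Submodule.smul_mem _ _ (Submodule.subset_span ⟨_, rfl⟩)
  · rintro _ ⟨w, rfl⟩ h_ne
    have hw : w ≠ 0 := by
      rintro rfl
      simp at h_ne
    obtain ⟨g, hg⟩ := exists_stdRep_of_linearIndependent (x := fun _ : Unit => v j)
      (y := fun _ => w) (.of_subsingleton () (v.ne_zero j)) (.of_subsingleton () hw)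
    exact ⟨g, _, det_stdRep_ne_zero g, by rw [m.rep_polar, hg ()]⟩

theorem span_alternating_eq_orbit {f : W →ₗ[ℂ] W →ₗ[ℂ] T} (hf : ∀ w, f w w = 0)
    (h_rep : ∀ g x y, m.rep g (f x y) =
      LinearMap.det (stdRep W g) • f (stdRep W g x) (stdRep W g y))
    {i k : Fin d} (hik : i ≠ k) :
    Submodule.span ℂ {z | ∃ x y, z = f x y} = (orbit m.rep (f (v i) (v k))).toSubmodule := by
  refine span_eq_orbit _ (fun g => ?_) ?_
  · rw [h_rep]
    exact Submodule.smul_mem _ _ (Submodule.subset_span ⟨_, _, rfl⟩)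
  · rintro _ ⟨w, x, rfl⟩ h_ne
    obtain ⟨g, hg⟩ := exists_stdRep_of_linearIndependent
      (v.linearIndependent.comp _ (injective_pair hik)) (linearIndependent_pair_of_ne_zero hf h_ne)
    have hgi : stdRep W g (v i) = w := hg 0
    have hgk : stdRep W g (v k) = x := hg 1
    exact ⟨g, _, det_stdRep_ne_zero g, by rw [h_rep, hgi, hgk]⟩

end TensModel

section Elements

variable {d : ℕ} {W : Type*} [AddCommGroup W] [Module ℂ W] (v : Basis (Fin d) ℂ W)

/-- The weight of `v_i` under `dilation v p`. -/
def dilWeight (p i : Fin d) : ℤ := if i = p then 1 else 0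

/-- The automorphism of `W` that doubles `v_p` and fixes the other basis vectors. -/
def dilation (p : Fin d) : GLW W :=
  toGL (v.equiv (v.unitsSMul fun i => if i = p then Units.mk0 2 two_ne_zero else 1)
    (Equiv.refl _))

theorem dilation_apply (p i : Fin d) :
    stdRep W (dilation v p) (v i) = (2 : ℂ) ^ dilWeight p i • v i := by
  rw [dilation, stdRep_toGL, Basis.equiv_apply, Equiv.refl_apply, Basis.unitsSMul_apply, dilWeight]
  split_ifs <;> simp [Units.smul_def]

theorem dilation_inv_apply (p i : Fin d) :
    stdRep W (dilation v p)⁻¹ (v i) = (2 : ℂ) ^ (-dilWeight p i) • v i := by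
  have h := stdRep_inv_apply (dilation v p) (v i)
  rw [dilation_apply, map_smul] at h
  rw [← one_smul ℂ (stdRep W (dilation v p)⁻¹ (v i)),
    ← zpow_neg_mul_zpow_self (dilWeight p i) (two_ne_zero (α := ℂ)), mul_smul, h]

theorem coord_comp_dilation (p j : Fin d) :
    v.coord j ∘ₗ stdRep W (dilation v p) = (2 : ℂ) ^ dilWeight p j • v.coord j := by
  refine v.ext fun i => ?_
  rw [LinearMap.comp_apply, dilation_apply, map_smul, LinearMap.smul_apply, coord_basis]
  split_ifs with h
  · rw [h]
  · simp

/-- The automorphism of `W` that permutes the basis vectors by `σ`. -/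
def permutation (σ : Equiv.Perm (Fin d)) : GLW W := toGL (v.equiv v σ)

theorem permutation_apply (σ : Equiv.Perm (Fin d)) (i : Fin d) :
    stdRep W (permutation v σ) (v i) = v (σ i) := by
  rw [permutation, stdRep_toGL, Basis.equiv_apply]

theorem permutation_inv_apply (σ : Equiv.Perm (Fin d)) (i : Fin d) :
    stdRep W (permutation v σ)⁻¹ (v i) = v (σ.symm i) := by
  rw [permutation, stdRep_toGL_inv, Basis.equiv_symm, Basis.equiv_apply]

theorem coord_comp_permutation (σ : Equiv.Perm (Fin d)) (j : Fin d) :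
    v.coord j ∘ₗ stdRep W (permutation v σ) = v.coord (σ.symm j) := by
  refine v.ext fun i => ?_
  rw [LinearMap.comp_apply, permutation_apply, coord_basis, coord_basis]
  simp only [Equiv.symm_apply_eq]

/-- The transvection of `W` that maps `v_p` to `v_p + v_r` and fixes the other basis vectors. -/
def basisTransvection {p r : Fin d} (h : r ≠ p) : GLW W :=
  toGL (LinearEquiv.transvection (f := v.coord p) (v := v r) (by rw [coord_basis, if_neg h.symm]))

theorem basisTransvection_apply {p r : Fin d} (h : r ≠ p) (z : W) :
    stdRep W (basisTransvection v h) z = z + v.coord p z • v r := rfl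

theorem basisTransvection_inv_apply {p r : Fin d} (h : r ≠ p) (z : W) :
    stdRep W (basisTransvection v h)⁻¹ z = z - v.coord p z • v r := by
  rw [basisTransvection, stdRep_toGL_inv, LinearEquiv.symm_apply_eq]
  simp [LinearMap.transvection.apply, h]

end Elements

namespace TensModel

variable {d : ℕ} {W T : Type*} [AddCommGroup W] [Module ℂ W] [AddCommGroup T] [Module ℂ T]
  (m : TensModel W T) (v : Basis (Fin d) ℂ W)

/-- The weight of `t(v_a^*; v_j, v_i, v_k)` under `dilation v p`. -/
def weight (p a j i k : Fin d) : ℤ :=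
  dilWeight p j + dilWeight p i + dilWeight p k - dilWeight p a

theorem mem_of_weight_pos {p a j i k : Fin d} (h : 0 < weight p a j i k) :
    p = j ∨ p = i ∨ p = k := by
  by_contra! hh
  simp only [weight, dilWeight, if_neg hh.1.symm, if_neg hh.2.1.symm, if_neg hh.2.2.symm] at h
  split_ifs at h <;> omega

theorem eq_of_weight_neg {p a j i k : Fin d} (h : weight p a j i k < 0) : p = a := by
  by_contra hh
  simp only [weight, dilWeight, if_neg (Ne.symm hh)] at h
  split_ifs at h <;> omega

theorem indices_of_weight_eq_of_distinct {a j i k a' j' i' k' : Fin d} (haj : a ≠ j)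
    (hai : a ≠ i) (hak : a ≠ k) (hji : j ≠ i) (hjk : j ≠ k) (hik : i ≠ k)
    (h : ∀ p, weight p a' j' i' k' = weight p a j i k) :
    a' = a ∧ (j' = j ∧ i' = i ∧ k' = k ∨ j' = j ∧ i' = k ∧ k' = i ∨ j' = i ∧ i' = j ∧ k' = k ∨
    j' = i ∧ i' = k ∧ k' = j ∨ j' = k ∧ i' = i ∧ k' = j ∨ j' = k ∧ i' = j ∧ k' = i) := by
  have h_dual : a = a' := eq_of_weight_neg (j := j') (i := i') (k := k') (by
    rw [h]; simp [weight, dilWeight, haj.symm, hai.symm, hak.symm])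
  have h_first := mem_of_weight_pos (p := j) (a := a') (j := j') (i := i') (k := k') (by
    rw [h]; simp [weight, dilWeight, haj, hji.symm, hjk.symm])
  have h_second := mem_of_weight_pos (p := i) (a := a') (j := j') (i := i') (k := k') (by
    rw [h]; simp [weight, dilWeight, hai, hji, hik.symm])
  have h_third := mem_of_weight_pos (p := k) (a := a') (j := j') (i := i') (k := k') (by
    rw [h]; simp [weight, dilWeight, hak, hjk, hik])
  clear h
  grind

theorem indices_of_weight_eq_pair {p r a j i k : Fin d} (hpr : p ≠ r) (hik : i ≠ k)
    (h : ∀ q, weight q a j i k = dilWeight q p + dilWeight q r) :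
    (a = p ∨ a = r) ∧ (j = a ∧ (i = p ∧ k = r ∨ i = r ∧ k = p)) ∨
    (a ≠ p ∧ a ≠ r ∧ (j = p ∧ (i = r ∧ k = a ∨ i = a ∧ k = r) ∨
      j = r ∧ (i = p ∧ k = a ∨ i = a ∧ k = p) ∨ j = a ∧ (i = p ∧ k = r ∨ i = r ∧ k = p))) := by
  have hp := mem_of_weight_pos (p := p) (a := a) (j := j) (i := i) (k := k) (by
    rw [h]; simp [dilWeight, hpr.symm])
  have hr := mem_of_weight_pos (p := r) (a := a) (j := j) (i := i) (k := k) (by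
    rw [h]; simp [dilWeight, hpr])
  have ha : a = j ∨ a = i ∨ a = k := by
    have h_weight := h a
    by_contra! hh
    simp only [weight, dilWeight, if_neg hh.1.symm, if_neg hh.2.1.symm, if_neg hh.2.2.symm]
      at h_weight
    split_ifs at h_weight <;> omega
  have hap : a = p → j = p ∧ (i = p ∨ k = p) := by
    rintro rfl
    have h_weight := h a
    simp only [weight, dilWeight, if_neg hpr.symm, if_true] at h_weight
    split_ifs at h_weight <;> omega
  have har : a = r → j = r ∧ (i = r ∨ k = r) := by
    rintro rfl
    have h_weight := h a
    simp only [weight, dilWeight, if_neg hpr, if_true] at h_weight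
    split_ifs at h_weight <;> omega
  clear h
  by_cases a = p
  · grind
  by_cases a = r <;> grind

theorem form_smul (c c₁ c₂ c₃ : ℂ) (ω : W) (β γ δ : Dual ℂ W) :
    m.form (c • ω) (c₁ • β) (c₂ • γ) (c₃ • δ) = (c * (c₁ * (c₂ * c₃))) • m.form ω β γ δ := by
  refine m.ext fun α w x y => ?_
  rw [LinearMap.smul_apply, m.form_t, m.form_t]
  simp only [map_smul, LinearMap.smul_apply, smul_eq_mul]
  ring

theorem coord_rep_dilation (p a j i k : Fin d) (z : T) :
    m.coord v a j i k (m.rep (dilation v p) z) = LinearMap.det (stdRep W (dilation v p)) *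
      (2 : ℂ) ^ weight p a j i k * m.coord v a j i k z := by
  rw [coord, m.form_rep, dilation_inv_apply, coord_comp_dilation, coord_comp_dilation,
    coord_comp_dilation, form_smul, LinearMap.smul_apply, smul_eq_mul, ← zpow_add₀ two_ne_zero,
    ← zpow_add₀ two_ne_zero, ← zpow_add₀ two_ne_zero, mul_assoc, weight]
  ring_nf

theorem coord_rep_permutation (σ : Equiv.Perm (Fin d)) (a j i k : Fin d) (z : T) :
    m.coord v a j i k (m.rep (permutation v σ) z) = LinearMap.det (stdRep W (permutation v σ)) *
      m.coord v (σ.symm a) (σ.symm j) (σ.symm i) (σ.symm k) z := by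
  rw [coord, m.form_rep, permutation_inv_apply, coord_comp_permutation, coord_comp_permutation,
    coord_comp_permutation, coord]

variable {v m}

theorem weight_eq_of_coord_ne_zero {p a j i k : Fin d} {z : T} {e : ℤ}
    (h : m.rep (dilation v p) z =
      (LinearMap.det (stdRep W (dilation v p)) * (2 : ℂ) ^ e) • z)
    (hz : m.coord v a j i k z ≠ 0) : weight p a j i k = e := by
  have h_coord := congrArg (m.coord v a j i k) h
  rw [coord_rep_dilation, map_smul, smul_eq_mul] at h_coord
  have h_complex := mul_left_cancel₀ (det_stdRep_ne_zero _) (mul_right_cancel₀ hz h_coord)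
  have h_real : (2 : ℝ) ^ weight p a j i k = 2 ^ e :=
    Complex.ofReal_injective (by push_cast; exact h_complex)
  exact zpow_right_injective₀ two_pos (by norm_num) h_real

variable (v m)

theorem rep_dilation_t (p a j i k : Fin d) :
    m.rep (dilation v p) (m.t (v.coord a) (v j) (v i) (v k)) =
      (LinearMap.det (stdRep W (dilation v p)) * (2 : ℂ) ^ weight p a j i k) •
        m.t (v.coord a) (v j) (v i) (v k) := by
  have hc : v.coord a ∘ₗ stdRep W (dilation v p)⁻¹ = (2 : ℂ) ^ (-dilWeight p a) • v.coord a := by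
    refine v.ext fun i => ?_
    rw [LinearMap.comp_apply, dilation_inv_apply, map_smul, LinearMap.smul_apply, coord_basis]
    split_ifs with h
    · rw [h]
    · simp
  rw [m.rep_t, hc, dilation_apply, dilation_apply, dilation_apply]
  simp only [map_smul, LinearMap.smul_apply, smul_smul, weight, sub_eq_add_neg,
    zpow_add₀ (two_ne_zero (α := ℂ))]
  congr 1
  ring

theorem rep_dilation_cyc (p a j i k : Fin d) :
    m.rep (dilation v p) (m.cyc (v.coord a) (v j) (v i) (v k)) =
      (LinearMap.det (stdRep W (dilation v p)) * (2 : ℂ) ^ weight p a j i k) •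
        m.cyc (v.coord a) (v j) (v i) (v k) := by
  rw [m.cyc_apply, map_add, map_add, rep_dilation_t, rep_dilation_t, rep_dilation_t, smul_add,
    smul_add, show weight p a i k j = weight p a j i k by simp only [weight]; ring,
    show weight p a k j i = weight p a j i k by simp only [weight]; ring]

theorem rep_dilation_bilin (f : W →ₗ[ℂ] W →ₗ[ℂ] T)
    (h_rep : ∀ g x y, m.rep g (f x y) =
      LinearMap.det (stdRep W g) • f (stdRep W g x) (stdRep W g y)) (p i k : Fin d) :
    m.rep (dilation v p) (f (v i) (v k)) = (LinearMap.det (stdRep W (dilation v p)) *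
      (2 : ℂ) ^ (dilWeight p i + dilWeight p k)) • f (v i) (v k) := by
  rw [h_rep, dilation_apply, dilation_apply]
  simp only [map_smul, LinearMap.smul_apply, smul_smul, zpow_add₀ (two_ne_zero (α := ℂ))]
  congr 1
  ring

theorem eq_smul_t_of_inheritsEigenvalues {a j k : Fin d} (haj : a ≠ j) (hak : a ≠ k)
    (hjk : j ≠ k) {z : T}
    (hz : InheritsEigenvalues m.rep (m.t (v.coord a) (v j) (v j) (v k)) z) :
    z = m.coord v a j j k z • m.t (v.coord a) (v j) (v j) (v k) := by
  refine hz.eq_smul _ (by simp [coord_t, hjk, hjk.symm]) fun z hz h_zero => ?_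
  refine m.eq_zero_of_coord v fun a' j' i' k' => ?_
  by_contra h_ne
  have h_weight := fun p =>
    weight_eq_of_coord_ne_zero (hz (dilation v p) _ (m.rep_dilation_t v p a j j k)) h_ne
  have hik : i' ≠ k' := by rintro rfl; exact h_ne (m.coord_self v _ _ _ _)
  have ha := h_weight a
  have hj := h_weight j
  have hk := h_weight k
  simp only [weight, dilWeight] at ha hj hk
  have h_zero_swap : m.coord v a j k j z = 0 := by rw [coord_swap, h_zero, neg_zero]
  have : a' = a := by grind
  have : j' = j := by grind
  have : i' = j ∧ k' = k ∨ i' = k ∧ k' = j := by grind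
  grind

theorem rep_permutation_bilin (f : W →ₗ[ℂ] W →ₗ[ℂ] T)
    (h_rep : ∀ g x y, m.rep g (f x y) =
      LinearMap.det (stdRep W g) • f (stdRep W g x) (stdRep W g y))
    (σ : Equiv.Perm (Fin d)) (i k : Fin d) :
    m.rep (permutation v σ) (f (v i) (v k)) =
      LinearMap.det (stdRep W (permutation v σ)) • f (v (σ i)) (v (σ k)) := by
  rw [h_rep, permutation_apply, permutation_apply]

theorem rep_permutation_cyc (σ : Equiv.Perm (Fin d)) (a j i k : Fin d) :
    m.rep (permutation v σ) (m.cyc (v.coord a) (v j) (v i) (v k)) =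
      LinearMap.det (stdRep W (permutation v σ)) •
        m.cyc (v.coord (σ a)) (v (σ j)) (v (σ i)) (v (σ k)) := by
  have hc : v.coord a ∘ₗ stdRep W (permutation v σ)⁻¹ = v.coord (σ a) := by
    refine v.ext fun i => ?_
    rw [LinearMap.comp_apply, permutation_inv_apply, coord_basis, coord_basis]
    simp only [Equiv.eq_symm_apply]
  rw [m.rep_cyc, hc, permutation_apply, permutation_apply, permutation_apply]

variable {v m}

theorem coord_eq_of_permutation {σ : Equiv.Perm (Fin d)} {z : T} {c : ℂ}
    (h : m.rep (permutation v σ) z =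
      (LinearMap.det (stdRep W (permutation v σ)) * c) • z) (a j i k : Fin d) :
    m.coord v a j i k z = c * m.coord v (σ a) (σ j) (σ i) (σ k) z := by
  have h_coord := congrArg (m.coord v (σ a) (σ j) (σ i) (σ k)) h
  rw [coord_rep_permutation, map_smul, smul_eq_mul, mul_assoc] at h_coord
  simpa using mul_left_cancel₀ (det_stdRep_ne_zero _) h_coord

variable (v m)

theorem coord_polar (a j i k p r : Fin d) : m.coord v a j i k (m.polar v (v p) (v r)) =
    (if j = p then 1 else 0) * ((if i = r then 1 else 0) * (if k = a then 1 else 0) -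
      (if i = a then 1 else 0) * (if k = r then 1 else 0)) := by
  simp only [coord, form_polar, coord_basis]

theorem eq_smul_polar_of_inheritsEigenvalues {b j : Fin d} (hbj : b ≠ j) {z : T}
    (hz : InheritsEigenvalues m.rep (m.polar v (v j) (v j)) z) :
    z = m.coord v b j j b z • m.polar v (v j) (v j) := by
  refine hz.eq_smul _ (by simp [coord_polar, hbj, hbj.symm]) fun z hz h_zero => ?_
  have h_zero_of_ne : ∀ a, a ≠ j → m.coord v a j j a z = 0 := fun a ha => by
    have h_perm := hz (permutation v (Equiv.swap a b))
      (LinearMap.det (stdRep W (permutation v (Equiv.swap a b))) * 1) (by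
        rw [m.rep_permutation_bilin v _ (m.rep_polar v), mul_one,
          Equiv.swap_apply_of_ne_of_ne ha.symm hbj.symm])
    rw [coord_eq_of_permutation h_perm, Equiv.swap_apply_of_ne_of_ne ha.symm hbj.symm,
      Equiv.swap_apply_left, h_zero, mul_zero]
  have h_zero_swap : ∀ a, a ≠ j → m.coord v a j a j z = 0 := fun a ha => by
    rw [coord_swap, h_zero_of_ne a ha, neg_zero]
  refine m.eq_zero_of_coord v fun a' j' i' k' => ?_
  by_contra h_ne
  have h_weight := fun p => weight_eq_of_coord_ne_zero
    (hz (dilation v p) _ (m.rep_dilation_bilin v _ (m.rep_polar v) p j j)) h_ne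
  have hik : i' ≠ k' := by rintro rfl; exact h_ne (m.coord_self v _ _ _ _)
  have ha' := h_weight a'
  have hj := h_weight j
  have hj' := h_weight j'
  have hi' := h_weight i'
  have hk' := h_weight k'
  simp only [weight, dilWeight] at ha' hj hj' hi' hk'
  have : a' ≠ j := by grind
  have : j' = j := by grind
  have : i' = j ∧ k' = a' ∨ i' = a' ∧ k' = j := by grind
  grind

variable {m v} in
/-- Two transpositions of `j`, `i`, `k` generate all permutations of these indices. -/
theorem coord_eq_neg_of_inheritsEigenvalues_cyc {a j i k : Fin d} (haj : a ≠ j) (hai : a ≠ i)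
    (hak : a ≠ k) (hji : j ≠ i) (hjk : j ≠ k) (hik : i ≠ k) {z : T}
    (hz : InheritsEigenvalues m.rep (m.cyc (v.coord a) (v j) (v i) (v k)) z) :
    (∀ j' i' k', m.coord v a j' i' k' z = -m.coord v a (Equiv.swap j i j') (Equiv.swap j i i')
      (Equiv.swap j i k') z) ∧
    ∀ j' i' k', m.coord v a j' i' k' z = -m.coord v a (Equiv.swap i k j') (Equiv.swap i k i')
      (Equiv.swap i k k') z := by
  have h_left := hz (permutation v (Equiv.swap j i))
    (LinearMap.det (stdRep W (permutation v (Equiv.swap j i))) * (-1)) (by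
      rw [m.rep_permutation_cyc v, Equiv.swap_apply_left, Equiv.swap_apply_right,
        Equiv.swap_apply_of_ne_of_ne hjk.symm hik.symm, Equiv.swap_apply_of_ne_of_ne haj hai,
        ← m.cyc_rotate, m.cyc_swap, mul_neg, mul_one, smul_neg, neg_smul])
  have h_right := hz (permutation v (Equiv.swap i k))
    (LinearMap.det (stdRep W (permutation v (Equiv.swap i k))) * (-1)) (by
      rw [m.rep_permutation_cyc v, Equiv.swap_apply_left, Equiv.swap_apply_right,
        Equiv.swap_apply_of_ne_of_ne hji hjk, Equiv.swap_apply_of_ne_of_ne hai hak,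
        m.cyc_swap, mul_neg, mul_one, smul_neg, neg_smul])
  constructor <;> intro j' i' k'
  · rw [coord_eq_of_permutation h_left, Equiv.swap_apply_of_ne_of_ne haj hai, neg_one_mul]
  · rw [coord_eq_of_permutation h_right, Equiv.swap_apply_of_ne_of_ne hai hak, neg_one_mul]

theorem eq_smul_cyc_of_inheritsEigenvalues {a j i k : Fin d} (haj : a ≠ j) (hai : a ≠ i)
    (hak : a ≠ k) (hji : j ≠ i) (hjk : j ≠ k) (hik : i ≠ k) {z : T}
    (hz : InheritsEigenvalues m.rep (m.cyc (v.coord a) (v j) (v i) (v k)) z) :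
    z = m.coord v a j i k z • m.cyc (v.coord a) (v j) (v i) (v k) := by
  refine hz.eq_smul _ (by simp [cyc_apply, coord_t, hji, hji.symm, hik, hik.symm, hjk, hjk.symm])
    fun z hz h_jik => ?_
  obtain ⟨h_left, h_right⟩ :=
    coord_eq_neg_of_inheritsEigenvalues_cyc haj hai hak hji hjk hik hz
  have h_jki : m.coord v a j k i z = 0 := by rw [coord_swap, h_jik, neg_zero]
  have h_ijk : m.coord v a i j k z = 0 := by
    rw [h_left, Equiv.swap_apply_left, Equiv.swap_apply_right,
      Equiv.swap_apply_of_ne_of_ne hjk.symm hik.symm, h_jik, neg_zero]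
  have h_ikj : m.coord v a i k j z = 0 := by rw [coord_swap, h_ijk, neg_zero]
  have h_kji : m.coord v a k j i z = 0 := by
    rw [h_right, Equiv.swap_apply_left, Equiv.swap_apply_right,
      Equiv.swap_apply_of_ne_of_ne hji hjk, h_ijk, neg_zero]
  have h_kij : m.coord v a k i j z = 0 := by rw [coord_swap, h_kji, neg_zero]
  refine m.eq_zero_of_coord v fun a' j' i' k' => ?_
  by_contra h_ne
  obtain ⟨rfl, h⟩ := indices_of_weight_eq_of_distinct haj hai hak hji hjk hik fun p =>
    weight_eq_of_coord_ne_zero (hz (dilation v p) _ (m.rep_dilation_cyc v p a j i k)) h_ne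
  rcases h with ⟨rfl, rfl, rfl⟩ | ⟨rfl, rfl, rfl⟩ | ⟨rfl, rfl, rfl⟩ | ⟨rfl, rfl, rfl⟩ |
    ⟨rfl, rfl, rfl⟩ | ⟨rfl, rfl, rfl⟩ <;> contradiction

theorem coord_trace (a j i k p r : Fin d) : m.coord v a j i k (m.trace v (v p) (v r)) =
    (if j = a then 1 else 0) * ((if i = p then 1 else 0) * (if k = r then 1 else 0) -
      (if i = r then 1 else 0) * (if k = p then 1 else 0)) := by
  simp only [coord, form_trace, coord_basis]

theorem coord_cycTrace (a j i k p r : Fin d) : m.coord v a j i k (m.cycTrace v (v p) (v r)) =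
    (if j = a then 1 else 0) * ((if i = p then 1 else 0) * (if k = r then 1 else 0) -
      (if i = r then 1 else 0) * (if k = p then 1 else 0)) +
    (if i = a then 1 else 0) * ((if k = p then 1 else 0) * (if j = r then 1 else 0) -
      (if k = r then 1 else 0) * (if j = p then 1 else 0)) +
    (if k = a then 1 else 0) * ((if j = p then 1 else 0) * (if i = r then 1 else 0) -
      (if j = r then 1 else 0) * (if i = p then 1 else 0)) := by
  simp only [coord, form_cycTrace, coord_basis]

theorem coord_rep_basisTransvection {p s : Fin d} (h : p ≠ s) (r : Fin d) (hrp : r ≠ p)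
    (z : T) : m.coord v s p p r (m.rep (basisTransvection v h) z) =
      LinearMap.det (stdRep W (basisTransvection v h)) *
      (m.coord v s p p r z + m.coord v s p s r z + m.coord v s s p r z + m.coord v s s s r z -
      m.coord v p p p r z - m.coord v p p s r z - m.coord v p s p r z - m.coord v p s s r z) := by
  suffices m.coord v s p p r ∘ₗ m.rep (basisTransvection v h) =
      LinearMap.det (stdRep W (basisTransvection v h)) •
      (m.coord v s p p r + m.coord v s p s r + m.coord v s s p r + m.coord v s s s r -
      m.coord v p p p r - m.coord v p p s r - m.coord v p s p r - m.coord v p s s r) from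
    LinearMap.congr_fun this z
  refine m.ext fun α w x y => ?_
  rw [LinearMap.comp_apply, m.rep_t, map_smul, coord_t]
  simp only [LinearMap.comp_apply, basisTransvection_apply, basisTransvection_inv_apply, map_add,
    map_sub, map_smul, coord_basis, LinearMap.smul_apply, LinearMap.add_apply,
    LinearMap.sub_apply, coord_t, smul_eq_mul, if_true, if_neg hrp]
  ring

/-- `z` is transformed by every `g` as `f (v p) (v r)` is by alternating bilinear maps `f` that are
equivariant up to `det g`; both `trace` and `cycTrace` are such maps. -/
def TransformsAsPair (p r : Fin d) (z : T) : Prop :=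
  ∀ (g : GLW W) (c : ℂ), (∀ f : W →ₗ[ℂ] W →ₗ[ℂ] T, (∀ x y, f y x = -f x y) →
    f (stdRep W g (v p)) (stdRep W g (v r)) = c • f (v p) (v r)) →
    m.rep g z = (LinearMap.det (stdRep W g) * c) • z

variable {m v}

theorem transformsAsPair_of_inheritsEigenvalues {f : W →ₗ[ℂ] W →ₗ[ℂ] T}
    (hf : ∀ x y, f y x = -f x y)
    (h_rep : ∀ g x y, m.rep g (f x y) =
      LinearMap.det (stdRep W g) • f (stdRep W g x) (stdRep W g y)) {p r : Fin d} {z : T}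
    (hz : InheritsEigenvalues m.rep (f (v p) (v r)) z) : m.TransformsAsPair v p r z :=
  fun g c h => hz g _ (by rw [h_rep, h f hf, smul_smul])

namespace TransformsAsPair

variable {p r s : Fin d} {z : T}

theorem sub_smul_trace_sub_smul_cycTrace (hz : m.TransformsAsPair v p r z) (b c : ℂ) :
    m.TransformsAsPair v p r
      (z - (b • m.trace v (v p) (v r) + c • m.cycTrace v (v p) (v r))) := fun g e h => by
  rw [map_sub, map_add, map_smul, map_smul, m.rep_trace, m.rep_cycTrace, h _ (m.trace_swap v),
    h _ (m.cycTrace_swap v), hz g e h]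
  module

theorem weight_eq (hz : m.TransformsAsPair v p r z) {a j i k : Fin d}
    (h : m.coord v a j i k z ≠ 0) (q : Fin d) :
    weight q a j i k = dilWeight q p + dilWeight q r := by
  refine weight_eq_of_coord_ne_zero (hz (dilation v q) _ fun f _ => ?_) h
  rw [dilation_apply, dilation_apply, zpow_add₀ two_ne_zero, mul_comm]
  simp only [map_smul, LinearMap.smul_apply, smul_smul]

theorem coord_swap (hz : m.TransformsAsPair v p r z) (a j i k : Fin d) :
    m.coord v a j i k z = -m.coord v (Equiv.swap p r a) (Equiv.swap p r j) (Equiv.swap p r i)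
      (Equiv.swap p r k) z := by
  have h_perm := hz (permutation v (Equiv.swap p r)) (-1) fun f hf => by
    rw [permutation_apply, permutation_apply, Equiv.swap_apply_left, Equiv.swap_apply_right, hf,
      neg_one_smul]
  rw [coord_eq_of_permutation h_perm, neg_one_mul]

theorem coord_eq_of_ne (hz : m.TransformsAsPair v p r z) (hps : p ≠ s) (hrs : r ≠ s) {a : Fin d}
    (hap : a ≠ p) (har : a ≠ r) (j i k : Fin d) :
    m.coord v a j i k z =
      m.coord v s (Equiv.swap a s j) (Equiv.swap a s i) (Equiv.swap a s k) z := by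
  have h_perm := hz (permutation v (Equiv.swap a s)) 1 fun f _ => by
    rw [permutation_apply, permutation_apply, Equiv.swap_apply_of_ne_of_ne hap.symm hps,
      Equiv.swap_apply_of_ne_of_ne har.symm hrs, one_smul]
  rw [coord_eq_of_permutation h_perm, Equiv.swap_apply_left, one_mul]

/-- The transvection `v_s ↦ v_s + v_p` fixes `v_p` and `v_r`. -/
theorem coord_eq_sub_of_transvection (hz : m.TransformsAsPair v p r z) (hpr : p ≠ r) (hps : p ≠ s)
    (hrs : r ≠ s) : m.coord v s s p r z = m.coord v p p p r z - m.coord v s p s r z := by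
  have h_rep := hz (basisTransvection v hps) 1 fun f _ => by
    rw [basisTransvection_apply, basisTransvection_apply, coord_basis, coord_basis,
      if_neg hps.symm, if_neg hrs.symm]
    simp
  have h_coord := congrArg (m.coord v s p p r) h_rep
  rw [m.coord_rep_basisTransvection v hps r hpr.symm, map_smul, smul_eq_mul, mul_assoc] at h_coord
  have h_sum := mul_left_cancel₀ (det_stdRep_ne_zero _) h_coord
  have h_zero : ∀ {a j i k}, weight s a j i k ≠ dilWeight s p + dilWeight s r →
      m.coord v a j i k z = 0 := fun h => by
    by_contra h_ne
    exact h (hz.weight_eq h_ne s)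
  have h_sssr : m.coord v s s s r z = 0 := h_zero (by simp [weight, dilWeight, hps, hrs])
  have h_ppsr : m.coord v p p s r z = 0 := h_zero (by simp [weight, dilWeight, hps, hrs])
  have h_pspr : m.coord v p s p r z = 0 := h_zero (by simp [weight, dilWeight, hps, hrs])
  have h_pssr : m.coord v p s s r z = 0 := h_zero (by simp [weight, dilWeight, hps, hrs])
  linear_combination h_sum - h_sssr + h_ppsr + h_pspr + h_pssr

theorem eq_zero (hz : m.TransformsAsPair v p r z) (hpr : p ≠ r) (hps : p ≠ s) (hrs : r ≠ s)
    (h_pppr : m.coord v p p p r z = 0) (h_sprs : m.coord v s p r s z = 0) : z = 0 := by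
  have h_spsr : m.coord v s p s r z = 0 := by rw [m.coord_swap, h_sprs, neg_zero]
  have h_sspr : m.coord v s s p r z = 0 := by
    rw [hz.coord_eq_sub_of_transvection hpr hps hrs, h_pppr, h_spsr, sub_zero]
  have h_rrrp : m.coord v r r r p z = 0 := by
    rw [hz.coord_swap, Equiv.swap_apply_left, Equiv.swap_apply_right, h_pppr, neg_zero]
  have h_srps : m.coord v s r p s z = 0 := by
    rw [hz.coord_swap, Equiv.swap_apply_left, Equiv.swap_apply_right,
      Equiv.swap_apply_of_ne_of_ne hps.symm hrs.symm, h_sprs, neg_zero]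
  refine m.eq_zero_of_coord v fun a j i k => ?_
  by_contra h_ne
  have hik : i ≠ k := by rintro rfl; exact h_ne (m.coord_self v _ _ _ _)
  rcases indices_of_weight_eq_pair hpr hik (hz.weight_eq h_ne) with ⟨ha, rfl, hh⟩ | ⟨hap, har, hh⟩
  · rcases ha with rfl | rfl <;> rcases hh with ⟨rfl, rfl⟩ | ⟨rfl, rfl⟩
    · exact h_ne h_pppr
    · exact h_ne (by rw [m.coord_swap, h_pppr, neg_zero])
    · exact h_ne (by rw [m.coord_swap, h_rrrp, neg_zero])
    · exact h_ne h_rrrp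
  · have hp : Equiv.swap a s p = p := Equiv.swap_apply_of_ne_of_ne hap.symm hps
    have hr : Equiv.swap a s r = r := Equiv.swap_apply_of_ne_of_ne har.symm hrs
    refine h_ne ?_
    rw [hz.coord_eq_of_ne hps hrs hap har]
    rcases hh with ⟨rfl, ⟨rfl, rfl⟩ | ⟨rfl, rfl⟩⟩ | ⟨rfl, ⟨rfl, rfl⟩ | ⟨rfl, rfl⟩⟩ |
      ⟨rfl, ⟨rfl, rfl⟩ | ⟨rfl, rfl⟩⟩ <;> rw [hp, hr, Equiv.swap_apply_left]
    · exact h_sprs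
    · exact h_spsr
    · exact h_srps
    · rw [m.coord_swap, h_srps, neg_zero]
    · exact h_sspr
    · rw [m.coord_swap, h_sspr, neg_zero]

theorem eq_smul_trace_add_smul_cycTrace (hz : m.TransformsAsPair v p r z) (hpr : p ≠ r)
    (hps : p ≠ s) (hrs : r ≠ s) :
    z = m.coord v p p p r z • m.trace v (v p) (v r) +
      m.coord v s p r s z • m.cycTrace v (v p) (v r) := by
  rw [← sub_eq_zero]
  refine (hz.sub_smul_trace_sub_smul_cycTrace _ _).eq_zero hpr hps hrs ?_ ?_
  · simp [coord_trace, coord_cycTrace, hpr, hpr.symm]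
  · simp [coord_trace, coord_cycTrace, hpr, hpr.symm, hps, hps.symm, hrs, hrs.symm]

end TransformsAsPair

end TensModel

section SchurModule

variable {d : ℕ} {W : Type*} [AddCommGroup W] [Module ℂ W] (v : Basis (Fin d) ℂ W)
  (μ : YoungDiagram)

/-- The coefficient of `v_{f(c₁)} ⊗ v_{f(c₂)} ⊗ ⋯` in an element of the tensor power. -/
def coef (f : μ.cells → Fin d) : CellTensor W μ →ₗ[ℂ] ℂ :=
  (Basis.piTensorProduct fun _ : μ.cells => v).coord f

theorem coef_tprod (f : μ.cells → Fin d) (y : μ.cells → W) :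
    coef v μ f (PiTensorProduct.tprod ℂ y) = ∏ c, v.coord (f c) (y c) := by
  rw [coef, Basis.coord_apply, Basis.piTensorProduct_repr_tprod_apply]
  rfl

variable {v μ} in
theorem eq_zero_of_coef {z : CellTensor W μ} (h : ∀ f, coef v μ f z = 0) : z = 0 :=
  (Basis.piTensorProduct fun _ : μ.cells => v).ext_elem fun f => by
    simpa [coef] using h f

theorem permCells_tprod (σ : Equiv.Perm μ.cells) (y : μ.cells → W) :
    permCells W μ σ (PiTensorProduct.tprod ℂ y) = PiTensorProduct.tprod ℂ fun c => y (σ.symm c) :=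
  PiTensorProduct.reindex_tprod σ y

theorem coef_permCells (σ : Equiv.Perm μ.cells) (f : μ.cells → Fin d) (z : CellTensor W μ) :
    coef v μ f (permCells W μ σ z) = coef v μ (f ∘ σ) z := by
  suffices coef v μ f ∘ₗ permCells W μ σ = coef v μ (f ∘ σ) from LinearMap.congr_fun this z
  refine PiTensorProduct.ext (MultilinearMap.ext fun y => ?_)
  simp only [LinearMap.compMultilinearMap_apply, LinearMap.comp_apply, permCells_tprod, coef_tprod]
  rw [← Equiv.prod_comp σ]
  simp

/-- The permutations of the cells preserving each row. -/
def rowPerms : Finset (Equiv.Perm μ.cells) := {σ | ∀ c, (σ c).1.1 = c.1.1}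

/-- The permutations of the cells preserving each column. -/
def colPerms : Finset (Equiv.Perm μ.cells) := {σ | ∀ c, (σ c).1.2 = c.1.2}

variable {μ} in
theorem mem_rowPerms {σ : Equiv.Perm μ.cells} : σ ∈ rowPerms μ ↔ ∀ c, (σ c).1.1 = c.1.1 := by
  simp [rowPerms]

variable {μ} in
theorem mem_colPerms {σ : Equiv.Perm μ.cells} : σ ∈ colPerms μ ↔ ∀ c, (σ c).1.2 = c.1.2 := by
  simp [colPerms]

theorem coef_rowSymmetrizer (f : μ.cells → Fin d) (z : CellTensor W μ) :
    coef v μ f (rowSymmetrizer W μ z) = ∑ σ ∈ rowPerms μ, coef v μ (f ∘ σ) z := by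
  simp only [rowSymmetrizer, LinearMap.sum_apply, map_sum, coef_permCells]
  rfl

theorem coef_colAntisymmetrizer (f : μ.cells → Fin d) (z : CellTensor W μ) :
    coef v μ f (colAntisymmetrizer W μ z) =
      ∑ τ ∈ colPerms μ, ((Equiv.Perm.sign τ : ℤ) : ℂ) * coef v μ (f ∘ τ) z := by
  simp only [colAntisymmetrizer, LinearMap.sum_apply, map_sum, LinearMap.smul_apply, map_smul,
    coef_permCells, smul_eq_mul]
  rfl

theorem coef_comp_rowSymmetrizer (f : μ.cells → Fin d) {σ : Equiv.Perm μ.cells}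
    (hσ : σ ∈ rowPerms μ) (z : CellTensor W μ) :
    coef v μ (f ∘ σ) (rowSymmetrizer W μ z) = coef v μ f (rowSymmetrizer W μ z) := by
  rw [coef_rowSymmetrizer, coef_rowSymmetrizer]
  refine Finset.sum_bij' (fun τ _ => σ * τ) (fun τ _ => σ⁻¹ * τ) ?_ ?_ ?_ ?_ ?_
  · intro τ hτ
    rw [mem_rowPerms] at *
    intro c
    rw [Equiv.Perm.mul_apply, hσ, hτ]
  · intro τ hτ
    rw [mem_rowPerms] at *
    intro c
    rw [Equiv.Perm.mul_apply, ← hσ, show σ (σ⁻¹ (τ c)) = τ c from σ.apply_symm_apply _, hτ]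
  · simp
  · simp
  · intro τ _
    rfl

/-- The tensor product of the vectors `v_{ρ(c)}`. -/
def cellVec (ρ : μ.cells → Fin d) : CellTensor W μ := PiTensorProduct.tprod ℂ fun c => v (ρ c)

theorem coef_cellVec (f ρ : μ.cells → Fin d) :
    coef v μ f (cellVec v μ ρ) = if f = ρ then 1 else 0 := by
  rw [cellVec, coef_tprod]
  simp only [coord_basis]
  rw [Fintype.prod_ite_zero]
  simp only [Finset.prod_const_one, funext_iff]

variable {μ} {ρ : μ.cells → Fin d}

theorem coef_colAntisymmetrizer_self (hρ : ∀ c, (ρ c : ℕ) = c.1.1) :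
    coef v μ ρ (colAntisymmetrizer W μ (cellVec v μ ρ)) = 1 := by
  rw [coef_colAntisymmetrizer, Finset.sum_eq_single 1]
  · simp [coef_cellVec]
  · intro τ hτ h_ne
    rw [coef_cellVec, if_neg, mul_zero]
    intro h
    refine h_ne (Equiv.ext fun c => ?_)
    refine Subtype.ext (Prod.ext ?_ (mem_colPerms.1 hτ c))
    rw [← hρ, ← hρ]
    exact congrArg _ (congrFun h c)
  · intro h
    exact absurd (mem_colPerms.2 fun c => rfl) h

theorem comp_eq_self_of_mem_rowPerms (hρ : ∀ c, (ρ c : ℕ) = c.1.1) {σ : Equiv.Perm μ.cells}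
    (hσ : σ ∈ rowPerms μ) : ρ ∘ σ = ρ := by
  funext c
  refine Fin.ext ?_
  rw [Function.comp_apply, hρ, hρ, mem_rowPerms.1 hσ]

theorem exists_real_coef_rowSymmetrizer {z : CellTensor W μ} (h : ∀ f, ∃ r : ℝ, coef v μ f z = r)
    (f : μ.cells → Fin d) :
    ∃ r : ℝ, coef v μ f (rowSymmetrizer W μ z) = r := by
  choose r hr using h
  refine ⟨∑ σ ∈ rowPerms μ, r (f ∘ σ), ?_⟩
  rw [coef_rowSymmetrizer]
  simp [hr]

theorem exists_real_coef_colAntisymmetrizer {z : CellTensor W μ}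
    (h : ∀ f, ∃ r : ℝ, coef v μ f z = r) (f : μ.cells → Fin d) :
    ∃ r : ℝ, coef v μ f (colAntisymmetrizer W μ z) = r := by
  choose r hr using h
  refine ⟨∑ σ ∈ colPerms μ, ((Equiv.Perm.sign σ : ℤ) : ℝ) * r (f ∘ σ), ?_⟩
  rw [coef_colAntisymmetrizer]
  simp [hr]

variable (μ ρ) in
theorem sum_coef_colAntisymmetrizer_mul_coef (z : CellTensor W μ) :
    ∑ f, coef v μ f (colAntisymmetrizer W μ (cellVec v μ ρ)) * coef v μ f z =
      coef v μ ρ (colAntisymmetrizer W μ z) := by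
  have h_inv : ∀ τ ∈ colPerms μ, τ⁻¹ ∈ colPerms μ := fun τ hτ => by
    rw [mem_colPerms] at *
    intro c
    rw [← hτ, show τ (τ⁻¹ c) = c from τ.apply_symm_apply c]
  simp only [coef_colAntisymmetrizer, Finset.sum_mul]
  rw [Finset.sum_comm]
  refine Finset.sum_bij' (fun τ _ => τ⁻¹) (fun τ _ => τ⁻¹) h_inv h_inv
    (fun τ _ => inv_inv τ) (fun τ _ => inv_inv τ) fun τ _ => ?_
  rw [Finset.sum_eq_single (ρ ∘ ⇑τ⁻¹)]
  · have h_comp : (ρ ∘ ⇑τ⁻¹) ∘ ⇑τ = ρ := by funext c; simp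
    rw [coef_cellVec, h_comp, if_pos rfl, mul_one, Equiv.Perm.sign_inv]
  · intro f _ hf
    rw [coef_cellVec, if_neg, mul_zero, zero_mul]
    rintro rfl
    exact hf (by funext c; simp)
  · simp

variable (μ) in
theorem sum_coef_mul_coef_rowSymmetrizer (z : CellTensor W μ) :
    (∑ f, coef v μ f z * coef v μ f (rowSymmetrizer W μ z)) * (rowPerms μ).card =
      ∑ f, coef v μ f (rowSymmetrizer W μ z) ^ 2 := by
  have h_comp : ∀ σ ∈ rowPerms μ,
      ∑ f, coef v μ (f ∘ σ) z * coef v μ f (rowSymmetrizer W μ z) =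
        ∑ f, coef v μ f z * coef v μ f (rowSymmetrizer W μ z) := fun σ hσ => by
    rw [← (Equiv.arrowCongr σ (Equiv.refl (Fin d))).symm.sum_comp
      fun f => coef v μ f z * coef v μ f (rowSymmetrizer W μ z)]
    refine Finset.sum_congr rfl fun f _ => ?_
    rw [← coef_comp_rowSymmetrizer v μ f hσ]
    rfl
  rw [mul_comm, ← nsmul_eq_mul, ← Finset.sum_const, ← Finset.sum_congr rfl h_comp,
    Finset.sum_comm]
  refine Finset.sum_congr rfl fun f _ => ?_
  rw [← Finset.sum_mul, ← coef_rowSymmetrizer, sq]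

/-- The coefficients of `y = rowSymmetrizer (colAntisymmetrizer (cellVec v μ ρ))` are real, and the
sum of their squares is a multiple of one coefficient of `colAntisymmetrizer y`. -/
theorem colAntisymmetrizer_youngSymmetrizer_cellVec_ne_zero (hρ : ∀ c, (ρ c : ℕ) = c.1.1) :
    colAntisymmetrizer W μ (youngSymmetrizer W μ (cellVec v μ ρ)) ≠ 0 := by
  intro h_zero
  rw [youngSymmetrizer, LinearMap.comp_apply] at h_zero
  have h_sum := sum_coef_mul_coef_rowSymmetrizer v μ (colAntisymmetrizer W μ (cellVec v μ ρ))
  rw [sum_coef_colAntisymmetrizer_mul_coef, h_zero, map_zero, zero_mul] at h_sum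
  choose r hr using exists_real_coef_rowSymmetrizer v
    (exists_real_coef_colAntisymmetrizer v (z := cellVec v μ ρ) fun f =>
      ⟨if f = ρ then 1 else 0, by rw [coef_cellVec]; split_ifs <;> simp⟩)
  simp only [hr] at h_sum
  have h_sq : ∑ f, r f ^ 2 = 0 := by exact_mod_cast h_sum.symm
  rw [Finset.sum_eq_zero_iff_of_nonneg fun f _ => sq_nonneg _] at h_sq
  have h_coef := hr ρ
  rw [pow_eq_zero_iff two_ne_zero |>.1 (h_sq ρ (Finset.mem_univ _)), coef_rowSymmetrizer,
    Finset.sum_congr rfl fun σ hσ => by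
      rw [comp_eq_self_of_mem_rowPerms hρ hσ, coef_colAntisymmetrizer_self v hρ]] at h_coef
  have h_card : (rowPerms μ).card ≠ 0 :=
    Finset.card_ne_zero_of_mem (mem_rowPerms.2 fun c => rfl : 1 ∈ rowPerms μ)
  simp [h_card] at h_coef

end SchurModule

section Equivalence

variable {K G V M : Type*} [Field K] [Group G] [AddCommGroup V] [Module K V] [AddCommGroup M]
  [Module K M] {ρ : Representation K G V} {σ : Representation K G M}

theorem nonempty_equiv_of_map_eq {N : Subrepresentation ρ} {L : Subrepresentation σ}
    (f : V →ₗ[K] M) (h_rep : ∀ g, ∀ z ∈ N.toSubmodule, f (ρ g z) = σ g (f z))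
    (h_inj : ∀ z ∈ N.toSubmodule, f z = 0 → z = 0)
    (h_map : N.toSubmodule.map f = L.toSubmodule) :
    Nonempty (N.toRepresentation.Equiv L.toRepresentation) := by
  let F : N.toSubmodule →ₗ[K] L.toSubmodule :=
    f.restrict fun z hz => h_map ▸ Submodule.mem_map_of_mem hz
  have hF : Function.Bijective F := by
    constructor
    · rw [← LinearMap.ker_eq_bot, LinearMap.ker_eq_bot']
      exact fun z hz => Subtype.ext (h_inj z z.2 (congrArg Subtype.val hz))
    · rintro ⟨y, hy⟩
      obtain ⟨z, hz, rfl⟩ := h_map ▸ hy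
      exact ⟨⟨z, hz⟩, rfl⟩
  exact ⟨Representation.Equiv.mk (LinearEquiv.ofBijective F hF) fun g =>
    LinearMap.ext fun z => Subtype.ext (h_rep g z z.2)⟩

theorem apply_apply_eq_smul_of_mem_orbit {f : M →ₗ[K] V} {h : V →ₗ[K] M} {u : V} {c : K}
    (hf : ∀ g z, f (σ g z) = ρ g (f z)) (hh : ∀ g, h (ρ g u) = σ g (h u)) (hc : f (h u) = c • u)
    {z : V} (hz : z ∈ (orbit ρ u).toSubmodule) : f (h z) = c • z := by
  have h_le : (orbit ρ u).toSubmodule ≤ LinearMap.eqLocus (f ∘ₗ h) (c • LinearMap.id) := by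
    refine orbit_le _ fun g => ?_
    simp only [LinearMap.mem_eqLocus, LinearMap.comp_apply, LinearMap.smul_apply,
      LinearMap.id_apply, hh, hf, hc, map_smul]
  exact h_le hz

end Equivalence

section Criterion

variable {d : ℕ} {W T : Type*} [AddCommGroup W] [Module ℂ W] [AddCommGroup T] [Module ℂ T]
  {v : Basis (Fin d) ℂ W} {μ : YoungDiagram} {ρ : μ.cells → Fin d}
  {τ : Representation ℂ (GLW W) T} {B : CellTensor W μ →ₗ[ℂ] T} {A : T →ₗ[ℂ] CellTensor W μ}
  {K : Submodule ℂ T}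

/-- The composite `rowSymmetrizer ∘ A` is equivariant on the range of `B`, and `B` maps the image
of the generator back to a nonzero multiple of the generator. -/
theorem orbit_equiv_schur (hρ : ∀ c, (ρ c : ℕ) = c.1.1)
    (hB : ∀ g z, B (cellRep W μ g z) = τ g (B z))
    (hA : ∀ z, A (B z) = colAntisymmetrizer W μ z)
    (hK : ∀ k ∈ K, rowSymmetrizer W μ (A k) = 0)
    (h_range : LinearMap.range B ≤ (orbit τ (B (cellVec v μ ρ))).toSubmodule ⊔ K)
    (h_unique : ∀ z ∈ LinearMap.range B, InheritsEigenvalues τ (B (cellVec v μ ρ)) z →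
      ∃ c : ℂ, z = c • B (cellVec v μ ρ)) :
    Nonempty ((orbit τ (B (cellVec v μ ρ))).toRepresentation.Equiv (schurRep W μ)) ∧
      (orbit τ (B (cellVec v μ ρ))).toSubmodule ⊓ K = ⊥ := by
  set u := B (cellVec v μ ρ) with hu
  let H : T →ₗ[ℂ] CellTensor W μ := rowSymmetrizer W μ ∘ₗ A
  have hHB : ∀ z, H (B z) = youngSymmetrizer W μ z := fun z => by
    simp only [H, LinearMap.comp_apply, hA, youngSymmetrizer]
  have h_rep : ∀ g, ∀ z ∈ LinearMap.range B, H (τ g z) = cellRep W μ g (H z) := by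
    rintro g _ ⟨y, rfl⟩
    rw [← hB, hHB, hHB, youngSymmetrizer_cellRep]
  have hu_mem : u ∈ LinearMap.range B := LinearMap.mem_range_self _ _
  have h_orbit : (orbit τ u).toSubmodule ≤ LinearMap.range B := orbit_le _ fun g => by
    rw [hu, ← hB]
    exact LinearMap.mem_range_self _ _
  obtain ⟨c, hc⟩ := h_unique (B (H u)) (LinearMap.mem_range_self _ _) fun g r hg => by
    rw [← hB, ← h_rep g u hu_mem, hg, map_smul, map_smul]
  have hc_ne : c ≠ 0 := by
    rintro rfl
    have h_zero := congrArg A hc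
    rw [hA, zero_smul, map_zero, hu, hHB] at h_zero
    exact colAntisymmetrizer_youngSymmetrizer_cellVec_ne_zero v hρ h_zero
  have h_inj : ∀ z ∈ (orbit τ u).toSubmodule, H z = 0 → z = 0 := fun z hz h => by
    have h_smul := apply_apply_eq_smul_of_mem_orbit hB (fun g => h_rep g u hu_mem) hc hz
    rw [h, map_zero] at h_smul
    exact (smul_eq_zero.1 h_smul.symm).resolve_left hc_ne
  refine ⟨nonempty_equiv_of_map_eq H (fun g z hz => h_rep g z (h_orbit hz)) h_inj ?_,
    eq_bot_iff.2 fun z ⟨hz, hzK⟩ => h_inj z hz (hK z hzK)⟩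
  apply le_antisymm
  · rintro _ ⟨z, hz, rfl⟩
    obtain ⟨y, rfl⟩ := h_orbit hz
    exact ⟨y, (hHB y).symm⟩
  · rintro _ ⟨y, rfl⟩
    obtain ⟨z, hz, k, hk, h_add⟩ := Submodule.mem_sup.1 (h_range (LinearMap.mem_range_self B y))
    exact ⟨z, hz, by rw [← hHB, ← h_add, map_add, show H k = 0 from hK k hk, add_zero]⟩

end Criterion

section ColumnDeterminant

variable {d : ℕ} {μ : YoungDiagram} {W : Type*} [AddCommGroup W] [Module ℂ W]
  (v : Basis (Fin d) ℂ W)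

theorem coef_colAntisymmetrizer_tprod (f : μ.cells → Fin d) (y : μ.cells → W) :
    coef v μ f (colAntisymmetrizer W μ (PiTensorProduct.tprod ℂ y)) =
      (Matrix.of fun c c₂ : μ.cells =>
        if c.1.2 = c₂.1.2 then v.coord (f c) (y c₂) else 0).det := by
  rw [coef_colAntisymmetrizer, Matrix.det_apply']
  symm
  rw [← Finset.sum_subset (Finset.subset_univ (colPerms μ))]
  · refine Finset.sum_congr rfl fun τ hτ => ?_
    rw [coef_tprod]
    congr 1
    refine Finset.prod_congr rfl fun c _ => ?_
    rw [Matrix.of_apply, if_pos (mem_colPerms.1 hτ c)]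
    rfl
  · intro τ _ hτ
    obtain ⟨c, hc⟩ : ∃ c, (τ c).1.2 ≠ c.1.2 := by
      by_contra! h
      exact hτ (mem_colPerms.2 h)
    rw [Finset.prod_eq_zero (Finset.mem_univ c), mul_zero]
    rw [Matrix.of_apply, if_neg hc]

end ColumnDeterminant

/-- A description of the cells of `μ`: its first column has `n ≤ d` cells, and the cells outside
the first column are enumerated by `extra`. -/
structure Columns (d : ℕ) (μ : YoungDiagram) (n k : ℕ) where
  /-- The cells outside the first column. -/
  extra : Fin k → ℕ × ℕ
  extra_injective : Function.Injective extra
  col_ne_zero (l : Fin k) : (extra l).2 ≠ 0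
  mem_iff (c : ℕ × ℕ) : c ∈ μ ↔ (c.1 < n ∧ c.2 = 0) ∨ ∃ l, extra l = c
  row_lt (l : Fin k) : (extra l).1 < n
  length_le : n ≤ d

namespace Columns

variable {d : ℕ} {μ : YoungDiagram} {n k : ℕ} (s : Columns d μ n k)

/-- The cell of `μ` with a given label. -/
def cell : Fin n ⊕ Fin k → μ.cells
  | .inl i => ⟨(i, 0), (YoungDiagram.mem_cells _).2 ((s.mem_iff _).2 (Or.inl ⟨i.2, rfl⟩))⟩
  | .inr l => ⟨s.extra l, (YoungDiagram.mem_cells _).2 ((s.mem_iff _).2 (Or.inr ⟨l, rfl⟩))⟩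

theorem cell_bijective : Function.Bijective s.cell := by
  constructor
  · rintro (i | i) (j | j) h <;> have h_val := congrArg Subtype.val h
    · exact congrArg _ (Fin.ext (congrArg Prod.fst h_val))
    · exact absurd (congrArg Prod.snd h_val).symm (s.col_ne_zero j)
    · exact absurd (congrArg Prod.snd h_val) (s.col_ne_zero i)
    · exact congrArg _ (s.extra_injective h_val)
  · rintro ⟨⟨i, j⟩, h⟩
    rcases (s.mem_iff _).1 ((YoungDiagram.mem_cells _).1 h) with ⟨hi, rfl⟩ | ⟨l, hl⟩
    · exact ⟨.inl ⟨i, hi⟩, rfl⟩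
    · exact ⟨.inr l, Subtype.ext hl⟩

/-- The labelling of the cells of `μ`. -/
def equiv : Fin n ⊕ Fin k ≃ μ.cells := Equiv.ofBijective s.cell s.cell_bijective

theorem equiv_inl (i : Fin n) : (s.equiv (.inl i)).1 = ((i : ℕ), 0) := rfl

theorem equiv_inr (l : Fin k) : (s.equiv (.inr l)).1 = s.extra l := rfl

/-- The row of a cell. -/
def row (c : μ.cells) : Fin d := ⟨c.1.1, by
  refine lt_of_lt_of_le ?_ s.length_le
  rcases (s.mem_iff _).1 ((YoungDiagram.mem_cells _).1 c.2) with ⟨hi, _⟩ | ⟨l, hl⟩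
  · exact hi
  · rw [← hl]; exact s.row_lt l⟩

/-- The row of an extra cell. -/
def extraRow (l : Fin k) : Fin d := ⟨(s.extra l).1, (s.row_lt l).trans_le s.length_le⟩

theorem sum_rowPerms_eq_zero {F : (μ.cells → Fin d) → ℂ} {c c₂ : μ.cells} (hc : c.1.1 = c₂.1.1)
    (hne : c ≠ c₂) (h : ∀ f, F (f ∘ Equiv.swap c c₂) = -F f) (f : μ.cells → Fin d) :
    ∑ σ ∈ rowPerms μ, F (f ∘ σ) = 0 := by
  refine Finset.sum_involution (fun σ _ => σ * Equiv.swap c c₂) ?_ ?_ ?_ ?_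
  · intro σ _
    rw [Equiv.Perm.coe_mul, ← Function.comp_assoc, h, add_neg_cancel]
  · intro σ _ _ h1
    have : Equiv.swap c c₂ = 1 := by simpa using h1
    exact hne (Equiv.swap_eq_one_iff.1 this)
  · intro σ hσ
    rw [mem_rowPerms] at *
    intro x
    rw [Equiv.Perm.mul_apply, hσ]
    rcases eq_or_ne x c with rfl | h1
    · rw [Equiv.swap_apply_left, hc]
    rcases eq_or_ne x c₂ with rfl | h2
    · rw [Equiv.swap_apply_right, hc]
    rw [Equiv.swap_apply_of_ne_of_ne h1 h2]
  · intro σ _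
    rw [mul_assoc, Equiv.swap_mul_self, mul_one]

theorem comp_swap_equiv (f : μ.cells → Fin d) (x y z : Fin n ⊕ Fin k) :
    f (Equiv.swap (s.equiv x) (s.equiv y) (s.equiv z)) =
      if z = x then f (s.equiv y) else if z = y then f (s.equiv x) else f (s.equiv z) := by
  rw [Equiv.swap_apply_def]
  simp only [s.equiv.injective.eq_iff]
  split_ifs <;> rfl

theorem sum_rowPerms_inl_inr {F : (Fin n → Fin d) → (Fin k → Fin d) → ℂ} {i : Fin n} {l : Fin k}
    (hrow : (s.extra l).1 = i)
    (h : ∀ p q, F (Function.update p i (q l)) (Function.update q l (p i)) = -F p q)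
    (f : μ.cells → Fin d) :
    ∑ σ ∈ rowPerms μ, F (fun i => f (σ (s.equiv (.inl i)))) (fun l => f (σ (s.equiv (.inr l)))) =
      0 := by
  refine sum_rowPerms_eq_zero (c := s.equiv (.inl i)) (c₂ := s.equiv (.inr l))
    (F := fun f => F (fun i => f (s.equiv (.inl i))) (fun l => f (s.equiv (.inr l))))
    (by rw [equiv_inl, equiv_inr, hrow]) (by simp) (fun f => ?_) f
  rw [← h]
  congr 1
  · funext m
    rw [Function.comp_apply, s.comp_swap_equiv f, Function.update_apply]
    simp
  · funext m
    rw [Function.comp_apply, s.comp_swap_equiv f, Function.update_apply]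
    simp

theorem sum_rowPerms_inr_inr {F : (Fin n → Fin d) → (Fin k → Fin d) → ℂ} {l l₂ : Fin k}
    (hrow : (s.extra l).1 = (s.extra l₂).1) (hne : l ≠ l₂)
    (h : ∀ p q, F p (q ∘ Equiv.swap l l₂) = -F p q)
    (f : μ.cells → Fin d) :
    ∑ σ ∈ rowPerms μ, F (fun i => f (σ (s.equiv (.inl i)))) (fun l => f (σ (s.equiv (.inr l)))) =
      0 := by
  refine sum_rowPerms_eq_zero (c := s.equiv (.inr l)) (c₂ := s.equiv (.inr l₂))
    (F := fun f => F (fun i => f (s.equiv (.inl i))) (fun l => f (s.equiv (.inr l))))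
    (by rw [equiv_inr, equiv_inr, hrow]) (by simpa using hne) (fun f => ?_) f
  rw [← h]
  congr 1
  · funext m
    rw [Function.comp_apply, s.comp_swap_equiv f]
    simp
  · funext m
    rw [Function.comp_apply, s.comp_swap_equiv f, Function.comp_apply, Equiv.swap_apply_def]
    simp only [Sum.inr.injEq]
    split_ifs <;> rfl

variable {W : Type*} [AddCommGroup W] [Module ℂ W] (v : Basis (Fin d) ℂ W)

/-- The determinant of the values of covectors on vectors labelled by the extra cells, with the
values for cells in different columns replaced by `0`. -/
def extraDet (q : Fin k → Fin d) (z : Fin k → W) : ℂ :=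
  (Matrix.of fun l l₂ : Fin k =>
    if (s.extra l).2 = (s.extra l₂).2 then v.coord (q l) (z l₂) else 0).det

theorem coef_colAntisymmetrizer_blocks (f : μ.cells → Fin d) (y : μ.cells → W) :
    coef v μ f (colAntisymmetrizer W μ (PiTensorProduct.tprod ℂ y)) =
      (Matrix.of fun i j : Fin n =>
        v.coord (f (s.equiv (.inl i))) (y (s.equiv (.inl j)))).det *
      s.extraDet v (fun l => f (s.equiv (.inr l))) (fun l => y (s.equiv (.inr l))) := by
  rw [coef_colAntisymmetrizer_tprod, ← Matrix.det_submatrix_equiv_self s.equiv, extraDet,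
    ← Matrix.det_fromBlocks_zero₂₁ _ 0]
  congr 1
  ext (i | i) (j | j)
  · simp [equiv_inl]
  · simp [equiv_inl, equiv_inr, (s.col_ne_zero j).symm]
  · simp [equiv_inl, equiv_inr, s.col_ne_zero i]
  · simp only [Matrix.submatrix_apply, Matrix.of_apply, Matrix.fromBlocks_apply₂₂, equiv_inr]
    congr

variable {T N : Type*} [AddCommGroup T] [Module ℂ T] [AddCommGroup N] [Module ℂ N]

/-- The linear map on the tensor power given by an alternating map of the first column and a
multilinear map of the extra cells. -/
def assemble (A : W [⋀^Fin n]→ₗ[ℂ] N) (Φ : N →ₗ[ℂ] MultilinearMap ℂ (fun _ : Fin k => W) T) :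
    CellTensor W μ →ₗ[ℂ] T :=
  PiTensorProduct.lift
    ((Φ.compMultilinearMap A.toMultilinearMap).uncurrySum.domDomCongr s.equiv)

variable (A : W [⋀^Fin n]→ₗ[ℂ] N) (Φ : N →ₗ[ℂ] MultilinearMap ℂ (fun _ : Fin k => W) T)

theorem assemble_tprod (y : μ.cells → W) : s.assemble A Φ (PiTensorProduct.tprod ℂ y) =
    Φ (A fun i => y (s.equiv (.inl i))) fun l => y (s.equiv (.inr l)) := by
  rw [assemble, PiTensorProduct.lift.tprod]
  rfl

theorem assemble_cellVec : s.assemble A Φ (cellVec v μ s.row) =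
    Φ (A fun i => v (Fin.castLE s.length_le i)) fun l => v (s.extraRow l) :=
  s.assemble_tprod A Φ _

theorem range_assemble_le {M : Submodule ℂ T} (h : ∀ y z, Φ (A y) z ∈ M) :
    LinearMap.range (s.assemble A Φ) ≤ M := by
  rintro _ ⟨x, rfl⟩
  induction x using PiTensorProduct.induction_on with
  | smul_tprod r y =>
    rw [map_smul, assemble_tprod]
    exact Submodule.smul_mem _ _ (h _ _)
  | add x y hx hy => rw [map_add]; exact Submodule.add_mem _ hx hy

/-- The linear map to the tensor power whose coefficient at `f` is the value of `L` at the labels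
given by `f`. -/
def readOff (L : (Fin n → Fin d) → (Fin k → Fin d) → T →ₗ[ℂ] ℂ) : T →ₗ[ℂ] CellTensor W μ :=
  ∑ f : μ.cells → Fin d,
    (L (fun i => f (s.equiv (.inl i))) (fun l => f (s.equiv (.inr l)))).smulRight (cellVec v μ f)

theorem coef_readOff (L : (Fin n → Fin d) → (Fin k → Fin d) → T →ₗ[ℂ] ℂ) (f : μ.cells → Fin d)
    (z : T) : coef v μ f (s.readOff v L z) =
      L (fun i => f (s.equiv (.inl i))) (fun l => f (s.equiv (.inr l))) z := by
  simp [readOff, coef_cellVec]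

/-- The symmetrization over the rows of the linear forms `L`, at the labels given by `f`. -/
def rowSum (L : (Fin n → Fin d) → (Fin k → Fin d) → T →ₗ[ℂ] ℂ) (f : μ.cells → Fin d) :
    T →ₗ[ℂ] ℂ :=
  ∑ σ ∈ rowPerms μ, L (fun i => f (σ (s.equiv (.inl i)))) (fun l => f (σ (s.equiv (.inr l))))

theorem rowSum_apply (L : (Fin n → Fin d) → (Fin k → Fin d) → T →ₗ[ℂ] ℂ) (f : μ.cells → Fin d)
    (z : T) : s.rowSum L f z = ∑ σ ∈ rowPerms μ,
      L (fun i => f (σ (s.equiv (.inl i)))) (fun l => f (σ (s.equiv (.inr l)))) z :=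
  LinearMap.sum_apply ..

variable {v A Φ} {L : (Fin n → Fin d) → (Fin k → Fin d) → T →ₗ[ℂ] ℂ}

theorem readOff_assemble
    (hL : ∀ p q y z, L p q (Φ (A y) z) =
      (Matrix.of fun i j => v.coord (p i) (y j)).det * s.extraDet v q z) :
    s.readOff v L ∘ₗ s.assemble A Φ = colAntisymmetrizer W μ := by
  refine PiTensorProduct.ext (MultilinearMap.ext fun y => ?_)
  simp only [LinearMap.compMultilinearMap_apply, LinearMap.comp_apply]
  rw [← sub_eq_zero]
  refine eq_zero_of_coef (v := v) fun f => ?_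
  rw [map_sub, coef_readOff, assemble_tprod, hL, s.coef_colAntisymmetrizer_blocks, sub_self]

theorem assemble_cellRep {τ : Representation ℂ (GLW W) T}
    (hτ : ∀ g y z, τ g (Φ (A y) z) = Φ (A fun i => stdRep W g (y i)) fun l => stdRep W g (z l))
    (g : GLW W) : s.assemble A Φ ∘ₗ cellRep W μ g = τ g ∘ₗ s.assemble A Φ := by
  refine PiTensorProduct.ext (MultilinearMap.ext fun y => ?_)
  simp only [LinearMap.compMultilinearMap_apply, LinearMap.comp_apply]
  rw [show cellRep W μ g (PiTensorProduct.tprod ℂ y) =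
    PiTensorProduct.tprod ℂ fun c => stdRep W g (y c) from PiTensorProduct.map_tprod _ _,
    assemble_tprod, assemble_tprod, hτ]

theorem orbit_equiv_schur {τ : Representation ℂ (GLW W) T} {M K : Submodule ℂ T}
    (hτ : ∀ g y z, τ g (Φ (A y) z) = Φ (A fun i => stdRep W g (y i)) fun l => stdRep W g (z l))
    (hL : ∀ p q y z, L p q (Φ (A y) z) =
      (Matrix.of fun i j => v.coord (p i) (y j)).det * s.extraDet v q z)
    (hK : ∀ f, K ≤ LinearMap.ker (s.rowSum L f))
    {u : T} (hu : u = Φ (A fun i => v (Fin.castLE s.length_le i)) fun l => v (s.extraRow l))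
    (hM : ∀ y z, Φ (A y) z ∈ M) (hMK : M ≤ (orbit τ u).toSubmodule ⊔ K)
    (h_unique : ∀ z ∈ M, InheritsEigenvalues τ u z → ∃ c : ℂ, z = c • u) :
    Nonempty ((orbit τ u).toRepresentation.Equiv (schurRep W μ)) ∧
      (orbit τ u).toSubmodule ⊓ K = ⊥ := by
  rw [← s.assemble_cellVec v A Φ] at hu
  subst hu
  refine HilbertSymmetric.orbit_equiv_schur (A := s.readOff v L) (fun _ => rfl)
    (fun g => LinearMap.congr_fun (s.assemble_cellRep hτ g))
    (LinearMap.congr_fun (s.readOff_assemble hL))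
    (fun x hx => eq_zero_of_coef (v := v) fun f => ?_)
    ((s.range_assemble_le A Φ hM).trans hMK)
    (fun z hz => h_unique z (s.range_assemble_le A Φ hM hz))
  rw [coef_rowSymmetrizer]
  simp only [coef_readOff]
  exact (s.rowSum_apply L f x).symm.trans (hK f hx)

end Columns

/-- The cells of `(3, 2, 1, …, 1, 0)`. -/
def columns321 {d : ℕ} (hd : 3 ≤ d) : Columns d (shape321 d) (d - 1) 3 where
  extra := ![(0, 2), (0, 1), (1, 1)]
  extra_injective := by decide
  col_ne_zero := by decide
  mem_iff := by
    rintro ⟨i, j⟩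
    rw [shape321, YoungDiagram.mem_ofRowLens]
    rcases i with _ | _ | i
    · simp [Fin.exists_fin_succ]; omega
    · simp [Fin.exists_fin_succ]; omega
    · simp [Fin.exists_fin_succ, List.getElem_append, List.getElem_cons]; grind
  row_lt l := by fin_cases l <;> simp <;> omega
  length_le := by omega

/-- The cells of `(3, 1, …, 1)`. -/
def columns311 {d : ℕ} (hd : 3 ≤ d) : Columns d (shape311 d) d 2 where
  extra := ![(0, 1), (0, 2)]
  extra_injective := by decide
  col_ne_zero := by decide
  mem_iff := by
    rintro ⟨i, j⟩
    rw [shape311, YoungDiagram.mem_ofRowLens]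
    rcases i with _ | i
    · simp [Fin.exists_fin_succ]; omega
    · simp [Fin.exists_fin_succ]; grind
  row_lt l := by fin_cases l <;> simp <;> omega
  length_le := le_rfl

/-- The cells of `(2, 2, 1, …, 1)`. -/
def columns221 {d : ℕ} (hd : 3 ≤ d) : Columns d (shape221 d) d 2 where
  extra := ![(0, 1), (1, 1)]
  extra_injective := by decide
  col_ne_zero := by decide
  mem_iff := by
    rintro ⟨i, j⟩
    rw [shape221, YoungDiagram.mem_ofRowLens]
    rcases i with _ | _ | i
    · simp [Fin.exists_fin_succ]; omega
    · simp [Fin.exists_fin_succ]; omega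
    · simp [Fin.exists_fin_succ]; grind
  row_lt l := by fin_cases l <;> simp <;> omega
  length_le := le_rfl

/-- The cells of `(2, 2, 2, 1, …, 1, 0)`. -/
def columns222 {d : ℕ} (hd : 4 ≤ d) : Columns d (shape222 d) (d - 1) 3 where
  extra := ![(0, 1), (1, 1), (2, 1)]
  extra_injective := by decide
  col_ne_zero := by decide
  mem_iff := by
    rintro ⟨i, j⟩
    rw [shape222, YoungDiagram.mem_ofRowLens]
    rcases i with _ | _ | _ | i
    · simp [Fin.exists_fin_succ]; omega
    · simp [Fin.exists_fin_succ]; omega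
    · simp [Fin.exists_fin_succ]; omega
    · simp [Fin.exists_fin_succ, List.getElem_append, List.getElem_cons]; grind
  row_lt l := by fin_cases l <;> simp <;> omega
  length_le := by omega

section ExtraDet

variable {d : ℕ} {W : Type*} [AddCommGroup W] [Module ℂ W] (v : Basis (Fin d) ℂ W)

theorem extraDet_columns321 (hd : 3 ≤ d) (q : Fin 3 → Fin d) (z : Fin 3 → W) :
    (columns321 hd).extraDet v q z = v.coord (q 0) (z 0) *
      (v.coord (q 1) (z 1) * v.coord (q 2) (z 2) - v.coord (q 1) (z 2) * v.coord (q 2) (z 1)) := by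
  rw [Columns.extraDet, Matrix.det_fin_three]
  simp [columns321]
  ring

theorem extraDet_columns311 (hd : 3 ≤ d) (q : Fin 2 → Fin d) (z : Fin 2 → W) :
    (columns311 hd).extraDet v q z = v.coord (q 0) (z 0) * v.coord (q 1) (z 1) := by
  rw [Columns.extraDet, Matrix.det_fin_two]
  simp [columns311]

theorem extraDet_columns221 (hd : 3 ≤ d) (q : Fin 2 → Fin d) (z : Fin 2 → W) :
    (columns221 hd).extraDet v q z =
      v.coord (q 0) (z 0) * v.coord (q 1) (z 1) - v.coord (q 0) (z 1) * v.coord (q 1) (z 0) := by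
  rw [Columns.extraDet, Matrix.det_fin_two]
  simp [columns221]

theorem extraDet_columns222 (hd : 4 ≤ d) (q : Fin 3 → Fin d) (z : Fin 3 → W) :
    (columns222 hd).extraDet v q z = (Matrix.of fun l l₂ => v.coord (q l) (z l₂)).det := by
  rw [Columns.extraDet]
  congr 2
  ext l l₂
  fin_cases l <;> fin_cases l₂ <;> rfl

end ExtraDet

section FirstColumn

variable {d : ℕ} {W : Type*} [AddCommGroup W] [Module ℂ W] (v : Basis (Fin d) ℂ W)

theorem det_coord_eq_mul (p : Fin d → Fin d) (y : Fin d → W) :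
    (Matrix.of fun i j => v.coord (p i) (y j)).det =
      (Matrix.of fun i j => v.coord (p i) (v j)).det * v.det y := by
  rw [Basis.det_apply, ← Matrix.det_mul]
  congr 1
  ext i j
  simp only [Matrix.mul_apply, Matrix.of_apply, Basis.toMatrix_apply, ← v.coord_apply]
  rw [← sum_coord_mul v (y j)]
  exact Finset.sum_congr rfl fun k _ => mul_comm _ _

variable [NeZero d]

/-- The covector determined by `d - 1` vectors, with the sign that makes `v_1, …, v_{d-1}`
correspond to the last coordinate form. -/
def firstColumn : W [⋀^Fin (d - 1)]→ₗ[ℂ] Dual ℂ W :=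
  ((-1 : ℂ) ^ d • (dualWedge v).symm.toLinearMap).compAlternatingMap
    (exteriorPower.ιMulti ℂ (d - 1))

theorem firstColumn_apply (y : Fin (d - 1) → W) :
    firstColumn v y = (-1 : ℂ) ^ d • (dualWedge v).symm (exteriorPower.ιMulti ℂ (d - 1) y) := rfl

theorem dualWedge_symm_extRep (g : GLW W) (η : ⋀[ℂ]^(d - 1) W) :
    (dualWedge v).symm (extRep W (d - 1) g η) =
      LinearMap.det (stdRep W g) • ((dualWedge v).symm η ∘ₗ stdRep W g⁻¹) := by
  rw [LinearEquiv.symm_apply_eq, map_smul, ← extRep_dualWedge, LinearEquiv.apply_symm_apply]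

theorem firstColumn_rep (g : GLW W) (y : Fin (d - 1) → W) :
    firstColumn v (fun i => stdRep W g (y i)) =
      LinearMap.det (stdRep W g) • (firstColumn v y ∘ₗ stdRep W g⁻¹) := by
  have h_wedge : exteriorPower.ιMulti ℂ (d - 1) (fun i => stdRep W g (y i)) =
      extRep W (d - 1) g (exteriorPower.ιMulti ℂ (d - 1) y) :=
    (exteriorPower.map_apply_ιMulti _ _).symm
  rw [firstColumn_apply, firstColumn_apply, h_wedge, dualWedge_symm_extRep, LinearMap.smul_comp,
    smul_comm]

theorem firstColumn_basis {a : Fin d} (ha : (a : ℕ) + 1 = d) :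
    firstColumn v (fun i => v (Fin.castLE (Nat.sub_le d 1) i)) = v.coord a := by
  have h_omit : exteriorPower.ιMulti ℂ (d - 1) (fun i => v (Fin.castLE (Nat.sub_le d 1) i)) =
      wedgeOmit v a := by
    rw [wedgeOmit]
    congr 2
    funext i
    exact congrArg v (Fin.ext (if_pos (by omega)).symm)
  rw [firstColumn_apply, h_omit, ← map_smul, LinearEquiv.symm_apply_eq, dualWedge_coord, ha]

/-- The vector on which `firstColumn v y` takes the value of the minor of `y` with rows `p`. -/
def evalVec (p : Fin (d - 1) → Fin d) : W :=
  (-1 : ℂ) ^ d • ∑ a, wedgeForm (fun i => v.coord (p i)) (dualWedge v (v.coord a)) • v a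

theorem apply_evalVec (p : Fin (d - 1) → Fin d) (α : Dual ℂ W) :
    α (evalVec v p) = (-1 : ℂ) ^ d * wedgeForm (fun i => v.coord (p i)) (dualWedge v α) := by
  conv_rhs => rw [← v.sum_dual_apply_smul_coord α]
  simp only [evalVec, map_sum, map_smul, smul_eq_mul, mul_comm (α _)]

theorem firstColumn_evalVec (p : Fin (d - 1) → Fin d) (y : Fin (d - 1) → W) :
    firstColumn v y (evalVec v p) = (Matrix.of fun i j => v.coord (p i) (y j)).det := by
  rw [apply_evalVec, firstColumn_apply, map_smul, LinearEquiv.apply_symm_apply, map_smul,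
    wedgeForm_ιMulti, smul_eq_mul, ← mul_assoc, ← mul_pow, neg_one_mul, neg_neg, one_pow, one_mul]

theorem coord_evalVec_update (p : Fin (d - 1) → Fin d) (i : Fin (d - 1)) (b : Fin d) :
    v.coord (p i) (evalVec v (Function.update p i b)) = -v.coord b (evalVec v p) := by
  have h_update : (fun j => v.coord (Function.update p i b j)) =
      Function.update (fun j => v.coord (p j)) i (v.coord b) :=
    Function.comp_update (fun a => v.coord a) p i b
  rw [apply_evalVec, apply_evalVec, h_update, wedgeForm_update_dualWedge v _ fun j => v.coord (p j),
    mul_neg]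

/-- The exchange of the extra cell `l` with the cell of the first column in the same row changes
the sign of every summand. -/
theorem Columns.sum_rowPerms_coord_evalVec_mul {μ : YoungDiagram} {k : ℕ}
    (s : Columns d μ (d - 1) k) {G : (Fin k → Fin d) → ℂ} (l : Fin k)
    (hG : ∀ q b, G (Function.update q l b) = G q) (f : μ.cells → Fin d) :
    ∑ σ ∈ rowPerms μ, v.coord (f (σ (s.equiv (.inr l))))
      (evalVec v fun i => f (σ (s.equiv (.inl i)))) * G (fun l => f (σ (s.equiv (.inr l)))) = 0 :=
  s.sum_rowPerms_inl_inr (i := ⟨(s.extra l).1, s.row_lt l⟩) (l := l)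
    (F := fun p q => v.coord (q l) (evalVec v p) * G q) rfl
    (fun p q => by rw [Function.update_self, coord_evalVec_update, hG, neg_mul]) f

end FirstColumn

namespace TensModel

variable {d : ℕ} {W T : Type*} [AddCommGroup W] [Module ℂ W] [AddCommGroup T] [Module ℂ T]
  (m : TensModel W T) (v : Basis (Fin d) ℂ W)

section FirstColumn

variable [NeZero d]

/-- The linear form on `T` labelled by the cells of a shape with `d - 1` cells in the first column
and three cells outside it. -/
def cellForm (p : Fin (d - 1) → Fin d) (q : Fin 3 → Fin d) : T →ₗ[ℂ] ℂ :=
  m.form (evalVec v p) (v.coord (q 0)) (v.coord (q 1)) (v.coord (q 2))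

theorem cellForm_cyc (p : Fin (d - 1) → Fin d) (q : Fin 3 → Fin d) (α : Dual ℂ W) (w x y : W) :
    m.cellForm v p q (m.cyc α w x y) =
      α (evalVec v p) * (Matrix.of fun l l₂ => v.coord (q l) (![w, x, y] l₂)).det := by
  rw [cyc_apply, map_add, map_add, cellForm, m.form_t, m.form_t, m.form_t, Matrix.det_fin_three]
  simp
  ring

theorem rep_t_firstColumn (g : GLW W) (y : Fin (d - 1) → W) (w x z : W) :
    m.rep g (m.t (firstColumn v y) w x z) = m.t (firstColumn v fun i => stdRep W g (y i))
      (stdRep W g w) (stdRep W g x) (stdRep W g z) := by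
  rw [m.rep_t, firstColumn_rep v, map_smul]
  rfl

theorem rep_cyc_firstColumn (g : GLW W) (y : Fin (d - 1) → W) (w x z : W) :
    m.rep g (m.cyc (firstColumn v y) w x z) = m.cyc (firstColumn v fun i => stdRep W g (y i))
      (stdRep W g w) (stdRep W g x) (stdRep W g z) := by
  rw [m.rep_cyc, firstColumn_rep v, map_smul]
  rfl

theorem polarSub_le_ker_rowSum_columns321 (hd : 3 ≤ d) (f : (shape321 d).cells → Fin d) :
    m.polarSub v ≤ LinearMap.ker ((columns321 hd).rowSum (m.cellForm v) f) := by
  rw [polarSub, Submodule.span_le]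
  rintro _ ⟨w, rfl⟩
  have h_last := (columns321 hd).sum_rowPerms_coord_evalVec_mul v 2
    (G := fun q => v.coord (q 0) w * v.coord (q 1) w) (by simp) f
  have h_middle := (columns321 hd).sum_rowPerms_coord_evalVec_mul v 1
    (G := fun q => v.coord (q 0) w * v.coord (q 2) w) (by simp) f
  rw [SetLike.mem_coe, LinearMap.mem_ker, Columns.rowSum_apply, ← sub_self (0 : ℂ)]
  nth_rewrite 1 [← h_last]
  rw [← h_middle, ← Finset.sum_sub_distrib]
  refine Finset.sum_congr rfl fun σ _ => ?_
  rw [cellForm, form_polar]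
  ring

theorem traceSub_le_ker_rowSum_columns321 (hd : 3 ≤ d) (f : (shape321 d).cells → Fin d) :
    m.traceSub v ≤ LinearMap.ker ((columns321 hd).rowSum (m.cellForm v) f) := by
  rw [traceSub, Submodule.span_le]
  rintro _ ⟨x, y, rfl⟩
  simp only [SetLike.mem_coe, LinearMap.mem_ker, Columns.rowSum_apply, cellForm, form_trace]
  exact (columns321 hd).sum_rowPerms_coord_evalVec_mul v 0
    (G := fun q => v.coord (q 1) x * v.coord (q 2) y - v.coord (q 1) y * v.coord (q 2) x)
    (by simp) f

theorem cycSub_le_ker_rowSum_columns321 (hd : 3 ≤ d) (f : (shape321 d).cells → Fin d) :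
    m.cycSub ≤ LinearMap.ker ((columns321 hd).rowSum (m.cellForm v) f) := by
  rw [cycSub, Submodule.span_le]
  rintro _ ⟨α, w, x, y, rfl⟩
  simp only [SetLike.mem_coe, LinearMap.mem_ker, Columns.rowSum_apply, cellForm_cyc]
  refine (columns321 hd).sum_rowPerms_inr_inr (l := 0) (l₂ := 1) (F := fun p q =>
    α (evalVec v p) * (Matrix.of fun l l₂ => v.coord (q l) (![w, x, y] l₂)).det)
    rfl (by decide) (fun p q => ?_) f
  have h_swap := Matrix.det_permute (Equiv.swap (0 : Fin 3) 1)
    (Matrix.of fun l l₂ => v.coord (q l) (![w, x, y] l₂))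
  rw [Equiv.Perm.sign_swap (by decide), Units.val_neg, Units.val_one, Int.cast_neg, Int.cast_one,
    neg_one_mul] at h_swap
  rw [← mul_neg, ← h_swap]
  rfl

theorem cycTraceSub_le_ker_rowSum_columns222 (hd : 4 ≤ d) (f : (shape222 d).cells → Fin d) :
    m.cycTraceSub v ≤ LinearMap.ker ((columns222 hd).rowSum (m.cellForm v) f) := by
  rw [cycTraceSub, Submodule.span_le]
  rintro _ ⟨x, y, rfl⟩
  simp only [SetLike.mem_coe, LinearMap.mem_ker, Columns.rowSum_apply, cellForm, form_cycTrace,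
    Finset.sum_add_distrib]
  rw [(columns222 hd).sum_rowPerms_coord_evalVec_mul v 0 (G := fun q =>
      v.coord (q 1) x * v.coord (q 2) y - v.coord (q 1) y * v.coord (q 2) x) (by simp) f,
    (columns222 hd).sum_rowPerms_coord_evalVec_mul v 1 (G := fun q =>
      v.coord (q 2) x * v.coord (q 0) y - v.coord (q 2) y * v.coord (q 0) x) (by simp) f,
    (columns222 hd).sum_rowPerms_coord_evalVec_mul v 2 (G := fun q =>
      v.coord (q 0) x * v.coord (q 1) y - v.coord (q 0) y * v.coord (q 1) x) (by simp) f,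
    add_zero, add_zero]

end FirstColumn

theorem orbit_t_equiv_schur_and_primitive_inf_eq_bot (hd : 3 ≤ d) :
    Nonempty ((orbit m.rep (m.t (v.coord ⟨d - 1, by omega⟩) (v ⟨0, by omega⟩) (v ⟨0, by omega⟩)
      (v ⟨1, by omega⟩))).toRepresentation.Equiv (schurRep W (shape321 d))) ∧
      m.primitive ⊓ (m.polarSub v ⊔ (m.traceSub v ⊔ m.cycSub)) = ⊥ := by
  have : NeZero d := ⟨by omega⟩
  have h_primitive := m.primitive_eq_orbit v (a := ⟨d - 1, by omega⟩) (j := ⟨0, by omega⟩)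
    (k := ⟨1, by omega⟩) (by grind) (by grind) (by simp)
  rw [h_primitive]
  refine (columns321 hd).orbit_equiv_schur (v := v) (A := firstColumn v)
    (Φ := uncurryTrilinear ∘ₗ m.t) (L := m.cellForm v) (M := ⊤) ?_ ?_ ?_ ?_ ?_ ?_ ?_
  · exact fun g y z => m.rep_t_firstColumn v g y _ _ _
  · intro p q y z
    rw [extraDet_columns321, ← firstColumn_evalVec, mul_comm (v.coord (q 1) (z 2))]
    refine (m.form_t ..).trans ?_
    ring
  · exact fun f => sup_le (m.polarSub_le_ker_rowSum_columns321 v hd f)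
      (sup_le (m.traceSub_le_ker_rowSum_columns321 v hd f)
        (m.cycSub_le_ker_rowSum_columns321 v hd f))
  · rw [firstColumn_basis v (a := ⟨d - 1, by omega⟩) (by grind)]
    rfl
  · exact fun _ _ => Submodule.mem_top
  · rw [← h_primitive, m.sup_eq_top v (by omega)]
  · exact fun z _ hz => ⟨_, m.eq_smul_t_of_inheritsEigenvalues v (by grind) (by grind)
      (by simp) hz⟩

theorem orbit_cyc_equiv_schur (hd : 4 ≤ d) :
    Nonempty ((orbit m.rep (m.cyc (v.coord ⟨d - 1, by omega⟩) (v ⟨0, by omega⟩) (v ⟨1, by omega⟩)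
      (v ⟨2, by omega⟩))).toRepresentation.Equiv (schurRep W (shape222 d))) := by
  have : NeZero d := ⟨by omega⟩
  have h_cycPrimitive := m.cycPrimitive_eq_orbit v (a := ⟨d - 1, by omega⟩) (j := ⟨0, by omega⟩)
    (i := ⟨1, by omega⟩) (k := ⟨2, by omega⟩) (by grind) (by grind) (by grind)
    (by simp) (by simp) (by simp)
  refine ((columns222 hd).orbit_equiv_schur (v := v) (A := firstColumn v)
    (Φ := uncurryTrilinear ∘ₗ m.cyc) (L := m.cellForm v) (M := m.cycSub) (K := m.cycTraceSub v)
    ?_ ?_ ?_ ?_ ?_ ?_ ?_).1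
  · exact fun g y z => m.rep_cyc_firstColumn v g y _ _ _
  · intro p q y z
    rw [extraDet_columns222, ← firstColumn_evalVec]
    refine (m.cellForm_cyc ..).trans ?_
    congr 3
    ext l l₂
    fin_cases l₂ <;> rfl
  · exact m.cycTraceSub_le_ker_rowSum_columns222 v hd
  · rw [firstColumn_basis v (a := ⟨d - 1, by omega⟩) (by grind)]
    rfl
  · exact fun y z => Submodule.subset_span ⟨_, _, _, _, rfl⟩
  · rw [← h_cycPrimitive]
    exact m.cycSub_le v (by omega)
  · exact fun z _ hz => ⟨_, m.eq_smul_cyc_of_inheritsEigenvalues v (by grind)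
      (by grind) (by grind) (by simp) (by simp) (by simp) hz⟩

end TensModel

section Bilinear

variable {d : ℕ} {W T : Type*} [AddCommGroup W] [Module ℂ W] [AddCommGroup T] [Module ℂ T]
  (v : Basis (Fin d) ℂ W)

/-- The linear forms on `T` labelled by the cells of a shape with `d` cells in the first column and
two cells outside it. -/
def fullColumnForm (Θ : Fin d → Fin d → T →ₗ[ℂ] ℂ) (p : Fin d → Fin d) (q : Fin 2 → Fin d) :
    T →ₗ[ℂ] ℂ :=
  (Matrix.of fun i j => v.coord (p i) (v j)).det • Θ (q 0) (q 1)

theorem orbit_bilinear_equiv_schur {μ : YoungDiagram} (s : Columns d μ d 2)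
    {τ : Representation ℂ (GLW W) T} {f : W →ₗ[ℂ] W →ₗ[ℂ] T}
    (h_rep : ∀ g x y, τ g (f x y) =
      LinearMap.det (stdRep W g) • f (stdRep W g x) (stdRep W g y))
    {Θ : Fin d → Fin d → T →ₗ[ℂ] ℂ}
    (hΘ : ∀ q z, Θ (q 0) (q 1) (f (z 0) (z 1)) = s.extraDet v q z) {K : Submodule ℂ T}
    (hK : ∀ φ, K ≤ LinearMap.ker (s.rowSum (fullColumnForm v Θ) φ)) {i k : Fin d}
    (hi : s.extraRow 0 = i) (hk : s.extraRow 1 = k)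
    (h_span : Submodule.span ℂ {z | ∃ x y, z = f x y} ≤
      (orbit τ (f (v i) (v k))).toSubmodule ⊔ K)
    (h_unique : ∀ z ∈ Submodule.span ℂ {z | ∃ x y, z = f x y},
      InheritsEigenvalues τ (f (v i) (v k)) z → ∃ c : ℂ, z = c • f (v i) (v k)) :
    Nonempty ((orbit τ (f (v i) (v k))).toRepresentation.Equiv (schurRep W μ)) := by
  refine (s.orbit_equiv_schur (v := v) (A := v.det)
    (Φ := LinearMap.toSpanSingleton ℂ _ (uncurryBilinear f)) (L := fullColumnForm v Θ)
    ?_ ?_ hK ?_ ?_ h_span h_unique).1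
  · intro g y z
    change τ g (v.det y • f (z 0) (z 1)) =
      v.det (fun i => stdRep W g (y i)) • f (stdRep W g (z 0)) (stdRep W g (z 1))
    rw [map_smul, h_rep, smul_smul, mul_comm]
    exact congrArg (· • _) (v.det_comp (stdRep W g) y).symm
  · intro p q y z
    change (Matrix.of fun i j => v.coord (p i) (v j)).det *
      Θ (q 0) (q 1) (v.det y • f (z 0) (z 1)) = _
    rw [map_smul, hΘ, det_coord_eq_mul v p y, smul_eq_mul, mul_assoc]
  · rw [← hi, ← hk]
    exact ((congrArg (· • _) v.det_self).trans (one_smul ℂ _)).symm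
  · exact fun y z => Submodule.smul_mem _ _ (Submodule.subset_span ⟨_, _, rfl⟩)

end Bilinear

namespace TensModel

variable {d : ℕ} {W T : Type*} [AddCommGroup W] [Module ℂ W] [AddCommGroup T] [Module ℂ T]
  (m : TensModel W T) (v : Basis (Fin d) ℂ W)

/-- The linear form on `T` that contracts the covector with the last vector. -/
def polarForm (j i : Fin d) : T →ₗ[ℂ] ℂ := ∑ a, m.form (v a) (v.coord j) (v.coord i) (v.coord a)

theorem polarForm_polar (j i : Fin d) (w x : W) :
    m.polarForm v j i (m.polar v w x) = ((d : ℂ) - 1) * (v.coord j w * v.coord i x) := by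
  simp only [polarForm, LinearMap.sum_apply, form_polar, coord_basis, if_true, mul_sub, mul_one,
    ← Finset.mul_sum, Finset.sum_sub_distrib, ite_mul, one_mul, zero_mul, Finset.sum_ite_eq,
    Finset.mem_univ, Finset.sum_const, Finset.card_univ, Fintype.card_fin, nsmul_eq_mul]
  ring

/-- The linear form on `T` that contracts the covector with the first vector. -/
def traceForm (i k : Fin d) : T →ₗ[ℂ] ℂ := ∑ a, m.form (v a) (v.coord a) (v.coord i) (v.coord k)

theorem traceForm_trace (i k : Fin d) (x y : W) :
    m.traceForm v i k (m.trace v x y) =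
      d * (v.coord i x * v.coord k y - v.coord i y * v.coord k x) := by
  simp [traceForm, form_trace, coord_basis, -Basis.coord_apply, mul_sub]

theorem traceForm_cycTrace (i k : Fin d) (x y : W) :
    m.traceForm v i k (m.cycTrace v x y) =
      (d - 2) * (v.coord i x * v.coord k y - v.coord i y * v.coord k x) := by
  simp only [traceForm, LinearMap.sum_apply, form_cycTrace, coord_basis, if_true, one_mul,
    Finset.sum_add_distrib, ite_mul, zero_mul, Finset.sum_ite_eq, Finset.mem_univ,
    Finset.sum_const, Finset.card_univ, Fintype.card_fin, nsmul_eq_mul]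
  ring

theorem polar_sub_swap_le_ker_rowSum_columns311 (hd : 3 ≤ d) (c : ℂ)
    (φ : (shape311 d).cells → Fin d) :
    Submodule.span ℂ {z | ∃ x y, z = m.polar v x y - m.polar v y x} ≤
      LinearMap.ker ((columns311 hd).rowSum (fullColumnForm v (c • m.polarForm v)) φ) := by
  rw [Submodule.span_le]
  rintro _ ⟨x, y, rfl⟩
  rw [SetLike.mem_coe, LinearMap.mem_ker, Columns.rowSum_apply]
  refine (columns311 hd).sum_rowPerms_inr_inr (l := 0) (l₂ := 1)
    (F := fun p q => fullColumnForm v (c • m.polarForm v) p q (m.polar v x y - m.polar v y x))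
    rfl (by decide) (fun p q => ?_) φ
  simp only [fullColumnForm, LinearMap.smul_apply, Pi.smul_apply, map_sub, polarForm_polar,
    smul_eq_mul, Function.comp_apply, Equiv.swap_apply_left, Equiv.swap_apply_right]
  ring

theorem span_polar_le :
    Submodule.span ℂ {z | ∃ x y, z = m.polar v x y} ≤
      m.polarSub v ⊔ Submodule.span ℂ {z | ∃ x y, z = m.polar v x y - m.polar v y x} := by
  rw [Submodule.span_le]
  rintro _ ⟨x, y, rfl⟩
  have h_polarization : m.polar v x y = (2 : ℂ)⁻¹ • (m.polar v (x + y) (x + y) - m.polar v x x -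
      m.polar v y y) + (2 : ℂ)⁻¹ • (m.polar v x y - m.polar v y x) := by
    simp only [map_add, LinearMap.add_apply]
    module
  have h_mem : ∀ w, m.polar v w w ∈ m.polarSub v := fun w => Submodule.subset_span ⟨w, rfl⟩
  rw [h_polarization]
  exact Submodule.add_mem_sup
    (Submodule.smul_mem _ _ (sub_mem (sub_mem (h_mem _) (h_mem _)) (h_mem _)))
    (Submodule.smul_mem _ _ (Submodule.subset_span ⟨_, _, rfl⟩))

theorem orbit_polar_equiv_schur (hd : 3 ≤ d) :
    Nonempty ((orbit m.rep (m.polar v (v ⟨0, by omega⟩)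
      (v ⟨0, by omega⟩))).toRepresentation.Equiv (schurRep W (shape311 d))) := by
  have h_ne : (d : ℂ) - 1 ≠ 0 := by
    rw [sub_ne_zero]
    exact_mod_cast (by omega : d ≠ 1)
  refine orbit_bilinear_equiv_schur v (columns311 hd) (m.rep_polar v)
    (Θ := ((d : ℂ) - 1)⁻¹ • m.polarForm v) (fun q z => ?_)
    (m.polar_sub_swap_le_ker_rowSum_columns311 v hd _) rfl rfl ?_
    fun z _ hz => ⟨_, m.eq_smul_polar_of_inheritsEigenvalues v (b := ⟨1, by omega⟩) (by simp) hz⟩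
  · rw [extraDet_columns311, Pi.smul_apply, Pi.smul_apply, LinearMap.smul_apply, polarForm_polar,
      smul_eq_mul, inv_mul_cancel_left₀ h_ne]
  · rw [← m.polarSub_eq_orbit v]
    exact m.span_polar_le v

theorem orbit_alternating_equiv_schur (hd : 3 ≤ d) {f : W →ₗ[ℂ] W →ₗ[ℂ] T}
    (hf : ∀ w, f w w = 0)
    (h_rep : ∀ g x y, m.rep g (f x y) =
      LinearMap.det (stdRep W g) • f (stdRep W g x) (stdRep W g y))
    {Θ : Fin d → Fin d → T →ₗ[ℂ] ℂ}
    (hΘ : ∀ i k x y, Θ i k (f x y) = v.coord i x * v.coord k y - v.coord i y * v.coord k x)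
    (h_unique : ∀ z ∈ Submodule.span ℂ {z | ∃ x y, z = f x y},
      InheritsEigenvalues m.rep (f (v ⟨0, by omega⟩) (v ⟨1, by omega⟩)) z →
        ∃ c : ℂ, z = c • f (v ⟨0, by omega⟩) (v ⟨1, by omega⟩)) :
    Nonempty ((orbit m.rep (f (v ⟨0, by omega⟩) (v ⟨1, by omega⟩))).toRepresentation.Equiv
      (schurRep W (shape221 d))) := by
  refine orbit_bilinear_equiv_schur v (columns221 hd) h_rep (Θ := Θ) (i := ⟨0, by omega⟩)
    (k := ⟨1, by omega⟩) (fun q z => ?_) (K := ⊥) (fun _ => bot_le) rfl rfl ?_ h_unique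
  · rw [hΘ, extraDet_columns221]
  · rw [m.span_alternating_eq_orbit v hf h_rep (i := ⟨0, by omega⟩)
      (k := ⟨1, by omega⟩) (by simp), sup_bot_eq]

theorem exists_eq_smul_trace {p r s : Fin d} (hpr : p ≠ r) (hps : p ≠ s) (hrs : r ≠ s) {z : T}
    (h_mem : z ∈ m.traceSub v) (hz : InheritsEigenvalues m.rep (m.trace v (v p) (v r)) z) :
    ∃ c : ℂ, z = c • m.trace v (v p) (v r) := by
  have h_le : m.traceSub v ≤ LinearMap.ker (m.coord v s p r s) := by
    rw [traceSub, Submodule.span_le]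
    rintro _ ⟨x, y, rfl⟩
    simp [coord, form_trace, coord_basis, hps, -Basis.coord_apply]
  have h_eq := (transformsAsPair_of_inheritsEigenvalues (m.trace_swap v) (m.rep_trace v)
    hz).eq_smul_trace_add_smul_cycTrace hpr hps hrs
  rw [LinearMap.mem_ker.1 (h_le h_mem), zero_smul, add_zero] at h_eq
  exact ⟨_, h_eq⟩

theorem exists_eq_smul_cycTrace {p r s : Fin d} (hpr : p ≠ r) (hps : p ≠ s) (hrs : r ≠ s) {z : T}
    (h_mem : z ∈ m.cycTraceSub v)
    (hz : InheritsEigenvalues m.rep (m.cycTrace v (v p) (v r)) z) :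
    ∃ c : ℂ, z = c • m.cycTrace v (v p) (v r) := by
  have h_le : m.cycTraceSub v ≤ LinearMap.ker (m.coord v p p p r) := by
    rw [cycTraceSub, Submodule.span_le]
    rintro _ ⟨x, y, rfl⟩
    simp only [SetLike.mem_coe, LinearMap.mem_ker, coord, form_cycTrace, coord_basis, hpr.symm,
      if_false]
    ring
  have h_eq := (transformsAsPair_of_inheritsEigenvalues (m.cycTrace_swap v) (m.rep_cycTrace v)
    hz).eq_smul_trace_add_smul_cycTrace hpr hps hrs
  rw [LinearMap.mem_ker.1 (h_le h_mem), zero_smul, zero_add] at h_eq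
  exact ⟨_, h_eq⟩

theorem orbit_trace_equiv_schur (hd : 3 ≤ d) :
    Nonempty ((orbit m.rep (m.trace v (v ⟨0, by omega⟩)
      (v ⟨1, by omega⟩))).toRepresentation.Equiv (schurRep W (shape221 d))) := by
  have h_ne : (d : ℂ) ≠ 0 := by exact_mod_cast (by omega : d ≠ 0)
  refine m.orbit_alternating_equiv_schur v hd (Θ := (d : ℂ)⁻¹ • m.traceForm v)
    (fun w => eq_zero_of_eq_neg_self (K := ℂ) (m.trace_swap v w w)) (m.rep_trace v)
    (fun i k x y => ?_)
    fun z => m.exists_eq_smul_trace v (s := ⟨2, by omega⟩) (by simp) (by simp) (by simp)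
  rw [Pi.smul_apply, Pi.smul_apply, LinearMap.smul_apply, traceForm_trace, smul_eq_mul,
    inv_mul_cancel_left₀ h_ne]

theorem orbit_cycTrace_equiv_schur (hd : 3 ≤ d) :
    Nonempty ((orbit m.rep (m.cycTrace v (v ⟨0, by omega⟩)
      (v ⟨1, by omega⟩))).toRepresentation.Equiv (schurRep W (shape221 d))) := by
  have h_ne : (d : ℂ) - 2 ≠ 0 := by
    rw [sub_ne_zero]
    exact_mod_cast (by omega : d ≠ 2)
  refine m.orbit_alternating_equiv_schur v hd (Θ := ((d : ℂ) - 2)⁻¹ • m.traceForm v)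
    (fun w => eq_zero_of_eq_neg_self (K := ℂ) (m.cycTrace_swap v w w)) (m.rep_cycTrace v)
    (fun i k x y => ?_)
    fun z => m.exists_eq_smul_cycTrace v (s := ⟨2, by omega⟩) (by simp) (by simp) (by simp)
  rw [Pi.smul_apply, Pi.smul_apply, LinearMap.smul_apply, traceForm_cycTrace, smul_eq_mul,
    inv_mul_cancel_left₀ h_ne]

end TensModel

section Generators

variable {d : ℕ}

/-- The coefficient of `x_a` in `P(x_k P(x_i x_j))`. -/
def iterMul (a i j k : Fin d) : R d :=
  (if a = k then p none i j else 0) + ∑ l, p (some l) i j * p (some a) k l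

theorem C_eq_iterMul_sub (a j i k : Fin d) : C a j i k = iterMul a i j k - iterMul a k j i := by
  simp [C, projMul, projQuad, iterMul]

theorem iterMul_comm (a i j k : Fin d) : iterMul a i j k = iterMul a j i k := by
  simp only [iterMul, p_comm _ i j]

theorem C_swap (a j i k : Fin d) : C a j k i = -C a j i k := by
  rw [C_eq_iterMul_sub, C_eq_iterMul_sub, neg_sub]

theorem C_cyc (a j i k : Fin d) : C a j i k + C a i k j + C a k j i = 0 := by
  simp only [C_eq_iterMul_sub, iterMul_comm a k j i, iterMul_comm a k i j, iterMul_comm a j i k]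
  ring

/-- The quadratic terms of the sum are `tr (p_i p_k) - tr (p_k p_i)`. -/
theorem sum_C_diag (i k : Fin d) : ∑ a, C a a i k = 0 := by
  simp only [C_eq_iterMul_sub, iterMul, Finset.sum_sub_distrib, Finset.sum_add_distrib]
  rw [Finset.sum_ite_eq', Finset.sum_ite_eq', if_pos (Finset.mem_univ _),
    if_pos (Finset.mem_univ _), p_comm none k i, sub_eq_zero, Finset.sum_comm]
  simp only [mul_comm]

/-- The evaluation of `R` at a family of symmetric matrices. -/
def evalAt (E : Option (Fin d) → Fin d → Fin d → ℂ) (hE : ∀ r s t, E r s t = E r t s) :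
    R d →ₐ[ℂ] ℂ :=
  MvPolynomial.aeval fun q => Sym2.lift ⟨E q.1, hE q.1⟩ q.2

theorem evalAt_p (E : Option (Fin d) → Fin d → Fin d → ℂ) (hE : ∀ r s t, E r s t = E r t s)
    (r : Option (Fin d)) (s t : Fin d) : evalAt E hE (p r s t) = E r s t := by
  simp [evalAt, p]

theorem evalAt_iterMul (E : Option (Fin d) → Fin d → Fin d → ℂ) (hE : ∀ r s t, E r s t = E r t s)
    (a i j k : Fin d) : evalAt E hE (iterMul a i j k) =
      (if a = k then E none i j else 0) + ∑ l, E (some l) i j * E (some a) k l := by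
  simp only [iterMul, map_add, map_sum, map_mul, apply_ite (evalAt E hE), map_zero, evalAt_p]

/-- The symmetric matrix `e_i e_j^T + e_j e_i^T`. -/
def symUnit (i j s t : Fin d) : ℂ :=
  (if s = i then 1 else 0) * (if t = j then 1 else 0) +
    (if s = j then 1 else 0) * (if t = i then 1 else 0)

theorem symUnit_comm (i j s t : Fin d) : symUnit i j s t = symUnit i j t s := by
  rw [symUnit, symUnit]; ring

theorem sum_mul_symUnit (f : Fin d → Fin d → ℂ) (i j : Fin d) :
    ∑ j', ∑ i', f j' i' * symUnit i j i' j' = f j i + f i j := by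
  simp [symUnit, mul_add, Finset.sum_add_distrib]

/-- The family of matrices whose only nonzero member is `symUnit i j` in the place `a`. -/
def symUnitAt (a i j b s t : Fin d) : ℂ := if b = a then symUnit i j s t else 0

theorem symUnitAt_comm (a i j b s t : Fin d) : symUnitAt a i j b s t = symUnitAt a i j b t s := by
  rw [symUnitAt, symUnitAt, symUnit_comm]

end Generators

section Action

variable {d : ℕ} {W : Type*} [AddCommGroup W] [Module ℂ W] (v : Basis (Fin d) ℂ W)

theorem coord_comp_stdRep_inv (g : GLW W) (a : Fin d) :
    v.coord a ∘ₗ stdRep W g⁻¹ = ∑ a', mat v g⁻¹ a a' • v.coord a' := by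
  conv_lhs => rw [← v.sum_dual_apply_smul_coord (v.coord a ∘ₗ stdRep W g⁻¹)]
  refine Finset.sum_congr rfl fun a' _ => ?_
  rw [mat, LinearMap.toMatrix_apply]
  rfl

theorem stdRep_basis (g : GLW W) (j : Fin d) :
    stdRep W g (v j) = ∑ j', mat v g j' j • v j' := by
  conv_lhs => rw [← v.sum_repr (stdRep W g (v j))]
  simp only [mat, LinearMap.toMatrix_apply]

end Action

namespace TensModel

variable {d : ℕ} {W T : Type*} [AddCommGroup W] [Module ℂ W] [AddCommGroup T] [Module ℂ T]
  (m : TensModel W T) (v : Basis (Fin d) ℂ W)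

/-- The linear map `T → R` that sends `t(v_a^*; v_j, v_i, v_k)` to `C(a; j, (i, k))`. -/
def toR : T →ₗ[ℂ] R d :=
  (2 : ℂ)⁻¹ • ∑ a, ∑ j, ∑ i, ∑ k, (m.coord v a j i k).smulRight (C a j i k)

theorem toR_t (a j i k : Fin d) : m.toR v (m.t (v.coord a) (v j) (v i) (v k)) = C a j i k := by
  simp only [toR, LinearMap.smul_apply, LinearMap.sum_apply, LinearMap.smulRight_apply]
  rw [m.sum_coord_smul v C, C_swap a j i k, sub_neg_eq_add, ← two_smul ℂ, smul_smul,
    inv_mul_cancel₀ two_ne_zero, one_smul]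

theorem toR_rep (g : GLW W) (z : T) : m.toR v (m.rep g z) = twistedRep v g (m.toR v z) := by
  suffices m.toR v ∘ₗ m.rep g = twistedRep v g ∘ₗ m.toR v from LinearMap.congr_fun this z
  refine m.ext_basis v fun a j i k => ?_
  rw [LinearMap.comp_apply, LinearMap.comp_apply, toR_t, m.rep_t, map_smul]
  change _ = LinearMap.det (stdRep W g) • actAlg v g (C a j i k)
  rw [actAlg_C, coord_comp_stdRep_inv, stdRep_basis, stdRep_basis, stdRep_basis]
  congr 1
  simp only [map_sum, map_smul, LinearMap.sum_apply, LinearMap.smul_apply, toR_t,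
    Finset.smul_sum, smul_smul]
  refine Finset.sum_congr rfl fun k' _ => Finset.sum_congr rfl fun i' _ => ?_
  rw [Finset.sum_comm]
  refine Finset.sum_congr rfl fun a' _ => Finset.sum_congr rfl fun j' _ => ?_
  congr 1
  ring

theorem traceSub_le_ker : m.traceSub v ≤ LinearMap.ker (m.toR v) := by
  rw [traceSub, Submodule.span_le]
  rintro _ ⟨x, y, rfl⟩
  suffices (m.trace v).compr₂ (m.toR v) = 0 from LinearMap.congr_fun₂ this x y
  refine LinearMap.ext_basis v v fun i k => ?_
  simp only [LinearMap.compr₂_apply, trace_apply, map_sum, toR_t, sum_C_diag, LinearMap.zero_apply]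

theorem cycSub_le_ker : m.cycSub ≤ LinearMap.ker (m.toR v) := by
  rw [cycSub, Submodule.span_le]
  rintro _ ⟨α, w, x, y, rfl⟩
  rw [SetLike.mem_coe, LinearMap.mem_ker, ← v.sum_dual_apply_smul_coord α, ← v.sum_repr w,
    ← v.sum_repr x, ← v.sum_repr y]
  simp only [map_sum, map_smul, LinearMap.sum_apply, LinearMap.smul_apply, cyc_apply, map_add,
    toR_t, C_cyc, smul_zero, Finset.sum_const_zero]

theorem toR_eq_sum_coord_smul_iterMul (z : T) :
    m.toR v z = ∑ a, ∑ j, ∑ i, ∑ k, m.coord v a j i k z • iterMul a i j k := by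
  have h_toR : m.toR v = ∑ a, ∑ j, ∑ i, ∑ k, (m.coord v a j i k).smulRight (iterMul a i j k) := by
    refine m.ext_basis v fun a j i k => ?_
    simp only [LinearMap.sum_apply, LinearMap.smulRight_apply]
    rw [m.sum_coord_smul v (fun a j i k => iterMul a i j k), toR_t, C_eq_iterMul_sub]
  simp only [h_toR, LinearMap.sum_apply, LinearMap.smulRight_apply]

theorem evalAt_toR (E : Option (Fin d) → Fin d → Fin d → ℂ) (hE : ∀ r s t, E r s t = E r t s)
    (z : T) : evalAt E hE (m.toR v z) = ∑ a, ∑ j, ∑ i, ∑ k, m.coord v a j i k z *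
      ((if a = k then E none i j else 0) + ∑ l, E (some l) i j * E (some a) k l) := by
  simp only [toR_eq_sum_coord_smul_iterMul, map_sum, map_smul, evalAt_iterMul, smul_eq_mul]

/-- The coordinates of an element of `T`, symmetrized in the first two vectors. -/
def symCoord (a i j k : Fin d) : T →ₗ[ℂ] ℂ := m.coord v a j i k + m.coord v a i j k

/-- The linear terms of `toR z` determine the polar contraction up to a skew form. -/
theorem polarForm_add_polarForm_swap_eq_zero {z : T} (hz : m.toR v z = 0) (i j : Fin d) :
    m.polarForm v j i z + m.polarForm v i j z = 0 := by
  have h := m.evalAt_toR v (fun r => r.elim (symUnit i j) 0)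
    (by rintro (_ | r) s t; exacts [symUnit_comm .., rfl]) z
  simp only [hz, map_zero, Option.elim_none, Option.elim_some, Pi.zero_apply,
    Finset.sum_const_zero, add_zero, mul_ite, mul_zero, Finset.sum_ite_eq, Finset.mem_univ,
    if_true, sum_mul_symUnit] at h
  rw [polarForm, polarForm, LinearMap.sum_apply, LinearMap.sum_apply, ← Finset.sum_add_distrib]
  exact h.symm

/-- The polarization, as a function of `p_1, …, p_d`, of the quadratic part of `toR z`. -/
def quadForm (z : T) (E E' : Fin d → Fin d → Fin d → ℂ) : ℂ :=
  ∑ a, ∑ j, ∑ i, ∑ k, m.coord v a j i k z * ∑ l, E l i j * E' a k l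

theorem quadForm_add (z : T) (E E' : Fin d → Fin d → Fin d → ℂ) :
    m.quadForm v z (E + E') (E + E') = m.quadForm v z E E + m.quadForm v z E E' +
      m.quadForm v z E' E + m.quadForm v z E' E' := by
  simp only [quadForm, Pi.add_apply, add_mul, mul_add, Finset.sum_add_distrib]
  ring

theorem quadForm_self {z : T} (hz : m.toR v z = 0) {E : Fin d → Fin d → Fin d → ℂ}
    (hE : ∀ r s t, E r s t = E r t s) : m.quadForm v z E E = 0 := by
  have h := m.evalAt_toR v (fun r => r.elim 0 E) (by rintro (_ | r) s t; exacts [rfl, hE r s t]) z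
  simp only [hz, map_zero, Option.elim_none, Option.elim_some, Pi.zero_apply, ite_self,
    zero_add] at h
  exact h.symm

theorem quadForm_symUnitAt (z : T) (a i j k l r : Fin d) :
    m.quadForm v z (symUnitAt r i j) (symUnitAt a k l) =
      (if l = r then m.symCoord v a i j k z else 0) +
        (if k = r then m.symCoord v a i j l z else 0) := by
  have h_sym : ∀ k', ∑ j', ∑ i', m.coord v a j' i' k' z * (symUnit i j i' j' * symUnit k l k' r) =
      m.symCoord v a i j k' z * symUnit k l k' r := fun k' => by
    simp only [← mul_assoc, ← Finset.sum_mul, sum_mul_symUnit]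
    rfl
  calc m.quadForm v z (symUnitAt r i j) (symUnitAt a k l)
      = ∑ j', ∑ i', ∑ k', m.coord v a j' i' k' z * (symUnit i j i' j' * symUnit k l k' r) := by
        simp only [quadForm, symUnitAt, ite_mul, mul_ite, zero_mul, mul_zero]
        rw [Finset.sum_eq_single a (fun b _ hb => by simp [hb]) (by simp)]
        simp
    _ = ∑ k', m.symCoord v a i j k' z * symUnit k l k' r := by
        simp only [← h_sym]
        rw [Finset.sum_comm (s := Finset.univ (α := Fin d)) (f := fun k' j' => ∑ i',
          m.coord v a j' i' k' z * (symUnit i j i' j' * symUnit k l k' r))]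
        exact Finset.sum_congr rfl fun j' _ => Finset.sum_comm
    _ = _ := by simp [symUnit, mul_add, Finset.sum_add_distrib, eq_comm]

theorem symCoord_relation {z : T} (hz : m.toR v z = 0) (a i j k l r : Fin d) :
    (if l = r then m.symCoord v a i j k z else 0) + (if k = r then m.symCoord v a i j l z else 0) +
      ((if j = a then m.symCoord v r k l i z else 0) +
        (if i = a then m.symCoord v r k l j z else 0)) = 0 := by
  have h_comm : ∀ b s t, (symUnitAt r i j + symUnitAt a k l) b s t =
      (symUnitAt r i j + symUnitAt a k l) b t s := fun b s t =>
    congrArg₂ (· + ·) (symUnitAt_comm r i j b s t) (symUnitAt_comm a k l b s t)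
  have h_add := m.quadForm_add v z (symUnitAt r i j) (symUnitAt a k l)
  rw [m.quadForm_self v hz (symUnitAt_comm r i j), m.quadForm_self v hz (symUnitAt_comm a k l),
    m.quadForm_self v hz h_comm,
    quadForm_symUnitAt, quadForm_symUnitAt] at h_add
  linear_combination -h_add

theorem symCoord_eq_zero {z : T} (hz : m.toR v z = 0)
    (h_contract : ∀ k i, ∑ r, m.symCoord v r k r i z = 0) (a i j k : Fin d) :
    m.symCoord v a i j k z = 0 := by
  have h_sum := Finset.sum_eq_zero fun r (_ : r ∈ Finset.univ) =>
    m.symCoord_relation v hz a i j k r r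
  have h_ite : ∀ (P : Prop) [Decidable P] (b : Fin d),
      ∑ r, (if P then m.symCoord v r k r b z else 0) = 0 := fun P _ b => by
    split_ifs
    exacts [h_contract k b, Finset.sum_const_zero]
  simp only [if_true, Finset.sum_add_distrib, Finset.sum_const, Finset.card_univ, h_ite,
    Fintype.card_fin, nsmul_eq_mul, Finset.sum_ite_eq, Finset.mem_univ, add_zero] at h_sum
  have h_succ : ((d : ℂ) + 1) * m.symCoord v a i j k z = 0 := by linear_combination h_sum
  exact (mul_eq_zero.1 h_succ).resolve_left (by exact_mod_cast d.succ_ne_zero)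

theorem primitive_sup_polarSub_le_ker {f : T →ₗ[ℂ] ℂ}
    (h_primitive : ∀ (α : Dual ℂ W) (w x : W), α w = 0 → α x = 0 → f (m.t α w w x) = 0)
    (h_polar : ∀ w, f (m.polar v w w) = 0) :
    m.primitive ⊔ m.polarSub v ≤ LinearMap.ker f := by
  refine sup_le (Submodule.span_le.2 ?_) (Submodule.span_le.2 ?_)
  · rintro _ ⟨α, w, x, hw, hx, rfl⟩
    exact h_primitive α w x hw hx
  · rintro _ ⟨w, rfl⟩
    exact h_polar w

theorem coord_cyclic_sum_eq_zero {z : T} (hz : z ∈ m.primitive ⊔ m.polarSub v) (a j i k : Fin d) :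
    m.coord v a j i k z + m.coord v a i k j z + m.coord v a k j i z = 0 := by
  refine m.primitive_sup_polarSub_le_ker v
    (f := m.coord v a j i k + m.coord v a i k j + m.coord v a k j i)
    (fun α w x _ _ => ?_) (fun w => ?_) hz
  · simp only [LinearMap.add_apply, coord, m.form_t]
    ring
  · simp only [LinearMap.add_apply, coord, form_polar]
    ring

theorem traceForm_eq_zero {z : T} (hz : z ∈ m.primitive ⊔ m.polarSub v) (i k : Fin d) :
    m.traceForm v i k z = 0 := by
  refine m.primitive_sup_polarSub_le_ker v (f := m.traceForm v i k)
    (fun α w x hw _ => ?_) (fun w => ?_) hz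
  · rw [traceForm, LinearMap.sum_apply, ← zero_mul (v.coord i w * v.coord k x -
      v.coord i x * v.coord k w), ← hw, ← sum_coord_mul v w α, Finset.sum_mul]
    exact Finset.sum_congr rfl fun a _ => by rw [m.form_t]; ring
  · simp [traceForm, form_polar, -Basis.coord_apply, coord_basis, mul_sub, mul_comm]

theorem polarForm_symm {z : T} (hz : z ∈ m.primitive ⊔ m.polarSub v) (i j : Fin d) :
    m.polarForm v j i z = m.polarForm v i j z := by
  refine sub_eq_zero.1 (m.primitive_sup_polarSub_le_ker v
    (f := m.polarForm v j i - m.polarForm v i j) (fun α w x hw hx => ?_) (fun w => ?_) hz)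
  · have h_t : ∀ i j, m.polarForm v j i (m.t α w w x) = 0 := fun i j => by
      calc m.polarForm v j i (m.t α w w x)
          = v.coord j w * (v.coord i w * ∑ a, v.coord a x * α (v a) -
              v.coord i x * ∑ a, v.coord a w * α (v a)) := by
            rw [polarForm, LinearMap.sum_apply, Finset.mul_sum, Finset.mul_sum,
              ← Finset.sum_sub_distrib, Finset.mul_sum]
            exact Finset.sum_congr rfl fun a _ => by rw [m.form_t]; ring
        _ = 0 := by
            rw [sum_coord_mul, sum_coord_mul, hw, hx, mul_zero, mul_zero, sub_zero, mul_zero]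
    rw [LinearMap.sub_apply, h_t, h_t, sub_zero]
  · rw [LinearMap.sub_apply, polarForm_polar, polarForm_polar]
    ring

theorem eq_zero_of_toR_eq_zero {z : T} (h_mem : z ∈ m.primitive ⊔ m.polarSub v)
    (hz : m.toR v z = 0) : z = 0 := by
  have h_polar : ∀ j i, m.polarForm v j i z = 0 := fun j i => by
    have h_skew := m.polarForm_add_polarForm_swap_eq_zero v hz i j
    rw [m.polarForm_symm v h_mem j i] at h_skew
    exact add_self_eq_zero.1 h_skew
  have h_sym : ∀ a i j k, m.coord v a j i k z + m.coord v a i j k z = 0 := fun a i j k => by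
    refine m.symCoord_eq_zero v hz (fun k i => ?_) a i j k
    calc ∑ r, m.symCoord v r k r i z = m.traceForm v k i z - m.polarForm v k i z := by
          rw [traceForm, polarForm, LinearMap.sum_apply, LinearMap.sum_apply,
            ← Finset.sum_sub_distrib]
          refine Finset.sum_congr rfl fun r _ => ?_
          rw [symCoord, LinearMap.add_apply, m.coord_swap v r k i r, sub_eq_add_neg]
          rfl
      _ = 0 := by rw [m.traceForm_eq_zero v h_mem, h_polar, sub_zero]
  refine m.eq_zero_of_coord v fun a j i k => ?_
  have h_three : 3 * m.coord v a j i k z = 0 := by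
    linear_combination m.coord_cyclic_sum_eq_zero v h_mem a j i k - m.coord_swap v a i j k z +
      h_sym a i j k - h_sym a j k i + m.coord_swap v a j i k z
  exact (mul_eq_zero.1 h_three).resolve_left three_ne_zero

end TensModel

section Isotypic

variable {G V U : Type*} [Group G] [AddCommGroup V] [Module ℂ V] [AddCommGroup U] [Module ℂ U]
  {ρ : Representation ℂ G V} {σ : Representation ℂ G U} {u : V}

theorem le_isotypic {N : Subrepresentation ρ} (h : Nonempty (N.toRepresentation.Equiv σ)) :
    N.toSubmodule ≤ isotypic ρ σ :=
  le_iSup₂ (f := fun (N : Subrepresentation ρ) (_ : Nonempty (N.toRepresentation.Equiv σ)) =>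
    N.toSubmodule) N h

theorem range_le_isotypic {i : σ.IntertwiningMap ρ} (hi : Function.Injective i) :
    LinearMap.range i.toLinearMap ≤ isotypic ρ σ := by
  let N : Subrepresentation ρ := ⟨LinearMap.range i.toLinearMap, fun g => by
    rintro _ ⟨x, rfl⟩
    exact ⟨σ g x, i.isIntertwining _ _ g x⟩⟩
  let e : σ.Equiv N.toRepresentation :=
    .mk (.ofInjective i.toLinearMap hi) fun g => by
      ext x
      exact congrArg id (i.isIntertwining _ _ g x)
  exact le_isotypic (N := N) ⟨e.symm⟩

theorem exists_embedding {N : Subrepresentation ρ} (h : Nonempty (N.toRepresentation.Equiv σ)) :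
    ∃ i : σ.IntertwiningMap ρ, Function.Injective i ∧
      LinearMap.range i.toLinearMap = N.toSubmodule := by
  obtain ⟨e⟩ := h
  refine ⟨⟨N.toSubmodule.subtype ∘ₗ e.symm.toLinearMap, fun g => ?_⟩, ?_, ?_⟩
  · ext x
    exact congrArg Subtype.val (e.symm.isIntertwining _ _ g x)
  · exact N.toSubmodule.injective_subtype.comp (EquivLike.injective e.symm)
  · exact (LinearMap.range_comp_of_range_eq_top _
      (LinearMap.range_eq_top.2 (EquivLike.surjective e.symm))).trans N.toSubmodule.range_subtype

theorem isotypic_le {M : Submodule ℂ V}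
    (hM : ∀ f : σ.IntertwiningMap ρ, LinearMap.range f.toLinearMap ≤ M) : isotypic ρ σ ≤ M :=
  iSup₂_le fun _ hN => by
    obtain ⟨i, -, h_range⟩ := exists_embedding hN
    exact h_range ▸ hM i

/-- The map is determined by the image of `u`, which inherits the eigenvalues of `u`. -/
theorem range_le_of_inheritsEigenvalues (hu : Nonempty ((orbit ρ u).toRepresentation.Equiv σ))
    {M : Subrepresentation ρ} (hM : ∀ z, InheritsEigenvalues ρ u z → z ∈ M.toSubmodule)
    (f : σ.IntertwiningMap ρ) : LinearMap.range f.toLinearMap ≤ M.toSubmodule := by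
  obtain ⟨e⟩ := hu
  let F := f.comp e.toIntertwiningMap
  let generator : (orbit ρ u).toSubmodule := ⟨u, mem_orbit_self ρ u⟩
  have h_generator : F generator ∈ M.toSubmodule := hM _ fun g c hg => by
    rw [← F.isIntertwining, ← map_smul]
    exact congrArg F (Subtype.ext hg)
  have h_orbit : ∀ z (hz : z ∈ (orbit ρ u).toSubmodule), F ⟨z, hz⟩ ∈ M.toSubmodule := fun z hz => by
    induction hz using Submodule.span_induction with
    | mem z hz =>
      obtain ⟨g, rfl⟩ := hz
      have h_apply := F.isIntertwining _ _ g generator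
      exact h_apply ▸ M.apply_mem_toSubmodule g h_generator
    | zero => exact (map_zero F).symm ▸ M.toSubmodule.zero_mem
    | add x y hx hy h_x h_y => exact map_add F ⟨x, hx⟩ ⟨y, hy⟩ ▸ M.toSubmodule.add_mem h_x h_y
    | smul c x hx h_x => exact map_smul F c ⟨x, hx⟩ ▸ M.toSubmodule.smul_mem c h_x
  rintro _ ⟨x, rfl⟩
  simpa [F] using h_orbit (e.symm x) (e.symm x).2

theorem range_le_orbit (hu : Nonempty ((orbit ρ u).toRepresentation.Equiv σ))
    (h_unique : ∀ z, InheritsEigenvalues ρ u z → ∃ c : ℂ, z = c • u)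
    (f : σ.IntertwiningMap ρ) : LinearMap.range f.toLinearMap ≤ (orbit ρ u).toSubmodule :=
  range_le_of_inheritsEigenvalues hu (fun z hz => by
    obtain ⟨c, rfl⟩ := h_unique z hz
    exact Submodule.smul_mem _ c (mem_orbit_self ρ u)) f

end Isotypic

section Splitting

variable {K G T Y A B : Type*} [CommRing K] [Group G] [AddCommGroup T] [Module K T]
  [AddCommGroup Y] [Module K Y] [AddCommGroup A] [Module K A] [AddCommGroup B] [Module K B]

theorem bijective_comp_coprod {Q : T →ₗ[K] Y} {i : A →ₗ[K] T} {j : B →ₗ[K] T}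
    (hQ : Function.Surjective Q) (hi : Function.Injective i) (hj : Function.Injective j)
    (h_compl : IsCompl (LinearMap.range i) (LinearMap.range j ⊔ LinearMap.ker Q))
    (h_disjoint : Disjoint (LinearMap.range j) (LinearMap.ker Q)) :
    Function.Bijective (Q ∘ₗ i.coprod j) := by
  constructor
  · rw [← LinearMap.ker_eq_bot, LinearMap.ker_eq_bot']
    rintro ⟨a, b⟩ (h : Q (i a + j b) = 0)
    have ha : i a = 0 := Submodule.disjoint_def.1 h_compl.disjoint _ ⟨a, rfl⟩
      (Submodule.mem_sup.2 ⟨j (-b), ⟨-b, rfl⟩, i a + j b, h, by rw [map_neg]; abel⟩)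
    have hb : j b = 0 := Submodule.disjoint_def.1 h_disjoint _ ⟨b, rfl⟩
      (by rwa [ha, zero_add] at h)
    exact Prod.ext (hi (ha.trans (map_zero i).symm)) (hj (hb.trans (map_zero j).symm))
  · intro y
    obtain ⟨z, rfl⟩ := hQ y
    obtain ⟨_, ⟨a, rfl⟩, _, h_mem, rfl⟩ :=
      Submodule.mem_sup.1 (h_compl.sup_eq_top ▸ Submodule.mem_top (x := z))
    obtain ⟨_, ⟨b, rfl⟩, k, hk, rfl⟩ := Submodule.mem_sup.1 h_mem
    refine ⟨(a, b), ?_⟩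
    simp [LinearMap.mem_ker.1 hk]

theorem isCompl_range_ker_of_leftInverse {Q : T →ₗ[K] Y} {φ : Y →ₗ[K] T}
    (h : Function.LeftInverse Q φ) : IsCompl (LinearMap.range φ) (LinearMap.ker Q) :=
  ⟨Submodule.disjoint_def.2 (by
      rintro _ ⟨y, rfl⟩ (hy : Q (φ y) = 0)
      rw [(h y).symm.trans hy, map_zero]),
    codisjoint_iff.2 (eq_top_iff.2 fun z _ => Submodule.mem_sup.2
      ⟨φ (Q z), ⟨Q z, rfl⟩, z - φ (Q z), by simp [h (Q z)], add_sub_cancel _ _⟩)⟩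

theorem map_comap_range (φ : Y →ₗ[K] T) (e : Y ≃ₗ[K] B) (f : A →ₗ[K] B) :
    Submodule.map φ (Submodule.comap e.toLinearMap (LinearMap.range f)) =
      LinearMap.range (φ ∘ₗ e.symm.toLinearMap ∘ₗ f) := by
  rw [LinearMap.range_comp, LinearMap.range_comp, Submodule.map_equiv_eq_comap_symm]
  rfl

variable {τ : Representation K G T} {η : Representation K G Y} {α : Representation K G A}
  {β : Representation K G B}

/-- The equivariant map `(a, b) ↦ i a + j b`. -/
def coprodMap (i : α.IntertwiningMap τ) (j : β.IntertwiningMap τ) :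
    (α.prod β).IntertwiningMap τ where
  toLinearMap := i.toLinearMap.coprod j.toLinearMap
  isIntertwining' g := by
    ext x <;> simp [i.isIntertwining, j.isIntertwining]

theorem exists_section {Q : τ.IntertwiningMap η} {i : α.IntertwiningMap τ}
    {j : β.IntertwiningMap τ}
    (hQ : Function.Surjective Q) (hi : Function.Injective i) (hj : Function.Injective j)
    (h_compl : IsCompl (LinearMap.range i.toLinearMap)
      (LinearMap.range j.toLinearMap ⊔ LinearMap.ker Q.toLinearMap))
    (h_disjoint : Disjoint (LinearMap.range j.toLinearMap) (LinearMap.ker Q.toLinearMap)) :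
    ∃ (φ : η.IntertwiningMap τ) (e : η.Equiv (α.prod β)), Function.LeftInverse Q φ ∧
      Submodule.map φ.toLinearMap
          (Submodule.comap e.toLinearMap (LinearMap.range (LinearMap.inl K A B))) =
        LinearMap.range i.toLinearMap ∧
      Submodule.map φ.toLinearMap
          (Submodule.comap e.toLinearMap (LinearMap.range (LinearMap.inr K A B))) =
        LinearMap.range j.toLinearMap := by
  let F : (α.prod β).Equiv η := (Q.comp (coprodMap i j)).ofBijective
    (bijective_comp_coprod hQ hi hj h_compl h_disjoint)
  let φ : η.IntertwiningMap τ := (coprodMap i j).comp F.symm.toIntertwiningMap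
  have h_φ : φ.toLinearMap ∘ₗ F.toLinearMap = i.toLinearMap.coprod j.toLinearMap :=
    LinearMap.ext fun x => congrArg (coprodMap i j) (F.symm_apply_apply x)
  refine ⟨φ, F.symm, F.apply_symm_apply, ?_, ?_⟩
  · refine (map_comap_range φ.toLinearMap F.symm.toLinearEquiv _).trans ?_
    change LinearMap.range ((φ.toLinearMap ∘ₗ F.toLinearMap) ∘ₗ LinearMap.inl K A B) = _
    rw [h_φ, LinearMap.coprod_inl]
  · refine (map_comap_range φ.toLinearMap F.symm.toLinearEquiv _).trans ?_
    change LinearMap.range ((φ.toLinearMap ∘ₗ F.toLinearMap) ∘ₗ LinearMap.inr K A B) = _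
    rw [h_φ, LinearMap.coprod_inr]

theorem section_unique {Q : τ.IntertwiningMap η} (e : η.Equiv (α.prod β)) {M N : Submodule K T}
    (hM : ∀ f : α.IntertwiningMap τ, LinearMap.range f.toLinearMap ≤ M)
    (hN : ∀ f : β.IntertwiningMap τ, LinearMap.range f.toLinearMap ≤ N)
    (hM_ker : Disjoint M (LinearMap.ker Q.toLinearMap))
    (hN_ker : Disjoint N (LinearMap.ker Q.toLinearMap)) {φ ψ : η.IntertwiningMap τ}
    (hφ : Function.LeftInverse Q φ) (hψ : Function.LeftInverse Q ψ) : ψ = φ := by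
  let δ := (ψ - φ).comp e.symm.toIntertwiningMap
  have h_ker : ∀ x, δ x ∈ LinearMap.ker Q.toLinearMap := fun x => by
    change Q (ψ _ - φ _) = 0
    rw [map_sub, hφ, hψ, sub_self]
  have h_inl : ∀ a, δ (a, 0) = 0 := fun a => Submodule.disjoint_def.1 hM_ker _
    (hM (δ.comp (.inl K α β)) ⟨a, rfl⟩) (h_ker _)
  have h_inr : ∀ b, δ (0, b) = 0 := fun b => Submodule.disjoint_def.1 hN_ker _
    (hN (δ.comp (.inr K α β)) ⟨b, rfl⟩) (h_ker _)
  refine Representation.IntertwiningMap.ext (LinearMap.ext fun y => sub_eq_zero.1 ?_)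
  obtain ⟨⟨a, b⟩, rfl⟩ := EquivLike.surjective e.symm y
  have h_add : δ (a, b) = 0 := by
    rw [show ((a, b) : A × B) = (a, 0) + (0, b) by simp, map_add, h_inl, h_inr, add_zero]
  exact h_add

end Splitting

namespace TensModel

variable {d : ℕ} {W T : Type*} [AddCommGroup W] [Module ℂ W] [AddCommGroup T] [Module ℂ T]
  (m : TensModel W T) (v : Basis (Fin d) ℂ W)

theorem exists_embedding_shape321 (v : Basis (Fin d) ℂ W) (hd : 3 ≤ d) :
    ∃ i : (schurRep W (shape321 d)).IntertwiningMap m.rep, Function.Injective i ∧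
      LinearMap.range i.toLinearMap = m.primitive := by
  rw [m.primitive_eq_orbit v (a := ⟨d - 1, by omega⟩) (j := ⟨0, by omega⟩) (k := ⟨1, by omega⟩)
    (by grind) (by grind) (by simp)]
  exact exists_embedding (m.orbit_t_equiv_schur_and_primitive_inf_eq_bot v hd).1

theorem range_le_primitive (v : Basis (Fin d) ℂ W) (hd : 3 ≤ d)
    (f : (schurRep W (shape321 d)).IntertwiningMap m.rep) :
    LinearMap.range f.toLinearMap ≤ m.primitive := by
  rw [m.primitive_eq_orbit v (a := ⟨d - 1, by omega⟩) (j := ⟨0, by omega⟩) (k := ⟨1, by omega⟩)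
    (by grind) (by grind) (by simp)]
  exact range_le_orbit (m.orbit_t_equiv_schur_and_primitive_inf_eq_bot v hd).1 (fun z hz =>
    ⟨_, m.eq_smul_t_of_inheritsEigenvalues v (by grind) (by grind) (by simp) hz⟩) f

theorem isotypic_shape321 (v : Basis (Fin d) ℂ W) (hd : 3 ≤ d) :
    isotypic m.rep (schurRep W (shape321 d)) = m.primitive := by
  obtain ⟨i, hi, h_range⟩ := m.exists_embedding_shape321 v hd
  exact le_antisymm (isotypic_le (m.range_le_primitive v hd)) (h_range ▸ range_le_isotypic hi)

theorem exists_embedding_shape311 (hd : 3 ≤ d) :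
    ∃ j : (schurRep W (shape311 d)).IntertwiningMap m.rep, Function.Injective j ∧
      LinearMap.range j.toLinearMap = m.polarSub v := by
  rw [m.polarSub_eq_orbit v ⟨0, by omega⟩]
  exact exists_embedding (m.orbit_polar_equiv_schur v hd)

theorem range_le_polarSub (hd : 3 ≤ d) (f : (schurRep W (shape311 d)).IntertwiningMap m.rep) :
    LinearMap.range f.toLinearMap ≤ m.polarSub v := by
  rw [m.polarSub_eq_orbit v ⟨0, by omega⟩]
  exact range_le_orbit (m.orbit_polar_equiv_schur v hd) (fun z hz =>
    ⟨_, m.eq_smul_polar_of_inheritsEigenvalues v (b := ⟨1, by omega⟩) (by simp) hz⟩) f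

theorem isotypic_shape311 (hd : 3 ≤ d) :
    isotypic m.rep (schurRep W (shape311 d)) = m.polarSub v := by
  obtain ⟨j, hj, h_range⟩ := m.exists_embedding_shape311 v hd
  exact le_antisymm (isotypic_le (m.range_le_polarSub v hd)) (h_range ▸ range_le_isotypic hj)

theorem isotypic_shape222 (v : Basis (Fin d) ℂ W) (hd : 4 ≤ d) :
    isotypic m.rep (schurRep W (shape222 d)) = m.cycPrimitive := by
  have h_equiv := m.orbit_cyc_equiv_schur v hd
  rw [m.cycPrimitive_eq_orbit v (a := ⟨d - 1, by omega⟩) (j := ⟨0, by omega⟩) (i := ⟨1, by omega⟩)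
    (k := ⟨2, by omega⟩) (by grind) (by grind) (by grind) (by simp) (by simp)
    (by simp)]
  exact le_antisymm (isotypic_le (range_le_orbit h_equiv fun z hz =>
    ⟨_, m.eq_smul_cyc_of_inheritsEigenvalues v (by grind) (by grind) (by grind)
      (by simp) (by simp) (by simp) hz⟩))
    (le_isotypic h_equiv)

theorem isotypic_shape221 (hd : 3 ≤ d) :
    isotypic m.rep (schurRep W (shape221 d)) = m.traceSub v ⊔ m.cycTraceSub v := by
  have h_trace := m.orbit_trace_equiv_schur v hd
  have h_cycTrace := m.orbit_cycTrace_equiv_schur v hd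
  have h_ne : (⟨0, by omega⟩ : Fin d) ≠ ⟨1, by omega⟩ := by simp
  rw [traceSub, cycTraceSub, m.span_alternating_eq_orbit v
      (fun w => eq_zero_of_eq_neg_self (K := ℂ) (m.trace_swap v w w)) (m.rep_trace v) h_ne,
    m.span_alternating_eq_orbit v
      (fun w => eq_zero_of_eq_neg_self (K := ℂ) (m.cycTrace_swap v w w)) (m.rep_cycTrace v) h_ne]
  refine le_antisymm (isotypic_le (range_le_of_inheritsEigenvalues h_trace
    (M := orbit m.rep _ ⊔ orbit m.rep _) fun z hz => ?_))
    (sup_le (le_isotypic h_trace) (le_isotypic h_cycTrace))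
  rw [(transformsAsPair_of_inheritsEigenvalues (m.trace_swap v) (m.rep_trace v)
    hz).eq_smul_trace_add_smul_cycTrace (s := ⟨2, by omega⟩) h_ne (by simp) (by simp)]
  exact Submodule.add_mem_sup (Submodule.smul_mem _ _ (mem_orbit_self _ _))
    (Submodule.smul_mem _ _ (mem_orbit_self _ _))

theorem cycSub_eq (hd : 3 ≤ d) : m.cycSub = m.cycPrimitive ⊔ m.cycTraceSub v := by
  refine le_antisymm (m.cycSub_le v hd) (sup_le (Submodule.span_mono ?_) (Submodule.span_le.2 ?_))
  · rintro _ ⟨α, w, x, y, -, -, -, rfl⟩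
    exact ⟨α, w, x, y, rfl⟩
  · rintro _ ⟨x, y, rfl⟩
    rw [cycTrace_apply]
    exact Submodule.sum_mem _ fun a _ => Submodule.subset_span ⟨_, _, _, _, rfl⟩

theorem isotypic_shape221_sup_isotypic_shape222 (hd : 3 ≤ d) :
    isotypic m.rep (schurRep W (shape221 d)) ⊔
      ⨆ _ : 4 ≤ d, isotypic m.rep (schurRep W (shape222 d)) = m.traceSub v ⊔ m.cycSub := by
  rw [m.isotypic_shape221 v hd, m.cycSub_eq v hd, sup_assoc, sup_comm m.cycPrimitive]
  obtain rfl | h_four := hd.eq_or_lt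
  · simp [m.cycPrimitive_eq_bot v]
  · simp only [Nat.succ_le_of_lt h_four, iSup_pos, m.isotypic_shape222 v h_four]

theorem ker_toR (hd : 2 ≤ d) : LinearMap.ker (m.toR v) = m.traceSub v ⊔ m.cycSub := by
  have h_le : m.traceSub v ⊔ m.cycSub ≤ LinearMap.ker (m.toR v) :=
    sup_le (m.traceSub_le_ker v) (m.cycSub_le_ker v)
  refine le_antisymm (fun z hz => ?_) h_le
  have h_top := m.sup_eq_top v hd
  rw [← sup_assoc] at h_top
  obtain ⟨x, hx, y, hy, rfl⟩ := Submodule.mem_sup.1 (h_top ▸ Submodule.mem_top (x := z))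
  have h_x : m.toR v x = 0 := by
    rwa [LinearMap.mem_ker, map_add, LinearMap.mem_ker.1 (h_le hy), add_zero] at hz
  rwa [m.eq_zero_of_toR_eq_zero v hx h_x, zero_add]

theorem disjoint_polarSub_ker_toR : Disjoint (m.polarSub v) (LinearMap.ker (m.toR v)) :=
  Submodule.disjoint_def.2 fun _ h_mem hz =>
    m.eq_zero_of_toR_eq_zero v (Submodule.mem_sup_right h_mem) hz

theorem isCompl_primitive_polarSub_sup_ker_toR (hd : 3 ≤ d) :
    IsCompl m.primitive (m.polarSub v ⊔ LinearMap.ker (m.toR v)) := by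
  rw [m.ker_toR v (by omega)]
  exact .of_eq (m.orbit_t_equiv_schur_and_primitive_inf_eq_bot v hd).2 (m.sup_eq_top v (by omega))

theorem exists_unique_section {Y : Type*} [AddCommGroup Y] [Module ℂ Y]
    {η : Representation ℂ (GLW W) Y} (hd : 3 ≤ d) {Q : m.rep.IntertwiningMap η}
    (hQ : Function.Surjective Q)
    (h_ker : LinearMap.ker Q.toLinearMap = LinearMap.ker (m.toR v)) :
    ∃ (φ : η.IntertwiningMap m.rep)
      (e : η.Equiv ((schurRep W (shape321 d)).prod (schurRep W (shape311 d)))),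
      Function.LeftInverse Q φ ∧
      (∀ ψ : η.IntertwiningMap m.rep, Function.LeftInverse Q ψ → ψ = φ) ∧
      Submodule.map φ.toLinearMap
          (Submodule.comap e.toLinearMap (LinearMap.range (LinearMap.inl ℂ _ _))) =
        isotypic m.rep (schurRep W (shape321 d)) ∧
      Submodule.map φ.toLinearMap
          (Submodule.comap e.toLinearMap (LinearMap.range (LinearMap.inr ℂ _ _))) =
        isotypic m.rep (schurRep W (shape311 d)) ∧
      IsCompl (LinearMap.range φ.toLinearMap) (LinearMap.ker Q.toLinearMap) := by
  have h_compl := m.isCompl_primitive_polarSub_sup_ker_toR v hd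
  have h_disjoint := m.disjoint_polarSub_ker_toR v
  obtain ⟨i, hi, h_i⟩ := m.exists_embedding_shape321 v hd
  obtain ⟨j, hj, h_j⟩ := m.exists_embedding_shape311 v hd
  rw [← h_ker] at h_compl h_disjoint
  obtain ⟨φ, e, hφ, h_inl, h_inr⟩ := exists_section hQ hi hj (by rwa [h_i, h_j]) (by rwa [h_j])
  refine ⟨φ, e, hφ, fun ψ hψ => ?_, ?_, ?_, isCompl_range_ker_of_leftInverse hφ⟩
  · exact section_unique e (m.range_le_primitive v hd) (m.range_le_polarSub v hd)
      (h_compl.disjoint.mono_right le_sup_right) h_disjoint hφ hψ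
  · rw [h_inl, h_i, m.isotypic_shape321 v hd]
  · rw [h_inr, h_j, m.isotypic_shape311 v hd]

end TensModel

section ToY

variable {d : ℕ} {W : Type*} [AddCommGroup W] [Module ℂ W] (v : Basis (Fin d) ℂ W)

theorem span_genY : Submodule.span ℂ {y | ∃ a j i k, y = genY v a j i k} = ⊤ := by
  refine Submodule.eq_top_iff'.2 fun ⟨f, hf⟩ => ?_
  induction hf using Submodule.span_induction with
  | mem f hf =>
    obtain ⟨a, j, i, k, rfl⟩ := hf
    exact Submodule.subset_span ⟨a, j, i, k, rfl⟩
  | zero => exact Submodule.zero_mem _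
  | add f g hf hg h_f h_g => exact Submodule.add_mem _ h_f h_g
  | smul c f hf h_f => exact Submodule.smul_mem _ c h_f

variable [NeZero d]

theorem toR_mem_Y (z : ⋀[ℂ]^(d - 1) W ⊗[ℂ] (W ⊗[ℂ] ⋀[ℂ]^2 W)) :
    (ambientModel v).toR v z ∈ (Y v).toSubmodule := by
  simp only [TensModel.toR, LinearMap.smul_apply, LinearMap.sum_apply, LinearMap.smulRight_apply]
  exact Submodule.smul_mem _ _ (Submodule.sum_mem _ fun a _ => Submodule.sum_mem _ fun j _ =>
    Submodule.sum_mem _ fun i _ => Submodule.sum_mem _ fun k _ =>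
      Submodule.smul_mem _ _ (Submodule.subset_span ⟨a, j, i, k, rfl⟩))

/-- The equivariant map `⋀^{d-1} W ⊗ W ⊗ ⋀² W → Y` that sends
`(-1)^a (v_1 ∧ ⋯ ∧ v̂_a ∧ ⋯ ∧ v_d) ⊗ v_j ⊗ (v_i ∧ v_k)` to `C(a; j, (i, k))`. -/
def toY : (ambientRep W d).IntertwiningMap (Yrep v) where
  toLinearMap := ((ambientModel v).toR v).codRestrict _ (toR_mem_Y v)
  isIntertwining' g := LinearMap.ext fun z => Subtype.ext ((ambientModel v).toR_rep v g z)

theorem toY_genT (a j i k : Fin d) : toY v (genT v a j i k) = genY v a j i k := by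
  rw [genT_eq_tens]
  exact Subtype.ext ((ambientModel v).toR_t v a j i k)

theorem ker_toY : LinearMap.ker (toY v).toLinearMap = LinearMap.ker ((ambientModel v).toR v) :=
  LinearMap.ker_codRestrict ..

theorem remainingIsotypic_eq_ker_toY (hd : 3 ≤ d) :
    remainingIsotypic W d = LinearMap.ker (toY v).toLinearMap := by
  rw [ker_toY, (ambientModel v).ker_toR v (by omega)]
  exact (ambientModel v).isotypic_shape221_sup_isotypic_shape222 v hd

theorem toY_surjective : Function.Surjective (toY v) := by
  refine LinearMap.range_eq_top.1 (eq_top_iff.2 ?_)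
  rw [← span_genY v, Submodule.span_le]
  rintro _ ⟨a, j, i, k, rfl⟩
  exact ⟨_, toY_genT v a j i k⟩

theorem leftInverse_toY_iff (ψ : (Yrep v).IntertwiningMap (ambientRep W d)) :
    Function.LeftInverse (toY v) ψ ↔ ∀ a j i k,
      ψ (genY v a j i k) - genT v a j i k ∈ LinearMap.ker (toY v).toLinearMap := by
  have h_mem : ∀ a j i k, ψ (genY v a j i k) - genT v a j i k ∈ LinearMap.ker (toY v).toLinearMap ↔
      toY v (ψ (genY v a j i k)) = genY v a j i k := fun a j i k => by
    rw [← toY_genT, ← sub_eq_zero, ← map_sub]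
    rfl
  simp only [h_mem]
  refine ⟨fun h a j i k => h _, fun h y => ?_⟩
  suffices (toY v).toLinearMap ∘ₗ ψ.toLinearMap = LinearMap.id from LinearMap.congr_fun this y
  refine LinearMap.ext_on (span_genY v) ?_
  rintro _ ⟨a, j, i, k, rfl⟩
  exact h a j i k

end ToY

end

end HilbertSymmetric

open HilbertSymmetric in
theorem mainTheorem6 (d : ℕ) (hd : 3 ≤ d) {W : Type*} [AddCommGroup W] [Module ℂ W]
    (v : Module.Basis (Fin d) ℂ W) :
    ∃ (φ : (Yrep v).IntertwiningMap (ambientRep W d))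
      (e : (Yrep v).Equiv ((schurRep W (shape321 d)).prod (schurRep W (shape311 d)))),
      (∀ a j i k : Fin d, φ (genY v a j i k) - genT v a j i k ∈ remainingIsotypic W d) ∧
      (∀ ψ : (Yrep v).IntertwiningMap (ambientRep W d),
        (∀ a j i k : Fin d, ψ (genY v a j i k) - genT v a j i k ∈ remainingIsotypic W d) →
          ψ = φ) ∧
      Function.Injective φ ∧
      Submodule.map φ.toLinearMap
          (Submodule.comap e.toLinearMap (LinearMap.range (LinearMap.inl ℂ _ _))) =
        isotypic (ambientRep W d) (schurRep W (shape321 d)) ∧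
      Submodule.map φ.toLinearMap
          (Submodule.comap e.toLinearMap (LinearMap.range (LinearMap.inr ℂ _ _))) =
        isotypic (ambientRep W d) (schurRep W (shape311 d)) ∧
      IsCompl (LinearMap.range φ.toLinearMap) (remainingIsotypic W d) := by
  have : NeZero d := ⟨by omega⟩
  obtain ⟨φ, e, hφ, h_unique, h_inl, h_inr, h_compl⟩ :=
    (ambientModel v).exists_unique_section v hd (toY_surjective v) (ker_toY v)
  rw [remainingIsotypic_eq_ker_toY v hd]
  exact ⟨φ, e, (leftInverse_toY_iff v φ).1 hφ,
    fun ψ hψ => h_unique ψ ((leftInverse_toY_iff v ψ).2 hψ), hφ.injective, h_inl, h_inr, h_compl⟩
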